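/- \textbf{Setting.} Let $N\ge 1$ and $\beta\in\mathbb C\setminus\{0\}$. For $k\in\mathbb Z$ write $k=\underline{k}-N\overline{k}$ with $\underline{k}\in\{1,\dots,N\}$, $\overline{k}\in\mathbb Z$. Let $V=\mathbb C^N$ with basis $v_1,\dots,v_N$, let $u_k=z^{\overline{k}}\otimes v_{\underline{k}}$ $(k\in\mathbb Z)$ be the corresponding basis of $\mathbb C[z^{\pm1}]\otimes V$, and for $k\in\mathbb Z^n$ let $$\hat u_k=u_{k_1}\wedge\dots\wedge u_{k_n}=\sum_{w\in S_n}\mathrm{sign}(w)\,u_{k_{w(1)}}\otimes\dots\otimes u_{k_{w(n)}}\in \mathbb C[z_1^{\pm1},\dots,z_n^{\pm1}]\otimes V^{\otimes n}.$$ Let $F_{N,n}$ be the span of all wedges $\hat u_k$. Let $o=(0,-1,-2,\dots)$ and let $F^0_{N,n}\subset F_{N,n}$ be the span of the linearly independent wedges $\hat u_k$ with $k_1>\dots>k_n$ and $k_i\ge o_i=-i+1$ for all $i$. Let $F^{0,(d)}_{N,n}$ be the span of those with $\sum_{i=1}^n(\overline{o_i}-\overline{k_i})=d$. For $l\ge r\ge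 0$ let $\pi_{l,r}:F^0_{N,lN}\to F^0_{N,rN}$ be the linear map sending $\hat u_{(k_1,\dots,k_{lN})}$ to $\hat u_{(k_1,\dots,k_{rN})}$ if $k_i=o_i$ for all $i>rN$, and to $0$ otherwise. With $D_i=z_i\partial/\partial z_i$, $\theta_{ij}=z_i/(z_i-z_j)$, and $K_{ij}$ the exchange of the variables $z_i,z_j$, let $$d_i(\beta)=\beta^{-1}D_i+n-i+\sum_{i<j\le n}\theta_{ji}(K_{ij}-1)-\sum_{1\le j<i}\theta_{ij}(K_{ij}-1),\qquad i=1,\dots,n,$$ be the Cherednik--Dunkl operators on $\mathbb C[z_1^{\pm1},\dots,z_n^{\pm1}]$. Let $E_{ab}^{(i)}$ be the matrix unit $E_{ab}$ acting in the $i$-th factor of $V^{\otimes n}$, and put $$L^{(i)}_{ab}(u)=\delta_{ab}+(u+d_i(\beta))^{-1}\otimes E_{ba}^{(i)},\qquad T_{ab}(u;\beta;n)=\sum_{c_1,\dots,c_{n-1}=1}^N L^{(1)}_{ac_1}(u)L^{(2)}_{c_1c_2}(u)\cdots L^{(n)}_{c_{n-1}b}(u)$$ (with $T_{ab}(u;\beta;0)=\delta_{ab}$),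 expanded in powers of $u^{-1}$. For $r\ge0$ let $$\overline{T}_{ab}(u;\beta;rN)=f(u;r)\,T_{ab}(u;\beta;rN)=\sum_{s\ge0}\overline{T}{}^{(s)}_{ab}(\beta;rN)u^{-s},\qquad f(u;r)=\prod_{s=1}^r\frac{u+(\beta^{-1}+N)s-1}{u+(\beta^{-1}+N)s}.$$ Let $F_N^{0,(d)}=\varprojlim_r F^{0,(d)}_{N,rN}$ be the space of sequences $(g_r)_{r\ge0}$, $g_r\in F^{0,(d)}_{N,rN}$, with $\pi_{l,r}(g_l)=g_r$ for all $l\ge r$. Let $F$ be the Fock space, generated by the semi-infinite wedges $\hat u_k=u_{k_1}\wedge u_{k_2}\wedge\cdots$, where $k_i\in\mathbb Z$ and $k_i=-i+1$ for all but finitely many $i$, modulo the relations that exchanging two neighbouring factors changes the sign. Let $F^{(d)}$ be the span of the $\hat u_k$ with $k$ strictly decreasing and $\sum_{i\ge1}(\overline{o_i}-\overline{k_i})=d$, and let $|m\rangle=u_m\wedge u_{m-1}\wedge\cdots$. The Yangian $Y(\mathfrak{gl}_N)$ is the unital associative $\mathbb C$-algebra generated by $T^{(s)}_{ab}$ ($s\ge1$,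 $1\le a,b\le N$) subject to $(u-v)[T_{ab}(u),T_{cd}(v)]=T_{cb}(v)T_{ad}(u)-T_{cb}(u)T_{ad}(v)$, where $T_{ab}(u)=\delta_{ab}+\sum_{s\ge1}T^{(s)}_{ab}u^{-s}$. \textbf{Proposition.} For all $r,d,s\ge0$ and $a,b=1,\dots,N$ the operator $\overline{T}{}_{ab}^{(s)}(\beta;rN)$ leaves $F_{N,rN}$, $F^0_{N,rN}$ and $F^{0,(d)}_{N,rN}$ invariant, and on $F^0_{N,rN+N}$ the intertwining relations $$\pi_{r+1,r}\,\overline{T}_{ab}(u;\beta;rN+N)=\overline{T}_{ab}(u;\beta;rN)\,\pi_{r+1,r}$$ hold. Consequently: (i) for each $d\ge0$ there is a unique action of $Y(\mathfrak{gl}_N)$ on $F_N^{0,(d)}$ such that $T^{(s)}_{ab}(g_r)_{r\ge0}=\bigl(\overline{T}{}^{(s)}_{ab}(\beta;rN)g_r\bigr)_{r\ge0}$; (ii) for each $d\ge 0$ the map $(g_r)_{r\ge 0}\mapsto g_r\wedge|-rN\rangle$ does not depend on $r\ge d$ and is an isomorphism of $F_N^{0,(d)}$ onto $F^{(d)}$;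 moreover $F=\bigoplus_{d\ge0}F^{(d)}$; (iii) there is a unique action of $Y(\mathfrak{gl}_N)$ on $F$ such that $T^{(s)}_{ab}\bigl(g_r\wedge|-rN\rangle\bigr)=\bigl(\overline{T}{}^{(s)}_{ab}(\beta;rN)g_r\bigr)\wedge|-rN\rangle$ for all $a,b=1,\dots,N$, $s\ge1$, $d\ge0$, $(g_r)_{r\ge0}\in F_N^{0,(d)}$ and $r\ge d$. -/

import Mathlib

open scoped TensorProduct

noncomputable section

namespace SpinSutherland

/-! ### Laurent polynomials and Cherednik-Dunkl operators -/

/-- The Laurent polynomials `ℂ[z₁^{±1}, …, z_n^{±1}]`. -/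
abbrev Laurent (n : ℕ) : Type := AddMonoidAlgebra ℂ (Fin n → ℤ)

/-- The monomial `z^t`. -/
def mono {n : ℕ} (t : Fin n → ℤ) : Laurent n := AddMonoidAlgebra.single t 1

/-- The linear operator on Laurent polynomials with prescribed values on the monomials. -/
def onMono {n : ℕ} (g : (Fin n → ℤ) → Laurent n) : Laurent n →ₗ[ℂ] Laurent n :=
  Finsupp.linearCombination ℂ g ∘ₗ
    (AddMonoidAlgebra.coeffLinearEquiv ℂ : Laurent n ≃ₗ[ℂ] ((Fin n → ℤ) →₀ ℂ)).toLinearMap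

theorem onMono_mono {n : ℕ} (g : (Fin n → ℤ) → Laurent n) (t : Fin n → ℤ) :
    onMono g (mono t) = g t := by
  simp [onMono, mono]

/-- The coordinate permutation `K_{pq}`, exchanging the variables `z_p` and `z_q`. -/
def permK {n : ℕ} (p q : Fin n) : Laurent n →ₗ[ℂ] Laurent n :=
  onMono fun t => mono (t ∘ Equiv.swap p q)

/-- The operator `D_i = z_i ∂/∂z_i`. -/
def eulerD {n : ℕ} (i : Fin n) : Laurent n →ₗ[ℂ] Laurent n :=
  onMono fun t => (t i : ℂ) • mono t

/-- The monomial obtained from `z^t` by replacing the exponents of `z_p`, `z_q` by `x`, `y`. -/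
def mono₂ {n : ℕ} (t : Fin n → ℤ) (p q : Fin n) (x y : ℤ) : Laurent n :=
  mono (Function.update (Function.update t p x) q y)

/-- The operator `θ_{pq} (K_{pq} - 1)` with `θ_{pq} = z_p / (z_p - z_q)`, for `p ≠ q`, written out
on monomials (the division is carried out, see `thetaK_spec`). -/
def thetaK {n : ℕ} (p q : Fin n) : Laurent n →ₗ[ℂ] Laurent n :=
  onMono fun t =>
    (∑ l ∈ Finset.range (t q - t p).toNat, mono₂ t p q (t q - l) (t p + l)) -
      ∑ l ∈ Finset.range (t p - t q).toNat, mono₂ t p q (t p - l) (t q + l)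

theorem mono₂_mul_left {n : ℕ} (t : Fin n → ℤ) {p q : Fin n} (h : p ≠ q) (x y : ℤ) :
    mono (Pi.single p 1) * mono₂ t p q x y = mono₂ t p q (x + 1) y := by
  unfold mono₂ mono
  rw [AddMonoidAlgebra.single_mul_single, one_mul]
  congr 1
  funext i
  by_cases hq : i = q
  · subst hq; simp [h.symm]
  · by_cases hp : i = p
    · subst hp; simp [hq, add_comm]
    · simp [hq, hp]

theorem mono₂_mul_right {n : ℕ} (t : Fin n → ℤ) {p q : Fin n} (h : p ≠ q) (x y : ℤ) :
    mono (Pi.single q 1) * mono₂ t p q x y = mono₂ t p q x (y + 1) := by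
  unfold mono₂ mono
  rw [AddMonoidAlgebra.single_mul_single, one_mul]
  congr 1
  funext i
  by_cases hq : i = q
  · subst hq; simp [add_comm]
  · by_cases hp : i = p
    · subst hp; simp [hq]
    · simp [hq, hp]

theorem thetaK_telescope {n : ℕ} (t : Fin n → ℤ) {p q : Fin n} (h : p ≠ q) (x y : ℤ) (m : ℕ) :
    (mono (Pi.single p 1) - mono (Pi.single q 1)) *
        ∑ l ∈ Finset.range m, mono₂ t p q (x - l) (y + l) =
      mono₂ t p q (x + 1) y - mono₂ t p q (x + 1 - m) (y + m) := by
  induction m with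
  | zero => simp
  | succ m ih =>
    rw [Finset.sum_range_succ, mul_add, ih, sub_mul, mono₂_mul_left t h, mono₂_mul_right t h]
    push_cast
    rw [show x - (m : ℤ) + 1 = x + 1 - m by ring, show x + 1 - ((m : ℤ) + 1) = x - m by ring,
      show y + ((m : ℤ) + 1) = y + m + 1 by ring]
    abel

/-- `(z_p - z_q) · θ_{pq}(K_{pq} - 1) f = z_p · (K_{pq} f - f)`. -/
theorem thetaK_spec {n : ℕ} {p q : Fin n} (h : p ≠ q) (f : Laurent n) :
    (mono (Pi.single p 1) - mono (Pi.single q 1)) * thetaK p q f =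
      mono (Pi.single p 1) * (permK p q f - f) := by
  have key : (LinearMap.mulLeft ℂ (mono (Pi.single p 1) - mono (Pi.single q 1) : Laurent n)) ∘ₗ
      thetaK p q = (LinearMap.mulLeft ℂ (mono (Pi.single p 1) : Laurent n)) ∘ₗ
        (permK p q - LinearMap.id) := by
    refine AddMonoidAlgebra.lhom_ext' fun t => LinearMap.ext_ring ?_
    change (mono (Pi.single p 1) - mono (Pi.single q 1)) * thetaK p q (mono t) =
      mono (Pi.single p 1) * (permK p q (mono t) - mono t)
    have e1 : mono t = mono₂ t p q (t p) (t q) := by simp [mono₂]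
    have e2 : mono (t ∘ Equiv.swap p q) = mono₂ t p q (t q) (t p) := by
      unfold mono₂
      congr 1
      funext i
      by_cases hq : i = q
      · subst hq; simp
      · by_cases hp : i = p
        · subst hp; simp [hq]
        · simp [hq, hp, Equiv.swap_apply_of_ne_of_ne]
    rw [thetaK, permK, onMono_mono, onMono_mono, mul_sub, thetaK_telescope t h,
      thetaK_telescope t h, e2, mul_sub, mono₂_mul_left t h, e1, mono₂_mul_left t h]
    rcases le_total (t p) (t q) with hle | hle
    · have h1 : ((t q - t p).toNat : ℤ) = t q - t p := Int.toNat_of_nonneg (by omega)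
      have h2 : ((t p - t q).toNat : ℤ) = 0 := by omega
      rw [h1, h2, show t q + 1 - (t q - t p) = t p + 1 by ring,
        show t p + (t q - t p) = t q by ring]
      simp
    · have h1 : ((t p - t q).toNat : ℤ) = t p - t q := Int.toNat_of_nonneg (by omega)
      have h2 : ((t q - t p).toNat : ℤ) = 0 := by omega
      rw [h1, h2, show t p + 1 - (t p - t q) = t q + 1 by ring,
        show t q + (t p - t q) = t p by ring]
      simp
  exact LinearMap.congr_fun key f

/-- The Cherednik-Dunkl operator
`d_i(β) = β⁻¹ D_i + n - i + ∑_{j > i} θ_{ji}(K_{ij} - 1) - ∑_{j < i} θ_{ij}(K_{ij} - 1)`;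
the index `i : Fin n` starts at `0`. -/
def dunkl {n : ℕ} (β : ℂ) (i : Fin n) : Module.End ℂ (Laurent n) :=
  β⁻¹ • eulerD i + ((n : ℂ) - ((i : ℕ) + 1)) • LinearMap.id +
    ∑ j ∈ Finset.univ.filter (fun j => i < j), thetaK j i -
    ∑ j ∈ Finset.univ.filter (fun j => j < i), thetaK i j

/-! ### The space `ℂ[z^{±1}] ⊗ (ℂ^N)^{⊗ n}` and the operators `T_{ab}(u; β; n)` -/

/-- The tensor power `(ℂ^N)^{⊗ n}`. -/
abbrev Spin (N n : ℕ) : Type := ⨂[ℂ] _ : Fin n, (Fin N → ℂ)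

/-- The space `V(z)^{⊗ n} = ℂ[z₁^{±1}, …, z_n^{±1}] ⊗ (ℂ^N)^{⊗ n}`. -/
abbrev Amb (N n : ℕ) : Type := Laurent n ⊗[ℂ] Spin N n

/-- The matrix unit `E_{ab}` (with `E_{ab} v_c = δ_{bc} v_a`) acting in the `i`-th factor. -/
def unitAt (N : ℕ) {n : ℕ} (a b : Fin N) (i : Fin n) : Module.End ℂ (Spin N n) :=
  PiTensorProduct.map
    (Function.update (fun _ => LinearMap.id) i (Matrix.toLin' (Matrix.single a b (1 : ℂ))))

/-- The `L`-operator `L_{ab}^{(i)}(u) = δ_{ab} + (u + d_i(β))⁻¹ ⊗ E_{ba}^{(i)}`, expanded as a power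
series in the variable `X = u⁻¹`, so that `(u + d)⁻¹ = ∑_{s ≥ 0} (-d)^s X^{s+1}`. -/
def lOp (N : ℕ) {n : ℕ} (β : ℂ) (i : Fin n) :
    Matrix (Fin N) (Fin N) (PowerSeries (Module.End ℂ (Amb N n))) :=
  fun a b => PowerSeries.mk fun s =>
    match s with
    | 0 => if a = b then 1 else 0
    | s + 1 => TensorProduct.map ((-dunkl β i) ^ s) (unitAt N b a i)

/-- The series `T_{ab}(u; β; n)` in `X = u⁻¹`: the entries of `L^{(1)}(u) ⋯ L^{(n)}(u)`. -/
def tSeries (N n : ℕ) (β : ℂ) :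
    Matrix (Fin N) (Fin N) (PowerSeries (Module.End ℂ (Amb N n))) :=
  (List.ofFn fun i : Fin n => lOp N β i).prod

/-- The expansion in `X = u⁻¹` of
`f(u; r) = ∏_{s=1}^r (u + (β⁻¹ + N) s - 1) / (u + (β⁻¹ + N) s)`; each factor is written as
`(1 + ((β⁻¹ + N) s - 1) X) · (1 + (β⁻¹ + N) s X)⁻¹`. -/
def fSeries (N : ℕ) (β : ℂ) (r : ℕ) : PowerSeries ℂ :=
  ∏ s ∈ Finset.Icc 1 r,
    ((1 + PowerSeries.C ((β⁻¹ + N) * s - 1) * PowerSeries.X) *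
      (1 + PowerSeries.C ((β⁻¹ + N) * s) * PowerSeries.X)⁻¹)

/-- The renormalized series `T̄_{ab}(u; β; rN) = f(u; r) T_{ab}(u; β; rN)`. -/
def tBarSeries (N : ℕ) (β : ℂ) (r : ℕ) (a b : Fin N) :
    PowerSeries (Module.End ℂ (Amb N (r * N))) :=
  PowerSeries.map (algebraMap ℂ (Module.End ℂ (Amb N (r * N)))) (fSeries N β r) *
    tSeries N (r * N) β a b

/-- The coefficient `T̄_{ab}^{(s)}(β; rN)` of `u^{-s}`. -/
def tBar (N : ℕ) (β : ℂ) (r s : ℕ) (a b : Fin N) : Module.End ℂ (Amb N (r * N)) :=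
  PowerSeries.coeff s (tBarSeries N β r a b)

/-! ### Wedges -/

/-- For `k = k̲ - N k̄` with `k̲ ∈ {1, …, N}`: the integer `k̄`. -/
def bar (N : ℕ) (k : ℤ) : ℤ := -((k - 1) / N)

/-- For `k = k̲ - N k̄` with `k̲ ∈ {1, …, N}`: the index of `v_{k̲}`, that is `k̲ - 1 ∈ Fin N`. -/
def under (N : ℕ) [NeZero N] (k : ℤ) : Fin N :=
  ⟨((k - 1) % N).toNat, by
    have hN : (0 : ℤ) < N := by exact_mod_cast Nat.pos_of_ne_zero (NeZero.ne N)
    have h0 := Int.emod_nonneg (k - 1) hN.ne'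
    have h1 := Int.emod_lt_of_pos (k - 1) hN
    omega⟩

theorem under_bar (N : ℕ) [NeZero N] (k : ℤ) : k = ((under N k : ℕ) + 1 : ℤ) - N * bar N k := by
  have hN : (0 : ℤ) < N := by exact_mod_cast Nat.pos_of_ne_zero (NeZero.ne N)
  have h0 := Int.emod_nonneg (k - 1) hN.ne'
  have h2 := Int.emod_add_mul_ediv (k - 1) N
  simp only [under, bar, Int.toNat_of_nonneg h0]
  linarith

/-- The vector `u_k = z^{k̄} ⊗ v(k̲)`. -/
def uvec (N : ℕ) [NeZero N] {n : ℕ} (k : Fin n → ℤ) : Amb N n :=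
  mono (fun i => bar N (k i)) ⊗ₜ[ℂ]
    PiTensorProduct.tprod ℂ (fun i => (Pi.single (under N (k i)) 1 : Fin N → ℂ))

/-- The wedge `û_k = u_{k_1} ∧ ⋯ ∧ u_{k_n} = ∑_w sign(w) u_{k ∘ w}`. -/
def wedge (N : ℕ) [NeZero N] {n : ℕ} (k : Fin n → ℤ) : Amb N n :=
  ∑ w : Equiv.Perm (Fin n), ((Equiv.Perm.sign w : ℤ) : ℂ) • uvec N (k ∘ w)

/-- The space of states `F_{N,n}`, the span of all wedges (the image of the antisymmetrizer). -/
def stateSpace (N : ℕ) [NeZero N] (n : ℕ) : Submodule ℂ (Amb N n) :=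
  Submodule.span ℂ (Set.range fun k : Fin n → ℤ => wedge N k)

/-- The strictly decreasing sequences `k = (k_1, …, k_n)` with `k ⊇ o`, where
`o = (0, -1, …, -n + 1)`; the index of `k` starts at `0`. -/
abbrev Seq (n : ℕ) : Type :=
  {k : Fin n → ℤ // StrictAnti k ∧ ∀ i : Fin n, -((i : ℕ) : ℤ) ≤ k i}

theorem uvec_coord (N : ℕ) [NeZero N] {n : ℕ} (l : Fin n → ℤ) :
    ∃ φ : Amb N n →ₗ[ℂ] ℂ, ∀ k : Fin n → ℤ, φ (uvec N k) = if k = l then 1 else 0 := by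
  let B := (AddMonoidAlgebra.basis (Fin n → ℤ) ℂ).tensorProduct
    (Basis.piTensorProduct fun _ : Fin n => Pi.basisFun ℂ (Fin N))
  refine ⟨B.coord (fun i => bar N (l i), fun i => under N (l i)), fun k => ?_⟩
  have h : uvec N k = B (fun i => bar N (k i), fun i => under N (k i)) := by
    simp [B, uvec, mono, Module.Basis.tensorProduct_apply, Basis.piTensorProduct_apply]
  rw [h, Module.Basis.coord_apply, Module.Basis.repr_self, Finsupp.single_apply]
  congr 1
  refine propext ⟨fun e => ?_, fun e => by rw [e]⟩
  funext i
  have e1 := congrFun (congrArg Prod.fst e) i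
  have e2 := congrFun (congrArg Prod.snd e) i
  simp only at e1 e2
  rw [under_bar N (k i), under_bar N (l i), e1, e2]

theorem strictAnti_comp_perm {n : ℕ} {k l : Fin n → ℤ} (hk : StrictAnti k) (hl : StrictAnti l)
    (w : Equiv.Perm (Fin n)) (h : k ∘ w = l) : w = 1 := by
  have hw : StrictMono w := fun i j hij => by
    have h1 := hl hij
    rw [← h] at h1
    exact hk.lt_iff_gt.mp h1
  have := Subsingleton.elim (hw.orderIsoOfSurjective w w.surjective) (OrderIso.refl _)
  ext i
  exact congrArg Fin.val (congrArg (fun e : Fin n ≃o Fin n => e i) this)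

theorem wedge_coord (N : ℕ) [NeZero N] {n : ℕ} (l : Fin n → ℤ) (hl : StrictAnti l) :
    ∃ φ : Amb N n →ₗ[ℂ] ℂ, ∀ k : Fin n → ℤ, StrictAnti k →
      φ (wedge N k) = if k = l then 1 else 0 := by
  obtain ⟨φ, hφ⟩ := uvec_coord N l
  refine ⟨φ, fun k hk => ?_⟩
  simp only [wedge, map_sum, map_smul, hφ, smul_eq_mul]
  rw [Finset.sum_eq_single (1 : Equiv.Perm (Fin n))]
  · simp
  · intro w _ hw
    rw [if_neg fun e => hw (strictAnti_comp_perm hk hl w e), mul_zero]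
  · simp

theorem wedge_linearIndependent (N : ℕ) [NeZero N] (n : ℕ) :
    LinearIndependent ℂ fun k : Seq n => wedge N k.1 := by
  choose φ hφ using fun l : Seq n => wedge_coord N l.1 l.2.1
  refine LinearIndependent.of_pairwise_dual_eq_zero_one _ φ (fun i j hij => ?_) fun i => ?_
  · change φ i (wedge N j.1) = 0
    rw [hφ i j.1 j.2.1, if_neg fun e => hij (Subtype.ext e.symm)]
  · rw [hφ i i.1 i.2.1, if_pos rfl]

/-- The space `F⁰_{N,n} ⊆ F_{N,n}`, the span of the wedges `û_k` with `k ∈ Seq n`. -/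
def F0 (N : ℕ) [NeZero N] (n : ℕ) : Submodule ℂ (Amb N n) :=
  Submodule.span ℂ (Set.range fun k : Seq n => wedge N k.1)

/-- The basis `û_k`, `k ∈ Seq n`, of `F⁰_{N,n}`. -/
def wedgeBasis (N : ℕ) [NeZero N] (n : ℕ) : Module.Basis (Seq n) ℂ (F0 N n) :=
  Module.Basis.span (wedge_linearIndependent N n)

theorem wedgeBasis_apply (N : ℕ) [NeZero N] (n : ℕ) (k : Seq n) :
    (wedgeBasis N n k : Amb N n) = wedge N k.1 :=
  congrArg Subtype.val (Module.Basis.span_apply (wedge_linearIndependent N n) k)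

theorem F0_le_stateSpace (N : ℕ) [NeZero N] (n : ℕ) : F0 N n ≤ stateSpace N n :=
  Submodule.span_mono (Set.range_subset_iff.mpr fun k => ⟨k.1, rfl⟩)

/-- The sequence `(k_1, …, k_n)` of the first `n` entries of `k = (k_1, …, k_m)`. -/
def Seq.take {m n : ℕ} (h : n ≤ m) (k : Seq m) : Seq n :=
  ⟨fun i => k.1 (Fin.castLE h i),
    fun _ _ hij => k.2.1 ((Fin.castLE_lt_castLE_iff h).mpr hij), fun i => k.2.2 (Fin.castLE h i)⟩

open Classical in
/-- The projection `F⁰_{N,m} → F⁰_{N,n}` that sends `û_k` to `û_{(k_1, …, k_n)}` if the partition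
`k - o` has length at most `n` (its parts beyond the `n`-th one vanish), and to `0` otherwise. -/
def proj (N : ℕ) [NeZero N] {m n : ℕ} (h : n ≤ m) : F0 N m →ₗ[ℂ] F0 N n :=
  (wedgeBasis N m).constr ℂ fun k =>
    if ∀ i : Fin m, n ≤ (i : ℕ) → k.1 i = -((i : ℕ) : ℤ) then wedgeBasis N n (k.take h) else 0

/-- The homogeneous degree `|ō - k̄|` of `û_k`. -/
def Seq.degree (N : ℕ) {n : ℕ} (k : Seq n) : ℤ :=
  ∑ i : Fin n, (bar N (-((i : ℕ) : ℤ)) - bar N (k.1 i))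

/-- The component `F⁰_{N,n}^{(d)}` of homogeneous degree `d` of `F⁰_{N,n}`. -/
def F0deg (N : ℕ) [NeZero N] (n d : ℕ) : Submodule ℂ (F0 N n) :=
  Submodule.span ℂ (wedgeBasis N n '' {k | k.degree N = (d : ℤ)})

/-- The inverse limit `F_N^{0,(d)}` of the spaces `F⁰_{N,rN}^{(d)}`, `r ≥ 0`. -/
def limitSpace (N : ℕ) [NeZero N] (d : ℕ) : Submodule ℂ (∀ r : ℕ, F0 N (r * N)) where
  carrier := {g | (∀ r, g r ∈ F0deg N (r * N) d) ∧
    ∀ (r l : ℕ) (h : r ≤ l), proj N (Nat.mul_le_mul_right N h) (g l) = g r}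
  add_mem' := fun {g g'} hg hg' => ⟨fun r => add_mem (hg.1 r) (hg'.1 r), fun r l h => by
    rw [Pi.add_apply, map_add, hg.2 r l h, hg'.2 r l h, Pi.add_apply]⟩
  zero_mem' := ⟨fun r => zero_mem _, fun r l h => by simp⟩
  smul_mem' := fun c g hg => ⟨fun r => Submodule.smul_mem _ c (hg.1 r), fun r l h => by
    rw [Pi.smul_apply, map_smul, hg.2 r l h, Pi.smul_apply]⟩

/-! ### The Fock space -/

/-- The semi-infinite integer sequences that agree with `(0, -1, -2, …)` from some index on;
the index starts at `0`. -/
abbrev SemiInf : Type := {k : ℕ → ℤ // ∃ m : ℕ, ∀ i, m ≤ i → k i = -(i : ℤ)}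

/-- The sequence `k` with its entries at the positions `i` and `i + 1` exchanged. -/
def SemiInf.swap (k : SemiInf) (i : ℕ) : SemiInf :=
  ⟨k.1 ∘ Equiv.swap i (i + 1), by
    obtain ⟨m, hm⟩ := k.2
    refine ⟨max m (i + 2), fun j hj => ?_⟩
    have h1 : j ≠ i := by have := le_max_right m (i + 2); omega
    have h2 : j ≠ i + 1 := by have := le_max_right m (i + 2); omega
    rw [Function.comp_apply, Equiv.swap_apply_of_ne_of_ne h1 h2]
    exact hm j ((le_max_left _ _).trans hj)⟩

/-- The span of the relations `⋯ ∧ u_{k_i} ∧ u_{k_{i+1}} ∧ ⋯ = - ⋯ ∧ u_{k_{i+1}} ∧ u_{k_i} ∧ ⋯`. -/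
def fockRel : Submodule ℂ (SemiInf →₀ ℂ) :=
  Submodule.span ℂ
    {x | ∃ (k : SemiInf) (i : ℕ), x = Finsupp.single k 1 + Finsupp.single (k.swap i) 1}

/-- The Fock space `F`, generated by the semi-infinite wedges `u_{k_1} ∧ u_{k_2} ∧ ⋯` modulo the
exchange relations. -/
abbrev Fock : Type := (SemiInf →₀ ℂ) ⧸ fockRel

/-- The semi-infinite wedge `û_k = u_{k_1} ∧ u_{k_2} ∧ ⋯`. -/
def siWedge (k : SemiInf) : Fock := fockRel.mkQ (Finsupp.single k 1)

/-- The component `F^{(d)}` of the Fock space of homogeneous degree `d`, spanned by the normally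
ordered `û_k` with `∑_i (ō_i - k̄_i) = d`. -/
def fockDeg (N d : ℕ) : Submodule ℂ Fock :=
  Submodule.span ℂ (siWedge '' {k | StrictAnti k.1 ∧
    ∑ᶠ i : ℕ, (bar N (-(i : ℤ)) - bar N (k.1 i)) = (d : ℤ)})

/-- The sequence `(k_1, …, k_n, -n, -n - 1, …)`. -/
def Seq.extend {n : ℕ} (k : Seq n) : SemiInf :=
  ⟨fun i => if h : i < n then k.1 ⟨i, h⟩ else -(i : ℤ),
    n, fun i hi => dif_neg (by omega)⟩

/-- The map `F⁰_{N,n} → F`, `û_k ↦ û_k ∧ |-n⟩` with `|-n⟩ = u_{-n} ∧ u_{-n-1} ∧ ⋯`. -/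
def withTail (N : ℕ) [NeZero N] (n : ℕ) : F0 N n →ₗ[ℂ] Fock :=
  (wedgeBasis N n).constr ℂ fun k => siWedge k.extend

/-- The map `Υ^{(d)} : F_N^{0,(d)} → F`, `(g_r)_r ↦ g_d ∧ |-Nd⟩`. -/
def upsilon (N : ℕ) [NeZero N] (d : ℕ) : limitSpace N d →ₗ[ℂ] Fock :=
  withTail N (d * N) ∘ₗ LinearMap.proj d ∘ₗ (limitSpace N d).subtype

/-! ### The Yangian -/

/-- The symbols `T_{ab}^{(s)}` in the free algebra, with `T_{ab}^{(0)} = δ_{ab}`. -/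
def freeT (N : ℕ) (s : ℕ) (a b : Fin N) : FreeAlgebra ℂ (ℕ × Fin N × Fin N) :=
  match s with
  | 0 => if a = b then 1 else 0
  | s + 1 => FreeAlgebra.ι ℂ (s, a, b)

/-- The coefficients at `u^{-r} v^{-s}` of the defining relations
`(u - v) [T_{ab}(u), T_{cd}(v)] = T_{cb}(v) T_{ad}(u) - T_{cb}(u) T_{ad}(v)`. -/
inductive YangianRel (N : ℕ) :
    FreeAlgebra ℂ (ℕ × Fin N × Fin N) → FreeAlgebra ℂ (ℕ × Fin N × Fin N) → Prop
  | mk (r s : ℕ) (a b c d : Fin N) : YangianRel N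
      ((freeT N (r + 1) a b * freeT N s c d - freeT N s c d * freeT N (r + 1) a b) -
        (freeT N r a b * freeT N (s + 1) c d - freeT N (s + 1) c d * freeT N r a b))
      (freeT N s c b * freeT N r a d - freeT N r c b * freeT N s a d)

/-- The Yangian `Y(gl_N)`. -/
abbrev Yangian (N : ℕ) : Type := RingQuot (YangianRel N)

/-- The element `T_{ab}^{(s)}` of the Yangian, with `T_{ab}^{(0)} = δ_{ab}`. -/
def yT (N : ℕ) (s : ℕ) (a b : Fin N) : Yangian N :=
  RingQuot.mkAlgHom ℂ (YangianRel N) (freeT N s a b)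

end SpinSutherland

end

noncomputable section

namespace SpinSutherland

/-! ### Relations between the operators on Laurent polynomials -/

/-! The Yangian relations have a formal origin. The operators d_i commute (`dunkl_commute`): each is
a part permuted by the symmetric group plus ∑_{j>i} K_{ij}, and the two commutator defects cancel.
Hence each L-operator is an evaluation module with parameter d_i (`RTT.evaluation`), entries at
different sites commute, and the relation passes to products (`RTT.mul`) and to multiples by the
central series f.

The wedges are preserved because K_{i,i+1} and the d_i satisfy the relations of the degenerate
affine Hecke algebra. With P the exchange of two neighbouring spins, the commutator of KP with
L^{(i)}L^{(i+1)} has the right factor P + K (`antisymmetrizer_relation`), which kills every vector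
with KPx = -x. The d_i only move exponents towards each other, so upper bounds on the exponents and
their total are preserved. For n = rN the condition k_i ≥ o_i on a decreasing sequence is exactly
such a bound (`seq_iff`), and the degree is fixed by the total exponent.

For the intertwining relation, π_{r+1,r} is, up to a sign, the extraction of the coefficient of
u_{-rN} ⊗ ⋯ ⊗ u_{-rN-N+1} in the first N places (`tailPart_eq_proj`). There all N exponents have the
maximal value r+1, and the Dunkl operators are triangular: the first N act on this coefficient by
scalars decreasing in steps of one, the others as the Dunkl operators in rN variables. On vectors
antisymmetric in the first N spins a product of L-operators with such scalars collapses to δ_{ab} +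
(u+c-1)⁻¹ ∑_i E_{ba}^{(i)}, where c = (β⁻¹+N)(r+1) (`prod_absL_agreeAt`). On the top exterior power
of ℂ^N this is the scalar δ_{ab}(u+c)/(u+c-1), the inverse of f(u;r+1)/f(u;r) (`fSeries_succ_mul`).

In degree d a decreasing sequence has k_i = o_i for all i > dN (`AntiSeq.eq_of_siDegree`), so the
inverse limit is reached at r = d. Its identification with F^{(d)} rests on the normally ordered
semi-infinite wedges being a basis of F; their independence is detected by determinants
(`exists_coord_siWedge`). The action on F is then transported from the direct sum of the limits. -/

theorem laurent_hom_ext {n : ℕ} {M : Type*} [AddCommMonoid M] [Module ℂ M]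
    {f g : Laurent n →ₗ[ℂ] M} (h : ∀ t, f (mono t) = g (mono t)) : f = g :=
  AddMonoidAlgebra.lhom_ext' fun t => LinearMap.ext_ring (h t)

theorem permK_mono {n : ℕ} (p q : Fin n) (t : Fin n → ℤ) :
    permK p q (mono t) = mono (t ∘ Equiv.swap p q) := onMono_mono _ _

theorem eulerD_mono {n : ℕ} (i : Fin n) (t : Fin n → ℤ) :
    eulerD i (mono t) = (t i : ℂ) • mono t := onMono_mono _ _

theorem thetaK_mono {n : ℕ} (p q : Fin n) (t : Fin n → ℤ) :
    thetaK p q (mono t) =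
      (∑ l ∈ Finset.range (t q - t p).toNat, mono₂ t p q (t q - l) (t p + l)) -
      ∑ l ∈ Finset.range (t p - t q).toNat, mono₂ t p q (t p - l) (t q + l) := onMono_mono _ _

theorem mono₂_comp_swap {n : ℕ} (t : Fin n → ℤ) (a b p q : Fin n) (x y : ℤ) :
    permK a b (mono₂ t p q x y) =
      mono₂ (t ∘ Equiv.swap a b) (Equiv.swap a b p) (Equiv.swap a b q) x y := by
  rw [mono₂, permK_mono, mono₂]
  congr 1
  rw [Function.update_comp_equiv, Function.update_comp_equiv, Equiv.symm_swap]

theorem permK_mul_thetaK {n : ℕ} (a b p q : Fin n) :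
    permK a b * thetaK p q =
      thetaK (Equiv.swap a b p) (Equiv.swap a b q) * permK a b := by
  refine laurent_hom_ext fun t => ?_
  simp only [Module.End.mul_apply, thetaK_mono, permK_mono, map_sub, map_sum, mono₂_comp_swap,
    Function.comp_apply, Equiv.swap_apply_self]

theorem permK_mul_eulerD {n : ℕ} (a b i : Fin n) :
    permK a b * eulerD i = eulerD (Equiv.swap a b i) * permK a b := by
  refine laurent_hom_ext fun t => ?_
  simp [Module.End.mul_apply, eulerD_mono, permK_mono]

theorem permK_mul_permK {n : ℕ} (a b p q : Fin n) :
    permK a b * permK p q =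
      permK (Equiv.swap a b p) (Equiv.swap a b q) * permK a b := by
  refine laurent_hom_ext fun t => ?_
  simp only [Module.End.mul_apply, permK_mono]
  congr 1
  funext i
  simp only [Function.comp_apply]
  congr 1
  have h := Equiv.swap_apply_apply (Equiv.swap a b) p q
  rw [Equiv.swap_inv] at h
  rw [h]
  simp

theorem permK_mul_self {n : ℕ} (a b : Fin n) : permK a b * permK a b = 1 := by
  refine laurent_hom_ext fun t => ?_
  simp only [Module.End.mul_apply, permK_mono, Module.End.one_apply]
  congr 1
  funext i
  simp

theorem permK_comm {n : ℕ} (a b : Fin n) : permK a b = permK b a := by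
  refine laurent_hom_ext fun t => ?_
  simp only [permK_mono, Equiv.swap_comm]

theorem thetaK_self {n : ℕ} (a : Fin n) : thetaK a a = 0 := by
  refine laurent_hom_ext fun t => ?_
  simp [thetaK_mono]

/-- The variable `z_i`, as an element of the field of rational functions. -/
def ratVar {n : ℕ} (i : Fin n) : FractionRing (Laurent n) :=
  algebraMap (Laurent n) _ (mono (Pi.single i 1))

theorem ratVar_sub_ne_zero {n : ℕ} {i j : Fin n} (h : i ≠ j) :
    (ratVar i : FractionRing (Laurent n)) - ratVar j ≠ 0 := by
  rw [sub_ne_zero]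
  intro e
  have e1 := IsFractionRing.injective (Laurent n) (FractionRing (Laurent n)) e
  have e2 : (Pi.single i 1 : Fin n → ℤ) = Pi.single j 1 :=
    AddMonoidAlgebra.of_injective (R := ℂ) e1
  have := congrFun e2 i
  simp [h] at this

/-- In the field of fractions the divided difference becomes multiplication by z_p/(z_p - z_q), so
operator identities reduce to identities between rational functions. -/
theorem algebraMap_thetaK {n : ℕ} {p q : Fin n} (h : p ≠ q) (f : Laurent n) :
    algebraMap _ (FractionRing (Laurent n)) (thetaK p q f) =
      ratVar p / (ratVar p - ratVar q) *
        (algebraMap _ (FractionRing (Laurent n)) (permK p q f) - algebraMap _ _ f) := by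
  have e := congrArg (algebraMap _ (FractionRing (Laurent n))) (thetaK_spec h f)
  simp only [map_mul, map_sub] at e
  have h0 := ratVar_sub_ne_zero h
  change (ratVar p - ratVar q) * _ = ratVar p * _ at e
  field_simp
  rw [mul_comm]
  exact e

theorem laurent_ext_rat {n : ℕ} {A B : Module.End ℂ (Laurent n)}
    (h : ∀ f, algebraMap _ (FractionRing (Laurent n)) (A f) = algebraMap _ _ (B f)) : A = B :=
  LinearMap.ext fun f => IsFractionRing.injective (Laurent n) (FractionRing (Laurent n)) (h f)

/-- The two rational coefficients z_p/(z_p - z_q) and z_q/(z_q - z_p) add up to 1. -/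
theorem thetaK_add_thetaK {n : ℕ} {p q : Fin n} (h : p ≠ q) :
    thetaK p q + thetaK q p = permK p q - 1 := by
  refine laurent_ext_rat fun f => ?_
  have h0 := ratVar_sub_ne_zero h
  have h1 := ratVar_sub_ne_zero h.symm
  simp only [LinearMap.add_apply, LinearMap.sub_apply, map_add, map_sub, algebraMap_thetaK h,
    algebraMap_thetaK h.symm, permK_comm q p, Module.End.one_apply]
  field_simp
  ring

theorem permK_thetaK_apply {n : ℕ} (a b p q : Fin n) (f : Laurent n) :
    permK a b (thetaK p q f) =
      thetaK (Equiv.swap a b p) (Equiv.swap a b q) (permK a b f) :=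
  LinearMap.congr_fun (permK_mul_thetaK a b p q) f

theorem permK_permK_apply {n : ℕ} (a b p q : Fin n) (f : Laurent n) :
    permK a b (permK p q f) =
      permK (Equiv.swap a b p) (Equiv.swap a b q) (permK a b f) :=
  LinearMap.congr_fun (permK_mul_permK a b p q) f

theorem thetaK_commute {n : ℕ} {i j k l : Fin n} (hij : i ≠ j) (hkl : k ≠ l) (hik : i ≠ k)
    (hil : i ≠ l) (hjk : j ≠ k) (hjl : j ≠ l) :
    Commute (thetaK i j) (thetaK k l) := by
  refine laurent_ext_rat fun f => ?_
  have h1 := permK_thetaK_apply i j k l f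
  have h2 := permK_thetaK_apply k l i j f
  have h3 := permK_permK_apply i j k l f
  rw [Equiv.swap_apply_of_ne_of_ne hik.symm hjk.symm,
    Equiv.swap_apply_of_ne_of_ne hil.symm hjl.symm] at h1 h3
  rw [Equiv.swap_apply_of_ne_of_ne hik hil, Equiv.swap_apply_of_ne_of_ne hjk hjl] at h2
  simp only [Module.End.mul_apply, algebraMap_thetaK hij, algebraMap_thetaK hkl, h1, h2, h3]
  ring

theorem permK_braid {n : ℕ} {i j k : Fin n} (hij : i ≠ j) (hik : i ≠ k) (f : Laurent n) :
    permK j k (permK i j f) = permK i k (permK j k f) := by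
  rw [permK_permK_apply, Equiv.swap_apply_of_ne_of_ne hij hik, Equiv.swap_apply_left]

/-- This collects everything that a third index k contributes to the commutator of the equivariant
parts of d_i and d_j. -/
theorem thetaK_three_term {n : ℕ} {i j k : Fin n} (hij : i ≠ j) (hik : i ≠ k) (hjk : j ≠ k) :
    (thetaK i k * thetaK j k - thetaK j k * thetaK i k) +
      (thetaK i j * thetaK j k - thetaK j k * thetaK i j) +
      (thetaK i k * thetaK j i - thetaK j i * thetaK i k) =
    (thetaK i k - thetaK j k) * permK i j := by
  refine laurent_ext_rat fun f => ?_
  have a1 : permK i k (thetaK j k f) = thetaK j i (permK i k f) := by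
    rw [permK_thetaK_apply, Equiv.swap_apply_of_ne_of_ne hij.symm hjk, Equiv.swap_apply_right]
  have a2 : permK j k (thetaK i k f) = thetaK i j (permK j k f) := by
    rw [permK_thetaK_apply, Equiv.swap_apply_of_ne_of_ne hij hik, Equiv.swap_apply_right]
  have a3 : permK i j (thetaK j k f) = thetaK i k (permK i j f) := by
    rw [permK_thetaK_apply, Equiv.swap_apply_of_ne_of_ne hik.symm hjk.symm,
      Equiv.swap_apply_right]
  have a4 : permK j k (thetaK i j f) = thetaK i k (permK j k f) := by
    rw [permK_thetaK_apply, Equiv.swap_apply_of_ne_of_ne hij hik, Equiv.swap_apply_left]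
  have a5 : permK i k (thetaK j i f) = thetaK j k (permK i k f) := by
    rw [permK_thetaK_apply, Equiv.swap_apply_of_ne_of_ne hij.symm hjk, Equiv.swap_apply_left]
  have a6 : permK i j (thetaK i k f) = thetaK j k (permK i j f) := by
    rw [permK_thetaK_apply, Equiv.swap_apply_of_ne_of_ne hik.symm hjk.symm,
      Equiv.swap_apply_left]
  -- Products of two distinct transpositions of i, j, k are 3-cycles. `b1` to `b4` bring them to the
  -- two normal forms K_{ik}K_{jk} and K_{ik}K_{ij}; the rational coefficients are then compared.
  have b1 := permK_braid hij hik f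
  have b2 : permK i j (permK i k f) = permK i k (permK j k f) := by
    rw [permK_comm i k, permK_braid hik.symm hjk.symm, permK_comm k j, b1, permK_comm k i]
  have b4 : permK i j (permK j k f) = permK i k (permK i j f) := by
    rw [permK_comm i j, permK_comm j k, permK_braid hjk.symm hik.symm, permK_comm k i]
  have b3 : permK j k (permK i k f) = permK i k (permK i j f) := by
    rw [permK_comm j k, permK_braid hik hij, permK_comm k j, b4]
  have h1 := ratVar_sub_ne_zero hij
  have h2 := ratVar_sub_ne_zero hik
  have h3 := ratVar_sub_ne_zero hjk
  have h4 := ratVar_sub_ne_zero hij.symm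
  simp only [Module.End.mul_apply, LinearMap.add_apply, LinearMap.sub_apply, map_add, map_sub,
    algebraMap_thetaK hij, algebraMap_thetaK hik, algebraMap_thetaK hjk, algebraMap_thetaK hij.symm,
    a1, a2, a3, a4, a5, a6, permK_comm j i, b1, b2, b3, b4]
  have h4' : (ratVar j : FractionRing (Laurent n)) - ratVar i = -(ratVar i - ratVar j) := by ring
  rw [h4']
  field_simp
  ring

theorem eulerD_commute {n : ℕ} (i j : Fin n) : Commute (eulerD i) (eulerD j) := by
  refine laurent_hom_ext fun t => ?_
  simp only [Module.End.mul_apply, eulerD_mono, map_smul]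
  rw [smul_comm]

theorem eulerD_mono₂ {n : ℕ} (t : Fin n → ℤ) (p q : Fin n) (x y : ℤ) (i : Fin n) :
    eulerD i (mono₂ t p q x y) =
      ((if i = q then y else if i = p then x else t i : ℤ) : ℂ) • mono₂ t p q x y := by
  rw [mono₂, eulerD_mono]
  congr 2
  simp only [Function.update_apply]

theorem eulerD_commute_thetaK {n : ℕ} {i p q : Fin n} (hp : i ≠ p) (hq : i ≠ q) :
    Commute (eulerD i) (thetaK p q) := by
  refine laurent_hom_ext fun t => ?_
  simp [Module.End.mul_apply, eulerD_mono, thetaK_mono, eulerD_mono₂ t p q, hp, hq,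
    Finset.smul_sum, smul_sub]

/-- D_p + D_q measures the total degree in z_p and z_q, which the divided difference preserves. -/
theorem eulerD_add_commute_thetaK {n : ℕ} {p q : Fin n} (hpq : p ≠ q) :
    Commute (eulerD p + eulerD q) (thetaK p q) := by
  refine laurent_hom_ext fun t => ?_
  simp only [Module.End.mul_apply, eulerD_mono, thetaK_mono, eulerD_mono₂ t p q, LinearMap.add_apply,
    map_sum, map_sub, ← add_smul, hpq, if_true, if_false, map_smul, smul_sub,
    Finset.smul_sum]
  refine congrArg₂ _ (Finset.sum_congr rfl fun l _ => ?_) (Finset.sum_congr rfl fun l _ => ?_) <;>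
  · congr 1
    push_cast
    ring

end SpinSutherland

end

noncomputable section

namespace SpinSutherland

/-! ### Commutativity and the Hecke relations of the Cherednik-Dunkl operators -/

/-- The part `β⁻¹ D_i - ∑_j θ_{ij}(K_{ij} - 1)` of the Cherednik-Dunkl operator, which is permuted
by the coordinate permutations. -/
def dunklSym {n : ℕ} (β : ℂ) (i : Fin n) : Module.End ℂ (Laurent n) :=
  β⁻¹ • eulerD i - ∑ j, thetaK i j

/-- For j > i the term θ_{ji}(K_{ij} - 1) is replaced by K_{ij} - 1 - θ_{ij}(K_{ij} - 1). The
constants -1 cancel the shift n - i, and what remains besides the K_{ij} is symmetric in the other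
indices. -/
theorem dunkl_eq {n : ℕ} (β : ℂ) (i : Fin n) :
    dunkl β i = dunklSym β i + ∑ j ∈ Finset.univ.filter (fun j => i < j), permK i j := by
  have h1 : ∑ j, thetaK i j = ∑ j ∈ Finset.univ.filter (fun j => i < j), thetaK i j +
      ∑ j ∈ Finset.univ.filter (fun j => j < i), thetaK i j := by
    rw [← Finset.sum_filter_add_sum_filter_not Finset.univ (fun j => i < j)]
    congr 1
    refine (Finset.sum_subset (fun j hj => ?_) fun j hj hj' => ?_).symm
    · simp only [Finset.mem_filter, Finset.mem_univ, true_and] at hj ⊢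
      exact hj.le.not_gt
    · simp only [Finset.mem_filter, Finset.mem_univ, true_and, not_lt] at hj hj'
      rw [le_antisymm hj hj', thetaK_self]
  have h2 : ∑ j ∈ Finset.univ.filter (fun j => i < j), permK i j =
      ∑ j ∈ Finset.univ.filter (fun j => i < j), thetaK i j +
        ∑ j ∈ Finset.univ.filter (fun j => i < j), thetaK j i +
        ((n : ℂ) - ((i : ℕ) + 1)) • (1 : Module.End ℂ (Laurent n)) := by
    -- With i counted from zero, n - (i + 1) is the number of indices j > i.
    have hc : ((n : ℂ) - ((i : ℕ) + 1)) • (1 : Module.End ℂ (Laurent n)) =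
        ∑ j ∈ Finset.univ.filter (fun j => i < j), 1 := by
      rw [Finset.sum_const, Finset.filter_lt_eq_Ioi, Fin.card_Ioi, ← Nat.cast_smul_eq_nsmul ℂ]
      congr 1
      have := i.2
      rw [Nat.sub_sub, Nat.cast_sub (by omega)]
      push_cast
      ring
    rw [hc, ← Finset.sum_add_distrib, ← Finset.sum_add_distrib]
    refine Finset.sum_congr rfl fun j hj => ?_
    simp only [Finset.mem_filter, Finset.mem_univ, true_and] at hj
    rw [thetaK_add_thetaK hj.ne]
    abel
  rw [dunkl, dunklSym, h1, h2, ← Module.End.one_eq_id]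
  abel

theorem permK_mul_dunklSym {n : ℕ} (β : ℂ) (a b i : Fin n) :
    permK a b * dunklSym β i = dunklSym β (Equiv.swap a b i) * permK a b := by
  rw [dunklSym, dunklSym, mul_sub, sub_mul, mul_smul_comm, smul_mul_assoc, permK_mul_eulerD,
    Finset.mul_sum, Finset.sum_mul, ← Equiv.sum_comp (Equiv.swap a b) fun j =>
      thetaK (Equiv.swap a b i) j * permK a b]
  simp only [permK_mul_thetaK]

/-- `Di`, `Dj` stand for β⁻¹D_i, β⁻¹D_j, `s`, `t` for the two divided differences in i, j, `a`, `b`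
for the sums of those pairing i, respectively j, with the other indices, and `K` for K_{ij}. -/
theorem commutator_of_relations {A : Type*} [Ring A] {Di Dj s t a b K : A}
    (h1 : Di * Dj = Dj * Di) (h2 : Di * b = b * Di) (h3 : Dj * a = a * Dj)
    (h4 : (Di + Dj) * s = s * (Di + Dj)) (h5 : K * Di = Dj * K) (h6 : s + t = K - 1)
    (h7 : K * s = t * K)
    (h8 : (s * b - b * s) + (a * t - t * a) + (a * b - b * a) = (a - b) * K) :
    (Di - (s + a)) * (Dj - (t + b)) - (Dj - (t + b)) * (Di - (s + a)) =
      ((Dj - (t + b)) - (Di - (s + a))) * K := by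
  obtain rfl : t = K - 1 - s := by rw [← h6]; abel
  linear_combination (norm := noncomm_ring) h1 - h2 + h3 + h4 + h5 - h7 + h8

/-- The pair i, j is separated from the remaining indices. Terms with two different remaining
indices commute, and each single one contributes an instance of `thetaK_three_term`. -/
theorem dunklSym_commutator {n : ℕ} (β : ℂ) {i j : Fin n} (hij : i ≠ j) :
    dunklSym β i * dunklSym β j - dunklSym β j * dunklSym β i =
      (dunklSym β j - dunklSym β i) * permK i j := by
  set T : Finset (Fin n) := (Finset.univ.erase i).erase j with hT
  have hTi : ∀ k ∈ T, k ≠ i ∧ k ≠ j := fun k hk => by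
    simp only [hT, Finset.mem_erase] at hk
    exact ⟨hk.2.1, hk.1⟩
  have hi : dunklSym β i = β⁻¹ • eulerD i - (thetaK i j + ∑ k ∈ T, thetaK i k) := by
    rw [dunklSym, ← Finset.add_sum_erase Finset.univ _ (Finset.mem_univ i), thetaK_self, zero_add,
      ← Finset.add_sum_erase _ _ (Finset.mem_erase.mpr ⟨hij.symm, Finset.mem_univ j⟩)]
  have hj : dunklSym β j = β⁻¹ • eulerD j - (thetaK j i + ∑ k ∈ T, thetaK j k) := by
    rw [dunklSym, ← Finset.add_sum_erase Finset.univ _ (Finset.mem_univ j), thetaK_self, zero_add,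
      ← Finset.add_sum_erase _ _ (Finset.mem_erase.mpr ⟨hij, Finset.mem_univ i⟩), hT,
      Finset.erase_right_comm]
  rw [hi, hj]
  refine commutator_of_relations ?_ ?_ ?_ ?_ ?_ (thetaK_add_thetaK hij) ?_ ?_
  · exact (((eulerD_commute i j).smul_left _).smul_right _).eq
  · refine (Commute.smul_left (Commute.sum_right _ _ _ fun k hk => ?_) _).eq
    exact eulerD_commute_thetaK hij (hTi k hk).1.symm
  · refine (Commute.smul_left (Commute.sum_right _ _ _ fun k hk => ?_) _).eq
    exact eulerD_commute_thetaK hij.symm (hTi k hk).2.symm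
  · rw [← smul_add]
    exact ((eulerD_add_commute_thetaK hij).smul_left _).eq
  · rw [mul_smul_comm, smul_mul_assoc, permK_mul_eulerD, Equiv.swap_apply_left]
  · rw [permK_mul_thetaK, Equiv.swap_apply_left, Equiv.swap_apply_right]
  · have hab : (∑ k ∈ T, thetaK i k) * (∑ k ∈ T, thetaK j k) -
        (∑ k ∈ T, thetaK j k) * (∑ k ∈ T, thetaK i k) =
        ∑ k ∈ T, (thetaK i k * thetaK j k - thetaK j k * thetaK i k) := by
      rw [Finset.sum_mul_sum, Finset.sum_mul_sum, Finset.sum_comm, ← Finset.sum_sub_distrib]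
      refine Finset.sum_congr rfl fun l hl => ?_
      rw [← Finset.sum_sub_distrib]
      refine Finset.sum_eq_single_of_mem l hl fun k hk hkl => ?_
      rw [sub_eq_zero]
      exact (thetaK_commute (hTi k hk).1.symm (hTi l hl).2.symm hij (hTi l hl).1.symm
        (hTi k hk).2 hkl).eq
    rw [hab, Finset.mul_sum, Finset.sum_mul, Finset.mul_sum, Finset.sum_mul,
      ← Finset.sum_sub_distrib, ← Finset.sum_sub_distrib, ← Finset.sum_sub_distrib,
      ← Finset.sum_add_distrib, ← Finset.sum_add_distrib, Finset.sum_mul]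
    refine Finset.sum_congr rfl fun k hk => ?_
    rw [← thetaK_three_term hij (hTi k hk).1.symm (hTi k hk).2.symm]
    abel

theorem permK_mul_dunklSym_of_ne {n : ℕ} (β : ℂ) {a b i : Fin n} (ha : i ≠ a) (hb : i ≠ b) :
    Commute (permK a b) (dunklSym β i) := by
  have := permK_mul_dunklSym β a b i
  rwa [Equiv.swap_apply_of_ne_of_ne ha hb] at this

theorem permK_mul_sum_permK {n : ℕ} (a b i : Fin n) (s : Finset (Fin n))
    (hs : ∀ k, Equiv.swap a b k ∈ s ↔ k ∈ s) :
    permK a b * ∑ k ∈ s, permK i k = (∑ k ∈ s, permK (Equiv.swap a b i) k) * permK a b := by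
  rw [Finset.mul_sum, Finset.sum_mul]
  refine Finset.sum_equiv (Equiv.swap a b) (fun k => (hs k).symm) fun k _ => ?_
  exact permK_mul_permK a b i k

/-- In ∑_{k>i} K_{ik} only the term k = j fails to commute with the equivariant part at j, and its
defect is opposite to that of `dunklSym_commutator`. The sum attached to j commutes with everything
attached to i, since it permutes only indices above i. -/
theorem dunkl_commute_of_lt {n : ℕ} (β : ℂ) {i j : Fin n} (hij : i < j) :
    Commute (dunkl β i) (dunkl β j) := by
  set Ki := ∑ k ∈ Finset.univ.filter (fun k => i < k), permK i k with hKi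
  set Kj := ∑ k ∈ Finset.univ.filter (fun k => j < k), permK j k with hKj
  have e1 := dunklSym_commutator β hij.ne
  have e2 : Ki * dunklSym β j - dunklSym β j * Ki =
      (dunklSym β i - dunklSym β j) * permK i j := by
    rw [hKi, Finset.sum_mul, Finset.mul_sum, ← Finset.sum_sub_distrib,
      Finset.sum_eq_single_of_mem j (by simpa using hij) fun k hk hkj => ?_]
    · rw [permK_mul_dunklSym, Equiv.swap_apply_right, sub_mul]
    · simp only [Finset.mem_filter, Finset.mem_univ, true_and] at hk
      rw [sub_eq_zero]
      exact (permK_mul_dunklSym_of_ne β hij.ne' hkj.symm).eq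
  have e3 : Commute Kj (dunklSym β i) := by
    refine Commute.sum_left _ _ _ fun k hk => ?_
    simp only [Finset.mem_filter, Finset.mem_univ, true_and] at hk
    exact permK_mul_dunklSym_of_ne β hij.ne (hij.trans hk).ne
  have e4 : Commute Kj Ki := by
    refine Commute.sum_left _ _ _ fun k hk => ?_
    simp only [Finset.mem_filter, Finset.mem_univ, true_and] at hk
    have := permK_mul_sum_permK j k i (Finset.univ.filter (fun k => i < k)) fun l => by
      simp only [Finset.mem_filter, Finset.mem_univ, true_and, Equiv.swap_apply_def]
      split_ifs with h1 h2
      · subst h1; exact ⟨fun _ => hij, fun _ => hij.trans hk⟩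
      · subst h2; exact ⟨fun _ => hij.trans hk, fun _ => hij⟩
      · rfl
    rw [Equiv.swap_apply_of_ne_of_ne hij.ne (hij.trans hk).ne] at this
    exact this
  rw [dunkl_eq, dunkl_eq, ← hKi, ← hKj]
  rw [sub_mul] at e1 e2
  have e3' := e3.eq
  have e4' := e4.eq
  change _ * _ = _ * _
  linear_combination (norm := noncomm_ring) e1 + e2 - e3' - e4'

theorem dunkl_commute {n : ℕ} (β : ℂ) (i j : Fin n) : Commute (dunkl β i) (dunkl β j) := by
  rcases lt_trichotomy i j with h | rfl | h
  · exact dunkl_commute_of_lt β h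
  · exact Commute.refl _
  · exact (dunkl_commute_of_lt β h).symm

/-- The cross relation `K_{i,i+1} d_i = d_{i+1} K_{i,i+1} + 1`. -/
theorem permK_mul_dunkl_left {n : ℕ} (β : ℂ) {i j : Fin n} (hij : (i : ℕ) + 1 = j) :
    permK i j * dunkl β i = dunkl β j * permK i j + 1 := by
  have hlt : i < j := Fin.lt_def.mpr (by omega)
  -- By adjacency the indices above i are j and those above j. The extra term K_{ij} multiplied by
  -- K_{ij} is the constant 1 of the cross relation.
  have hs : Finset.univ.filter (fun k => i < k) =
      insert j (Finset.univ.filter (fun k => j < k)) := by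
    ext k
    simp only [Finset.mem_filter, Finset.mem_univ, true_and, Finset.mem_insert, Fin.lt_def,
      Fin.ext_iff]
    omega
  rw [dunkl_eq, dunkl_eq, mul_add, permK_mul_dunklSym, Equiv.swap_apply_left, hs,
    Finset.sum_insert (by simp), mul_add, permK_mul_self, add_mul, permK_mul_sum_permK,
    Equiv.swap_apply_left]
  · abel
  · intro l
    simp only [Finset.mem_filter, Finset.mem_univ, true_and, Equiv.swap_apply_def]
    split_ifs with h1 h2
    · subst h1; simp [hlt.le]
    · subst h2; simp [hlt.le]
    · rfl

/-- The cross relation `K_{i,i+1} d_{i+1} = d_i K_{i,i+1} - 1`. -/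
theorem permK_mul_dunkl_right {n : ℕ} (β : ℂ) {i j : Fin n} (hij : (i : ℕ) + 1 = j) :
    permK i j * dunkl β j = dunkl β i * permK i j - 1 := by
  have h := permK_mul_dunkl_left β hij
  have h2 := permK_mul_self i j
  calc permK i j * dunkl β j
      = permK i j * (dunkl β j * permK i j + 1) * permK i j - 1 := by
        rw [mul_add, add_mul, mul_one, h2, mul_assoc, mul_assoc, h2, mul_one]; abel
    _ = _ := by rw [← h, ← mul_assoc, h2, one_mul]

/-- Since i and j are adjacent, an index k different from both lies below both or above both. The
set of indices above k is therefore stable under the exchange. -/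
theorem permK_commute_dunkl {n : ℕ} (β : ℂ) {i j k : Fin n} (hij : (i : ℕ) + 1 = j) (hi : k ≠ i)
    (hj : k ≠ j) : Commute (permK i j) (dunkl β k) := by
  have hi' : (k : ℕ) ≠ i := fun e => hi (Fin.ext e)
  have hj' : (k : ℕ) ≠ j := fun e => hj (Fin.ext e)
  rw [dunkl_eq]
  refine (permK_mul_dunklSym_of_ne β hi hj).add_right ?_
  have := permK_mul_sum_permK i j k (Finset.univ.filter (fun l => k < l)) fun l => by
    simp only [Finset.mem_filter, Finset.mem_univ, true_and, Equiv.swap_apply_def, Fin.lt_def]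
    split_ifs with h1 h2
    · subst h1; omega
    · subst h2; omega
    · rfl
  rw [Equiv.swap_apply_of_ne_of_ne hi hj] at this
  exact this

end SpinSutherland

end

noncomputable section

namespace SpinSutherland

/-! ### Operators on the tensor power `(ℂ^N)^{⊗ n}` -/

/-- The basis vector `v_{η 1} ⊗ ⋯ ⊗ v_{η n}`. -/
def spinVec {N n : ℕ} (η : Fin n → Fin N) : Spin N n :=
  PiTensorProduct.tprod ℂ fun i => (Pi.single (η i) 1 : Fin N → ℂ)

theorem spin_hom_ext {N n : ℕ} {M : Type*} [AddCommMonoid M] [Module ℂ M]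
    {f g : Spin N n →ₗ[ℂ] M} (h : ∀ η, f (spinVec η) = g (spinVec η)) : f = g := by
  refine (Basis.piTensorProduct fun _ : Fin n => Pi.basisFun ℂ (Fin N)).ext fun η => ?_
  simpa [Basis.piTensorProduct_apply, spinVec] using h η

/-- The linear map on `(ℂ^N)^{⊗ n}` with prescribed values on the basis vectors. -/
def onSpin {N n : ℕ} {M : Type*} [AddCommMonoid M] [Module ℂ M] (g : (Fin n → Fin N) → M) :
    Spin N n →ₗ[ℂ] M :=
  (Basis.piTensorProduct fun _ : Fin n => Pi.basisFun ℂ (Fin N)).constr ℂ g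

theorem onSpin_spinVec {N n : ℕ} {M : Type*} [AddCommMonoid M] [Module ℂ M]
    (g : (Fin n → Fin N) → M) (η : Fin n → Fin N) : onSpin g (spinVec η) = g η := by
  rw [onSpin, ← (Basis.piTensorProduct fun _ : Fin n => Pi.basisFun ℂ (Fin N)).constr_basis ℂ g η]
  simp [Basis.piTensorProduct_apply, spinVec]

theorem unitAt_spinVec {N n : ℕ} (a b : Fin N) (i : Fin n) (η : Fin n → Fin N) :
    unitAt N a b i (spinVec η) = if η i = b then spinVec (Function.update η i a) else 0 := by
  rw [unitAt, spinVec, PiTensorProduct.map_tprod]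
  split_ifs with h
  · rw [spinVec]
    congr 1
    funext j
    by_cases hj : j = i
    · subst hj
      ext c
      simp [h, Matrix.single_apply, Pi.single_apply, eq_comm]
    · simp [hj]
  · refine (PiTensorProduct.tprod ℂ).map_coord_zero i ?_
    simp only [Function.update_self, Matrix.toLin'_apply]
    ext c
    simp [Matrix.single_apply]
    intro _ e
    exact absurd e.symm h

/-- The exchange of the `i`-th and the `j`-th factor. -/
def flip (N : ℕ) {n : ℕ} (i j : Fin n) : Module.End ℂ (Spin N n) :=
  onSpin fun η => spinVec (η ∘ Equiv.swap i j)

theorem flip_spinVec {N n : ℕ} (i j : Fin n) (η : Fin n → Fin N) :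
    flip N i j (spinVec η) = spinVec (η ∘ Equiv.swap i j) := onSpin_spinVec _ _

theorem flip_mul_self {N n : ℕ} (i j : Fin n) : flip N i j * flip N i j = 1 := by
  refine spin_hom_ext fun η => ?_
  simp only [Module.End.mul_apply, flip_spinVec, Module.End.one_apply]
  congr 1
  funext i
  simp

theorem flip_mul_unitAt {N n : ℕ} (a b : Fin N) (i j k : Fin n) :
    flip N i j * unitAt N a b k = unitAt N a b (Equiv.swap i j k) * flip N i j := by
  refine spin_hom_ext fun η => ?_
  simp only [Module.End.mul_apply, flip_spinVec, unitAt_spinVec, Function.comp_apply,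
    Equiv.swap_apply_self]
  split_ifs
  · rw [flip_spinVec, Function.update_comp_equiv, Equiv.symm_swap]
  · simp

theorem unitAt_mul_unitAt {N n : ℕ} (a b c d : Fin N) (i : Fin n) :
    unitAt N a b i * unitAt N c d i = if b = c then unitAt N a d i else 0 := by
  refine spin_hom_ext fun η => ?_
  simp only [Module.End.mul_apply, unitAt_spinVec]
  by_cases h1 : η i = d <;> by_cases h2 : b = c <;>
    simp [h1, h2, unitAt_spinVec]
  exact fun e => absurd e.symm h2

theorem unitAt_commute {N n : ℕ} (a b c d : Fin N) {i j : Fin n} (hij : i ≠ j) :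
    Commute (unitAt N a b i) (unitAt N c d j) := by
  refine spin_hom_ext fun η => ?_
  simp only [Module.End.mul_apply, unitAt_spinVec]
  by_cases h1 : η i = b <;> by_cases h2 : η j = d <;>
    simp [h1, h2, unitAt_spinVec, hij, hij.symm, Function.update_comm]

/-- The exchange of two factors is ∑ E_{de}^{(i)} E_{ed}^{(j)}. The quadratic term in a product of
two L-operators thus involves only this exchange and one matrix unit. -/
theorem sum_unitAt_mul_unitAt {N n : ℕ} (a c : Fin N) {i j : Fin n} (hij : i ≠ j) :
    ∑ d, unitAt N d a i * unitAt N c d j = flip N i j * unitAt N c a i := by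
  refine spin_hom_ext fun η => ?_
  simp only [LinearMap.sum_apply, Module.End.mul_apply, unitAt_spinVec]
  rw [Finset.sum_eq_single (η j)]
  · rw [if_pos rfl, unitAt_spinVec, Function.update_of_ne hij]
    split_ifs
    · rw [flip_spinVec]
      congr 1
      funext k
      by_cases hi : k = i
      · subst hi; simp [hij.symm]
      · by_cases hj : k = j
        · subst hj; simp [hij.symm]
        · simp [hi, hj, Equiv.swap_apply_of_ne_of_ne]
    · simp
  · intro d _ hd
    rw [if_neg hd.symm, map_zero]
  · simp

end SpinSutherland

end

noncomputable section

namespace SpinSutherland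

/-! ### The relations of the Yangian for matrices of power series -/

/-- The relation `(u - v)[U_{ab}, V_{cd}] = V_{cb} U_{ad} - U_{cb} V_{ad}`, written in the
variables `x = u⁻¹`, `y = v⁻¹`. -/
def RTT {S ι : Type*} [Ring S] (x y : S) (U V : Matrix ι ι S) : Prop :=
  ∀ a b c d, (y - x) * (U a b * V c d - V c d * U a b) =
    x * y * (V c b * U a d - U c b * V a d)

/-- This is the compatibility of the relations with the coproduct: two solutions with mutually
commuting entries multiply to a solution. -/
theorem RTT.mul {S ι : Type*} [Ring S] [Fintype ι] {x y : S} (hx : ∀ z, Commute x z)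
    (hy : ∀ z, Commute y z) {U V U' V' : Matrix ι ι S} (h : RTT x y U V) (h' : RTT x y U' V')
    (h₁ : ∀ a b c d, Commute (U' a b) (V c d)) (h₂ : ∀ a b c d, Commute (V' a b) (U c d)) :
    RTT x y (U * U') (V * V') := by
  intro a b c d
  have key : ∀ {W₁ W₂ W₁' W₂' : Matrix ι ι S} (a b c d : ι),
      (∀ a b c d, Commute (W₁' a b) (W₂ c d)) →
      (W₁ * W₁') a b * (W₂ * W₂') c d =
        ∑ e, ∑ f, W₁ a e * W₂ c f * (W₁' e b * W₂' f d) := by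
    intro W₁ W₂ W₁' W₂' a b c d hc
    rw [Matrix.mul_apply, Matrix.mul_apply, Finset.sum_mul_sum]
    refine Finset.sum_congr rfl fun e _ => Finset.sum_congr rfl fun f _ => ?_
    have := (hc e b c f).eq
    simp only [mul_assoc]
    rw [← mul_assoc (W₁' e b), this, mul_assoc]
  rw [key a b c d h₁, key c d a b h₂, key c b a d h₂, key c b a d h₁,
    Finset.sum_comm (f := fun e f => V c e * U a f * (V' e d * U' f b)),
    Finset.sum_comm (f := fun e f => V c e * U a f * (V' e b * U' f d))]
  -- The mixed terms, one from each factor's relation, differ only by the names of the two summation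
  -- indices and cancel in the sum.
  have hcancel : ∑ e, ∑ f, V c e * U a f * (U' e b * V' f d) =
      ∑ e, ∑ f, V c f * U a e * (U' f b * V' e d) := Finset.sum_comm
  -- The Leibniz rule [UU', VV'] = [U,V]U'V' + VU[U',V'], with the relation of each factor inserted.
  have hstep : ∀ e f, (y - x) * (U a e * V c f * (U' e b * V' f d) -
      V c f * U a e * (V' f d * U' e b)) =
      x * y * (V c e * U a f * (U' e b * V' f d)) - x * y * (U c e * V a f * (U' e b * V' f d)) +
      (x * y * (V c f * U a e * (V' f b * U' e d)) -
        x * y * (V c f * U a e * (U' f b * V' e d))) := by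
    intro e f
    have e1 := congrArg (· * (U' e b * V' f d)) (h a e c f)
    have e2 := congrArg (V c f * U a e * ·) (h' e b f d)
    beta_reduce at e1 e2
    have c1 : V c f * U a e * ((y - x) * (U' e b * V' f d - V' f d * U' e b)) =
        (y - x) * (V c f * U a e * (U' e b * V' f d - V' f d * U' e b)) := by
      rw [← mul_assoc, ← ((hy _).sub_left (hx _)).eq, mul_assoc]
    have c2 : V c f * U a e * (x * y * (V' f b * U' e d - U' f b * V' e d)) =
        x * y * (V c f * U a e * (V' f b * U' e d - U' f b * V' e d)) := by
      rw [← mul_assoc, ← ((hx _).mul_left (hy _)).eq, mul_assoc]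
    rw [c1, c2] at e2
    linear_combination (norm := noncomm_ring) e1 + e2
  rw [← Finset.sum_sub_distrib, Finset.mul_sum]
  simp only [← Finset.sum_sub_distrib, Finset.mul_sum, hstep, Finset.sum_add_distrib]
  simp only [Finset.sum_sub_distrib, ← Finset.mul_sum]
  rw [hcancel, mul_sub]
  abel

theorem RTT.smul {S ι : Type*} [Ring S] {x y f g : S} (hf : ∀ z, Commute f z)
    (hg : ∀ z, Commute g z) {U V : Matrix ι ι S} (h : RTT x y U V) :
    RTT x y (fun a b => f * U a b) (fun a b => g * V a b) := by
  intro a b c d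
  have e1 : ∀ p q, f * p * (g * q) = f * g * (p * q) := fun p q => by
    rw [mul_assoc, ← mul_assoc p, ← (hg p).eq, mul_assoc, mul_assoc]
  have e2 : ∀ p q, g * p * (f * q) = f * g * (p * q) := fun p q => by
    rw [mul_assoc, ← mul_assoc p, ← (hf p).eq, mul_assoc, ← mul_assoc, (hg f).eq]
  have e3 : ∀ z, Commute (f * g) z := fun z => (hf z).mul_left (hg z)
  simp only [e1, e2, ← mul_sub]
  rw [← mul_assoc, ← (e3 _).eq, mul_assoc, h a b c d, ← mul_assoc, (e3 _).eq, mul_assoc]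

theorem RTT.one {S ι : Type*} [Ring S] [DecidableEq ι] {x y : S} :
    RTT x y (1 : Matrix ι ι S) 1 := by
  intro a b c d
  simp only [Matrix.one_apply]
  split_ifs <;> simp

/-- The relation for an evaluation module: `U = 1 + (u + D)⁻¹ E`, `V = 1 + (v + D)⁻¹ E`. -/
theorem RTT.evaluation {S ι : Type*} [Ring S] [DecidableEq ι] {x y D hu hv : S}
    {E : ι → ι → S} (hx : ∀ z, Commute x z) (hy : ∀ z, Commute y z)
    (eu : hu + x * D * hu = x) (ev : hv + y * D * hv = y)
    (huv : Commute hu hv) (hDu : Commute D hu)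
    (hEu : ∀ a b, Commute hu (E a b)) (hEv : ∀ a b, Commute hv (E a b))
    (hE : ∀ a b c d, E a b * E c d = if b = c then E a d else 0) :
    RTT x y (fun a b => (if a = b then 1 else 0) + hu * E b a)
      (fun a b => (if a = b then 1 else 0) + hv * E b a) := by
  intro a b c d
  -- The resolvent identity (v+D)⁻¹ - (u+D)⁻¹ = (u-v)(u+D)⁻¹(v+D)⁻¹, multiplied by xy; the
  -- hypotheses `eu` and `ev` are the defining equations of the two inverses.
  have key : x * y * (hv - hu) = (y - x) * (hu * hv) := by
    have e1 : x * y * hv = y * (hu * hv) + x * y * (D * hu * hv) := by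
      calc x * y * hv = y * (x * hv) := by rw [(hx y).eq, mul_assoc]
        _ = y * ((hu + x * D * hu) * hv) := by rw [eu]
        _ = y * (hu * hv) + y * x * (D * hu * hv) := by noncomm_ring
        _ = _ := by rw [(hx y).eq]
    have e2 : x * y * hu = x * (hu * hv) + x * y * (D * hu * hv) := by
      calc x * y * hu = x * (hu * y) := by rw [mul_assoc, (hy hu).eq]
        _ = x * (hu * (hv + y * D * hv)) := by rw [ev]
        _ = x * (hu * hv) + x * ((hu * y) * D * hv) := by noncomm_ring
        _ = x * (hu * hv) + x * (y * (hu * D) * hv) := by rw [← (hy hu).eq, mul_assoc y]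
        _ = x * (hu * hv) + x * (y * (D * hu) * hv) := by rw [hDu.eq]
        _ = _ := by noncomm_ring
    rw [mul_sub, e1, e2]
    noncomm_ring
  have p1 : ∀ a b c d, hu * E a b * (hv * E c d) = hu * hv * (E a b * E c d) :=
    fun a b c d => by
      rw [mul_assoc, ← mul_assoc (E a b), ← (hEv a b).eq, mul_assoc, mul_assoc]
  have p2 : ∀ a b c d, hv * E a b * (hu * E c d) = hu * hv * (E a b * E c d) :=
    fun a b c d => by
      rw [mul_assoc, ← mul_assoc (E a b), ← (hEu a b).eq, mul_assoc, ← mul_assoc, ← huv.eq]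
  have δ : ∀ (p : Prop) [Decidable p] (z : S), Commute (if p then (1 : S) else 0) z := by
    intro p _ z
    split_ifs
    · exact Commute.one_left z
    · exact Commute.zero_left z
  have l1 : ((if a = b then (1 : S) else 0) + hu * E b a) * ((if c = d then 1 else 0) + hv * E d c) -
      ((if c = d then 1 else 0) + hv * E d c) * ((if a = b then 1 else 0) + hu * E b a) =
      hu * hv * (E b a * E d c - E d c * E b a) := by
    have q1 := (δ (a = b) (hv * E d c)).eq
    have q2 := (δ (c = d) (hu * E b a)).eq
    have q3 := (δ (a = b) (if c = d then (1 : S) else 0)).eq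
    have q4 := p1 b a d c
    have q5 := p2 d c b a
    linear_combination (norm := noncomm_ring) q1 - q2 + q3 + q4 - q5
  -- The terms containing both inverses cancel, so only the difference of the inverses survives, and
  -- `key` converts it into their product.
  have l2 : ((if c = b then (1 : S) else 0) + hv * E b c) * ((if a = d then 1 else 0) + hu * E d a) -
      ((if c = b then 1 else 0) + hu * E b c) * ((if a = d then 1 else 0) + hv * E d a) =
      (hv - hu) * ((if a = d then 1 else 0) * E b c - (if c = b then 1 else 0) * E d a) := by
    have q1 := (δ (a = d) (hv * E b c)).eq
    have q2 := (δ (a = d) (hu * E b c)).eq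
    have q3 := (δ (c = b) hu).eq
    have q3' := (δ (c = b) hv).eq
    have q6 := (δ (a = d) hu).eq
    have q6' := (δ (a = d) hv).eq
    have q4 := p1 b c d a
    have q5 := p2 b c d a
    generalize (if a = d then (1 : S) else 0) = δ₁ at *
    generalize (if c = b then (1 : S) else 0) = δ₂ at *
    have r1 := congrArg (· * E b c) q6
    have r2 := congrArg (· * E b c) q6'
    have r3 := congrArg (· * E d a) q3
    have r4 := congrArg (· * E d a) q3'
    beta_reduce at r1 r2 r3 r4
    linear_combination (norm := noncomm_ring) -q1 + q2 - q4 + q5 - r1 + r2 + r3 - r4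
  rw [l1, l2, hE, hE, ← mul_assoc, ← key, mul_assoc]
  congr 2
  congr 1 <;> split_ifs <;> simp_all

end SpinSutherland

end

/-! ### Resolvents as power series, and the Yangian relation for products of series. -/

noncomputable section

namespace SpinSutherland

open PowerSeries

/-- The expansion `∑_{s ≥ 0} (-d)^s X^{s+1}` of `(u + d)⁻¹` in `X = u⁻¹`. -/
def resolvent {A : Type*} [Ring A] (d : A) : PowerSeries A :=
  X * PowerSeries.mk fun s => (-d) ^ s

/-- This is (u + d)(u + d)⁻¹ = 1 multiplied by u⁻¹. -/
theorem resolvent_add {A : Type*} [Ring A] (d : A) :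
    resolvent d + X * C d * resolvent d = X := by
  rw [resolvent, mul_assoc, ← mul_add]
  conv_rhs => rw [← mul_one X]
  congr 1
  ext s
  cases s with
  | zero => simp
  | succ s =>
    rw [map_add, coeff_mk, coeff_C_mul,
      coeff_succ_X_mul, coeff_mk, coeff_one, if_neg s.succ_ne_zero, pow_succ']
    noncomm_ring

theorem series_commute {A : Type*} [Ring A] {f g : PowerSeries A}
    (h : ∀ m n, Commute (coeff m f) (coeff n g)) : Commute f g := by
  ext s
  rw [coeff_mul, coeff_mul, ← Finset.Nat.sum_antidiagonal_swap]
  exact Finset.sum_congr rfl fun p _ => (h _ _).eq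

theorem commute_coeff_of_C {A : Type*} [Ring A] {f : PowerSeries A} {a : A}
    (h : ∀ m, Commute a (coeff m f)) : Commute (C a) f := by
  ext s
  rw [coeff_C_mul, coeff_mul_C]
  exact (h s).eq

theorem coeff_resolvent_commute {A : Type*} [Ring A] {d a : A} (h : Commute d a) (m : ℕ) :
    Commute (coeff m (resolvent d)) a := by
  cases m with
  | zero => rw [resolvent, coeff_zero_X_mul]; exact Commute.zero_left _
  | succ m => rw [resolvent, coeff_succ_X_mul, coeff_mk]; exact h.neg_left.pow_left m

theorem resolvent_commute {A : Type*} [Ring A] {d d' : A} (h : Commute d d') :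
    Commute (resolvent d) (resolvent d') :=
  series_commute fun _ n => coeff_resolvent_commute
    (coeff_resolvent_commute h.symm n).symm _

theorem C_commute_resolvent {A : Type*} [Ring A] {d a : A} (h : Commute a d) :
    Commute (C a) (resolvent d) :=
  commute_coeff_of_C fun m => (coeff_resolvent_commute h.symm m).symm

theorem resolvent_add' {A : Type*} [Ring A] (d : A) :
    resolvent d + resolvent d * C d * X = X := by
  conv_rhs => rw [← resolvent_add d]
  rw [← (C_commute_resolvent (Commute.refl d)).eq, mul_assoc X, (commute_X _).eq]

/-- If `k d = d' k + c` with `c` commuting with `d`, then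
`k (u + d)⁻¹ = (u + d')⁻¹ k - (u + d')⁻¹ c (u + d)⁻¹`. -/
theorem resolvent_intertwine {A : Type*} [Ring A] {d d' k c : A} (h : k * d = d' * k + c) :
    C k * resolvent d = resolvent d' * C k - resolvent d' * C c * resolvent d := by
  -- Multiplication by X is injective; after it the equations of the two resolvents can be inserted
  -- in place of X.
  have hX : ∀ f g : PowerSeries A, X * f = X * g → f = g := fun f g e => by
    ext s
    rw [← coeff_succ_X_mul, e, coeff_succ_X_mul]
  apply hX
  have e1 := resolvent_add d
  have e2 := resolvent_add' d'
  have hC : (C k : PowerSeries A) * C d = C d' * C k + C c := by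
    rw [← map_mul, h, map_add, map_mul]
  have x1 := (commute_X (resolvent d' * C k)).eq
  have x2 := (commute_X (resolvent d')).eq
  have x3 := (commute_X (C k : PowerSeries A)).eq
  have x4 := (commute_X (C d' : PowerSeries A)).eq
  calc X * (C k * resolvent d)
      = X * C k * resolvent d := by rw [mul_assoc]
    _ = (resolvent d' + resolvent d' * C d' * X) * C k * resolvent d := by rw [e2]
    _ = resolvent d' * C k * resolvent d +
          resolvent d' * C d' * (X * C k) * resolvent d := by noncomm_ring
    _ = resolvent d' * C k * resolvent d +
          resolvent d' * (C k * C d - C c) * X * resolvent d := by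
        rw [hC, ← x3]; noncomm_ring
    _ = resolvent d' * C k * resolvent d + resolvent d' * C k * (C d * X) * resolvent d
          - resolvent d' * C c * (X * resolvent d) := by noncomm_ring
    _ = resolvent d' * C k * resolvent d + resolvent d' * C k * (X * C d) * resolvent d
          - resolvent d' * C c * (X * resolvent d) := by rw [(commute_X (C d)).eq]
    _ = resolvent d' * C k * (resolvent d + X * C d * resolvent d)
          - resolvent d' * C c * (X * resolvent d) := by noncomm_ring
    _ = resolvent d' * C k * X - resolvent d' * C c * (resolvent d * X) := by
        rw [e1, (commute_X (resolvent d)).eq]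
    _ = _ := by
        rw [x1, mul_sub, ← mul_assoc (resolvent d' * C c), (commute_X _).eq]

/-- The coefficients of `r, s` in the defining relation of the Yangian. -/
theorem coeff_relation_of_RTT {A ι : Type*} [Ring A] {T : Matrix ι ι (PowerSeries A)}
    (h : RTT (X : PowerSeries (PowerSeries A)) (C X) (T.map (PowerSeries.map C)) (T.map C))
    (r s : ℕ) (a b c d : ι) :
    (coeff (r + 1) (T a b) * coeff s (T c d) - coeff s (T c d) * coeff (r + 1) (T a b)) -
        (coeff r (T a b) * coeff (s + 1) (T c d) - coeff (s + 1) (T c d) * coeff r (T a b)) =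
      coeff s (T c b) * coeff r (T a d) - coeff r (T c b) * coeff s (T a d) := by
  -- The outer variable is x = u⁻¹ and the inner one y = v⁻¹. At x^{r+1} y^{s+1} the factor y - x
  -- shifts one index of the commutator and the factor xy lowers both indices on the right, which
  -- gives the stated coefficients.
  have e := congrArg (fun z => coeff (s + 1) (coeff (r + 1) z)) (h a b c d)
  have q1 : ∀ f g : PowerSeries A, ∀ m k,
      coeff k (coeff m (PowerSeries.map C f * C g)) = coeff m f * coeff k g := by
    intro f g m k
    rw [coeff_mul_C, coeff_map, coeff_C_mul]
  have q2 : ∀ f g : PowerSeries A, ∀ m k,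
      coeff k (coeff m (C g * PowerSeries.map C f)) = coeff k g * coeff m f := by
    intro f g m k
    rw [coeff_C_mul, coeff_map, coeff_mul_C]
  have q3 : ∀ z : PowerSeries (PowerSeries A),
      coeff (s + 1) (coeff (r + 1) (C X * z)) = coeff s (coeff (r + 1) z) := by
    intro z
    rw [coeff_C_mul, coeff_succ_X_mul]
  have q4 : ∀ z : PowerSeries (PowerSeries A),
      coeff (s + 1) (coeff (r + 1) (X * z)) = coeff (s + 1) (coeff r z) := by
    intro z
    rw [coeff_succ_X_mul]
  have q5 : ∀ z : PowerSeries (PowerSeries A),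
      coeff (s + 1) (coeff (r + 1) (X * C X * z)) = coeff s (coeff r z) := by
    intro z
    rw [mul_assoc, coeff_succ_X_mul, coeff_C_mul, coeff_succ_X_mul]
  simp only [Matrix.map_apply, sub_mul, map_sub, q3, q4, q5, q1, q2] at e
  exact e

/-- The coproduct argument is iterated: as the list has no repetition, the head commutes
coefficientwise with the product of the tail. -/
theorem RTT.list_prod {A ι κ : Type*} [Ring A] [Fintype ι] [DecidableEq ι]
    {L : κ → Matrix ι ι (PowerSeries A)}
    (h : ∀ i, RTT (X : PowerSeries (PowerSeries A)) (C X) ((L i).map (PowerSeries.map C))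
      ((L i).map C))
    (hc : ∀ i j, i ≠ j → ∀ a b c d m n, Commute (coeff m (L i a b)) (coeff n (L j c d)))
    (l : List κ) (hl : l.Nodup) :
    RTT (X : PowerSeries (PowerSeries A)) (C X)
      ((l.map L).prod.map (PowerSeries.map C)) ((l.map L).prod.map C) := by
  induction l with
  | nil =>
    simp only [List.map_nil, List.prod_nil, Matrix.map_one _ (map_zero _) (map_one _)]
    exact RTT.one
  | cons i l ih =>
    rw [List.nodup_cons] at hl
    have hcomm : ∀ a b c d m n,
        Commute (coeff m ((l.map L).prod a b)) (coeff n (L i c d)) := by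
      intro a b c d m n
      clear ih
      induction l generalizing a m with
      | nil =>
        rw [List.map_nil, List.prod_nil, Matrix.one_apply]
        split_ifs
        · rw [coeff_one]
          split_ifs
          · exact Commute.one_left _
          · exact Commute.zero_left _
        · rw [map_zero]; exact Commute.zero_left _
      | cons j l ihl =>
        rw [List.map_cons, List.prod_cons, Matrix.mul_apply, map_sum]
        refine Commute.sum_left _ _ _ fun e _ => ?_
        rw [coeff_mul]
        refine Commute.sum_left _ _ _ fun p _ => Commute.mul_left ?_ ?_
        · exact hc j i (fun e => hl.1 (by simp [e])) _ _ _ _ _ _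
        · exact ihl ⟨fun e => hl.1 (List.mem_cons_of_mem _ e), (List.nodup_cons.mp hl.2).2⟩ _ _
    rw [List.map_cons, List.prod_cons, Matrix.map_mul, Matrix.map_mul]
    refine RTT.mul (fun z => (commute_X z).symm) (fun z => ?_) (h i) (ih hl.2) ?_ ?_
    · exact commute_coeff_of_C fun m => (commute_X _).symm
    · intro a b c d
      simp only [Matrix.map_apply]
      refine (commute_coeff_of_C fun m => ?_).symm
      rw [coeff_map]
      exact (commute_coeff_of_C fun k => hcomm a b c d m k).symm
    · intro a b c d
      simp only [Matrix.map_apply]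
      refine commute_coeff_of_C fun m => ?_
      rw [coeff_map]
      exact (commute_coeff_of_C fun k => (hcomm a b c d k m).symm).symm

/-- `RTT.evaluation` is applied over double series. The two resolvents, in u⁻¹ and in v⁻¹, are the
images of one series under the two embeddings, and so are their defining equations. -/
theorem RTT.resolvent {A ι : Type*} [Ring A] [DecidableEq ι] {D : A} {E : ι → ι → A}
    (hDE : ∀ a b, Commute D (E a b))
    (hE : ∀ a b c d, E a b * E c d = if b = c then E a d else 0)
    {L : Matrix ι ι (PowerSeries A)}
    (hL : ∀ a b, L a b = (if a = b then 1 else 0) + SpinSutherland.resolvent D * C (E b a)) :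
    RTT (X : PowerSeries (PowerSeries A)) (C X) (L.map (PowerSeries.map C)) (L.map C) := by
  have hxX : ∀ z : PowerSeries (PowerSeries A), Commute X z := fun z => (commute_X z).symm
  have hCX : ∀ z : PowerSeries (PowerSeries A), Commute (C X) z := fun z =>
    commute_coeff_of_C fun m => (commute_X _).symm
  have mapC : ∀ a : A, PowerSeries.map (C : A →+* PowerSeries A) (C a) = C (C a) :=
    fun a => PowerSeries.map_C _ a
  have main := RTT.evaluation (x := (X : PowerSeries (PowerSeries A))) (y := C X)
    (D := C (C D)) (hu := PowerSeries.map C (SpinSutherland.resolvent D))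
    (hv := C (SpinSutherland.resolvent D)) (E := fun a b => C (C (E a b))) hxX hCX
    ?_ ?_ ?_ ?_ ?_ ?_ ?_
  · have e1 : L.map (PowerSeries.map C) = fun a b => (if a = b then 1 else 0) +
        PowerSeries.map C (SpinSutherland.resolvent D) * C (C (E b a)) := by
      ext1 a b
      simp only [Matrix.map_apply, hL, map_add, map_mul, mapC]
      split_ifs <;> simp
    have e2 : L.map C = fun a b => (if a = b then 1 else 0) +
        C (SpinSutherland.resolvent D) * C (C (E b a)) := by
      ext1 a b
      simp only [Matrix.map_apply, hL, map_add, map_mul]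
      split_ifs <;> simp
    rw [e1, e2]
    exact main
  · have := congrArg (PowerSeries.map (C : A →+* PowerSeries A)) (resolvent_add D)
    simpa only [map_add, map_mul, mapC, PowerSeries.map_X] using this
  · have := congrArg (C : PowerSeries A →+* _) (resolvent_add D)
    simpa only [map_add, map_mul] using this
  · refine (commute_coeff_of_C fun m => ?_).symm
    rw [coeff_map]
    exact (C_commute_resolvent (coeff_resolvent_commute (Commute.refl D) m)).symm
  · refine commute_coeff_of_C fun m => ?_
    rw [coeff_map]
    exact ((coeff_resolvent_commute (Commute.refl D) m).symm.map C)
  · intro a b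
    refine (commute_coeff_of_C fun m => ?_).symm
    rw [coeff_map]
    exact ((coeff_resolvent_commute (hDE a b) m).symm.map C)
  · intro a b
    exact (C_commute_resolvent (hDE a b).symm).symm.map C
  · intro a b c d
    rw [← map_mul, ← map_mul, hE]
    split_ifs <;> simp

/-- A relation between coefficients that is compatible with the ring operations passes to products
of matrices of power series. -/
theorem coeff_list_prod_mem {A B ι κ : Type*} [Ring A] [Ring B] [Fintype ι] [DecidableEq ι]
    (𝒮 : Subsemiring (A × B)) {L : κ → Matrix ι ι (PowerSeries A)}
    {L' : κ → Matrix ι ι (PowerSeries B)} (l : List κ)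
    (h : ∀ i ∈ l, ∀ a b s, (coeff s (L i a b), coeff s (L' i a b)) ∈ 𝒮) (a b : ι) (s : ℕ) :
    (coeff s ((l.map L).prod a b), coeff s ((l.map L').prod a b)) ∈ 𝒮 := by
  induction l generalizing a s with
  | nil =>
    simp only [List.map_nil, List.prod_nil, Matrix.one_apply]
    split_ifs
    · simp only [coeff_one]
      split_ifs
      · exact one_mem 𝒮
      · exact zero_mem 𝒮
    · simp only [map_zero]
      exact zero_mem 𝒮
  | cons i l ih =>
    simp only [List.map_cons, List.prod_cons, Matrix.mul_apply, map_sum, coeff_mul]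
    have : ((∑ c, ∑ p ∈ Finset.HasAntidiagonal.antidiagonal s, coeff p.1 (L i a c) *
        coeff p.2 ((l.map L).prod c b), ∑ c, ∑ p ∈ Finset.HasAntidiagonal.antidiagonal s, coeff p.1 (L' i a c) *
        coeff p.2 ((l.map L').prod c b)) : A × B) =
        ∑ c, ∑ p ∈ Finset.HasAntidiagonal.antidiagonal s, (coeff p.1 (L i a c), coeff p.1 (L' i a c)) *
          (coeff p.2 ((l.map L).prod c b), coeff p.2 ((l.map L').prod c b)) := by
      ext <;> simp [Prod.fst_sum, Prod.snd_sum]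
    rw [this]
    refine sum_mem fun c _ => sum_mem fun p _ => mul_mem (h i (by simp) _ _ _) ?_
    exact ih (fun j hj => h j (by simp [hj])) _ _

theorem coeff_list_prod_mem_subsemiring {A ι κ : Type*} [Ring A] [Fintype ι] [DecidableEq ι]
    (𝒮 : Subsemiring A) {L : κ → Matrix ι ι (PowerSeries A)} (l : List κ)
    (h : ∀ i ∈ l, ∀ a b s, coeff s (L i a b) ∈ 𝒮) (a b : ι) (s : ℕ) :
    coeff s ((l.map L).prod a b) ∈ 𝒮 :=
  coeff_list_prod_mem (L' := L) (𝒮.comap (RingHom.fst A A)) l h a b s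

end SpinSutherland

end

/-! ### Compatibility of products of L-operators with antisymmetry. -/

noncomputable section

namespace SpinSutherland

open PowerSeries

/-- `h₁`, `h₂` are the resolvents at two neighbouring sites, and the last summand is the quadratic
part of the product of the two L-operators. The point is the right factor P + K: it vanishes on x as
soon as KPx = -x and K² = 1. -/
theorem antisymmetrizer_relation {S : Type*} [Ring S] {δ K P h₁ h₂ e₁ e₂ : S}
    (hδK : Commute δ K) (hδP : Commute δ P)
    (hKP : Commute K P) (k₁ : K * h₁ = h₂ * K - h₂ * h₁) (k₂ : K * h₂ = h₁ * K + h₁ * h₂)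
    (hh : Commute h₁ h₂) (p₁ : P * e₁ = e₂ * P) (p₂ : P * e₂ = e₁ * P) (pp : P * P = 1)
    (ke₁ : Commute K e₁) (ke₂ : Commute K e₂) (ph₁ : Commute P h₁) (ph₂ : Commute P h₂) :
    K * P * (δ + h₁ * e₁ + h₂ * e₂ + h₁ * h₂ * (P * e₁)) -
      (δ + h₁ * e₁ + h₂ * e₂ + h₁ * h₂ * (P * e₁)) * (K * P) =
    h₁ * h₂ * (e₁ - e₂) * (P + K) := by
  have t0 : K * P * δ = δ * (K * P) := ((hδK.mul_right hδP).eq).symm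
  have t1 : K * P * (h₁ * e₁) = h₂ * e₂ * (K * P) - h₁ * h₂ * e₂ * P := by
    calc K * P * (h₁ * e₁) = K * (P * h₁) * e₁ := by noncomm_ring
      _ = K * h₁ * (P * e₁) := by rw [ph₁.eq]; noncomm_ring
      _ = h₂ * (K * e₂) * P - h₂ * h₁ * e₂ * P := by rw [k₁, p₁]; noncomm_ring
      _ = _ := by rw [ke₂.eq, hh.eq]; noncomm_ring
  have t2 : K * P * (h₂ * e₂) = h₁ * e₁ * (K * P) + h₁ * h₂ * e₁ * P := by
    calc K * P * (h₂ * e₂) = K * (P * h₂) * e₂ := by noncomm_ring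
      _ = K * h₂ * (P * e₂) := by rw [ph₂.eq]; noncomm_ring
      _ = h₁ * (K * e₁) * P + h₁ * h₂ * e₁ * P := by rw [k₂, p₂]; noncomm_ring
      _ = _ := by rw [ke₁.eq]; noncomm_ring
  have t3 : K * P * (h₁ * h₂ * (P * e₁)) = h₁ * h₂ * e₁ * K := by
    have hk : K * (h₁ * h₂) = h₁ * h₂ * K := by
      calc K * (h₁ * h₂) = K * h₁ * h₂ := by noncomm_ring
        _ = h₂ * (K * h₂) - h₂ * h₁ * h₂ := by rw [k₁]; noncomm_ring
        _ = h₂ * h₁ * K := by rw [k₂]; noncomm_ring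
        _ = _ := by rw [hh.eq]
    calc K * P * (h₁ * h₂ * (P * e₁)) = K * (P * (h₁ * h₂)) * P * e₁ := by noncomm_ring
      _ = K * (h₁ * h₂) * (P * P) * e₁ := by rw [(ph₁.mul_right ph₂).eq]; noncomm_ring
      _ = h₁ * h₂ * (K * e₁) := by rw [pp, hk]; noncomm_ring
      _ = _ := by rw [ke₁.eq]; noncomm_ring
  have t4 : h₁ * h₂ * (P * e₁) * (K * P) = h₁ * h₂ * e₂ * K := by
    calc h₁ * h₂ * (P * e₁) * (K * P) = h₁ * h₂ * e₂ * P * (K * P) := by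
          rw [p₁]; noncomm_ring
      _ = h₁ * h₂ * e₂ * (P * P) * K := by rw [hKP.eq]; noncomm_ring
      _ = _ := by rw [pp]; noncomm_ring
  rw [mul_add, mul_add, mul_add, add_mul, add_mul, add_mul, t0, t1, t2, t3, t4]
  noncomm_ring

/-! ### Products of `L`-operators in an abstract algebra -/

/-- The `L`-operator `δ_{ab} + (u + D_i)⁻¹ E_{ba}^{(i)}` in an arbitrary ring. -/
def absL {A κ ι : Type*} [Ring A] [DecidableEq ι] (D : κ → A) (E : ι → ι → κ → A) (i : κ) :
    Matrix ι ι (PowerSeries A) :=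
  fun a b => (if a = b then 1 else 0) + resolvent (D i) * C (E b a i)

/-- The relations between commuting elements `D_i` and matrix units `E_{ab}^{(i)}`. -/
structure IsEvaluation {A κ ι : Type*} [Ring A] [DecidableEq ι] (D : κ → A)
    (E : ι → ι → κ → A) : Prop where
  comm_D : ∀ i j, Commute (D i) (D j)
  comm_DE : ∀ i j a b, Commute (D i) (E a b j)
  mul_E : ∀ a b c d i, E a b i * E c d i = if b = c then E a d i else 0
  comm_E : ∀ a b c d i j, i ≠ j → Commute (E a b i) (E c d j)

theorem commute_ite_one {S : Type*} [Ring S] (p : Prop) [Decidable p] (z : S) :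
    Commute (if p then (1 : S) else 0) z := by
  split_ifs
  · exact Commute.one_left z
  · exact Commute.zero_left z

section

variable {A κ ι : Type*} [Ring A] [DecidableEq ι] {D : κ → A} {E : ι → ι → κ → A}

theorem coeff_absL (i : κ) (a b : ι) (s : ℕ) :
    coeff s (absL D E i a b) = (if s = 0 then (if a = b then 1 else 0) else 0) +
      coeff s (resolvent (D i)) * E b a i := by
  rw [absL, map_add, coeff_mul_C]
  congr 1
  split_ifs <;> simp_all [coeff_one]

theorem coeff_zero_absL (i : κ) (a b : ι) :
    coeff 0 (absL D E i a b) = if a = b then 1 else 0 := by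
  rw [coeff_absL, resolvent, coeff_zero_X_mul, zero_mul, add_zero, if_pos rfl]

theorem coeff_succ_absL (i : κ) (a b : ι) (s : ℕ) :
    coeff (s + 1) (absL D E i a b) = (-D i) ^ s * E b a i := by
  rw [coeff_absL, resolvent, coeff_succ_X_mul, coeff_mk, if_neg s.succ_ne_zero, zero_add]

theorem coeff_absL_commute_of {i : κ} {y : A} (hD : Commute (D i) y) {a b : ι}
    (hE : Commute (E b a i) y) (s : ℕ) : Commute (coeff s (absL D E i a b)) y := by
  rw [coeff_absL]
  refine Commute.add_left ?_ ((coeff_resolvent_commute hD s).mul_left hE)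
  split_ifs <;> first | exact Commute.one_left _ | exact Commute.zero_left _

theorem IsEvaluation.coeff_absL_commute (h : IsEvaluation D E) {i j : κ} (hij : i ≠ j)
    (a b c d : ι) (r s : ℕ) : Commute (coeff r (absL D E i a b)) (coeff s (absL D E j c d)) :=
  coeff_absL_commute_of
    (coeff_absL_commute_of (h.comm_D j i) (h.comm_DE i j d c).symm s).symm
    (coeff_absL_commute_of (h.comm_DE j i b a) (h.comm_E d c b a j i hij.symm) s).symm r

variable [Fintype ι]

theorem IsEvaluation.RTT (h : IsEvaluation D E) {l : List κ} (hl : l.Nodup) :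
    RTT (X : PowerSeries (PowerSeries A)) (C X)
      ((l.map (absL D E)).prod.map (PowerSeries.map C)) ((l.map (absL D E)).prod.map C) :=
  RTT.list_prod
    (fun i => RTT.resolvent (h.comm_DE i i) (fun a b c d => h.mul_E a b c d i) fun _ _ => rfl)
    (fun _ _ hij a b c d _ _ => h.coeff_absL_commute hij a b c d _ _) _ hl

theorem coeff_zero_prod_absL (l : List κ) (a b : ι) :
    coeff 0 ((l.map (absL D E)).prod a b) = if a = b then 1 else 0 := by
  induction l generalizing a with
  | nil =>
    rw [List.map_nil, List.prod_nil, Matrix.one_apply]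
    split_ifs <;> simp
  | cons i l ih =>
    rw [List.map_cons, List.prod_cons, Matrix.mul_apply, map_sum]
    simp only [coeff_mul, Finset.Nat.antidiagonal_zero, Finset.sum_singleton, ih, coeff_zero_absL]
    simp

theorem IsEvaluation.absL_mul_absL (h : IsEvaluation D E) {i j : κ} {P : A}
    (hP : ∀ a c, ∑ d, E d a i * E c d j = P * E c a i) (a b : ι) :
    (absL D E i * absL D E j) a b = (if a = b then 1 else 0) +
      resolvent (D i) * C (E b a i) + resolvent (D j) * C (E b a j) +
      resolvent (D i) * resolvent (D j) * (C P * C (E b a i)) := by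
  have hc : ∀ c, (resolvent (D i) * C (E c a i)) * (resolvent (D j) * C (E b c j)) =
      resolvent (D i) * resolvent (D j) * C (E c a i * E b c j) := by
    intro c
    have := (C_commute_resolvent (h.comm_DE j i c a).symm).eq
    rw [mul_assoc, ← mul_assoc (C _), this, map_mul]
    noncomm_ring
  rw [Matrix.mul_apply]
  simp only [absL, add_mul, mul_add, Finset.sum_add_distrib, hc]
  rw [← Finset.mul_sum, ← map_sum, hP, map_mul]
  simp only [ite_mul, mul_ite, one_mul, mul_one, zero_mul, mul_zero, Finset.sum_ite_eq,
    Finset.sum_ite_eq', Finset.mem_univ, if_true]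
  abel

/-- The elements `K`, `P` exchange the `i`-th and the `j`-th site, up to the cross relation. -/
structure IsExchange (D : κ → A) (E : ι → ι → κ → A) (i j : κ) (K P : A) : Prop where
  comm_KP : Commute K P
  K_left : K * D i = D j * K + 1
  K_right : K * D j = D i * K + -1
  K_other : ∀ k, k ≠ i → k ≠ j → Commute K (D k)
  K_mul_K : K * K = 1
  comm_KE : ∀ a b k, Commute K (E a b k)
  P_left : ∀ a b, P * E a b i = E a b j * P
  P_right : ∀ a b, P * E a b j = E a b i * P
  P_other : ∀ a b k, k ≠ i → k ≠ j → Commute P (E a b k)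
  P_mul_P : P * P = 1
  comm_PD : ∀ k, Commute P (D k)
  sum_E : ∀ a c, ∑ d, E d a i * E c d j = P * E c a i

theorem IsExchange.absL_mul_absL {i j : κ} {K P : A} (h : IsEvaluation D E)
    (hx : IsExchange D E i j K P) (a b : ι) : ∃ Z : PowerSeries A,
      C K * C P * (absL D E i * absL D E j) a b =
        (absL D E i * absL D E j) a b * (C K * C P) + Z * (C P + C K) := by
  refine ⟨resolvent (D i) * resolvent (D j) * (C (E b a i) - C (E b a j)), ?_⟩
  rw [h.absL_mul_absL hx.sum_E, ← sub_eq_iff_eq_add']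
  refine antisymmetrizer_relation (commute_ite_one _ _) (commute_ite_one _ _) (hx.comm_KP.map C)
    ?_ ?_ (resolvent_commute (h.comm_D i j)) ?_ ?_ ?_ ((hx.comm_KE b a i).map C)
    ((hx.comm_KE b a j).map C) (C_commute_resolvent (hx.comm_PD i))
    (C_commute_resolvent (hx.comm_PD j))
  · have := resolvent_intertwine hx.K_left
    rwa [map_one, mul_one] at this
  · have := resolvent_intertwine hx.K_right
    rw [map_neg, map_one] at this
    rw [this]
    noncomm_ring
  · rw [← map_mul, ← map_mul, hx.P_left]
  · rw [← map_mul, ← map_mul, hx.P_right]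
  · rw [← map_mul, hx.P_mul_P, map_one]

/-- The centralizer of K and P is a subsemiring that contains all coefficients of the L-operators at
the other sites. -/
theorem IsExchange.commute_prod {i j : κ} {K P : A} (hx : IsExchange D E i j K P)
    {l : List κ} (hi : i ∉ l) (hj : j ∉ l) (a b : ι) :
    Commute (C K) ((l.map (absL D E)).prod a b) ∧
      Commute (C P) ((l.map (absL D E)).prod a b) := by
  have h := coeff_list_prod_mem_subsemiring (L := absL D E)
    (Subsemiring.centralizer {K, P}) l ?_ a b
  · simp only [Subsemiring.mem_centralizer_iff, Set.mem_insert_iff, Set.mem_singleton_iff,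
      forall_eq_or_imp, forall_eq] at h
    exact ⟨commute_coeff_of_C fun s => (h s).1, commute_coeff_of_C fun s => (h s).2⟩
  · intro k hk a b s
    have hki : k ≠ i := fun e => hi (e ▸ hk)
    have hkj : k ≠ j := fun e => hj (e ▸ hk)
    simp only [Subsemiring.mem_centralizer_iff, Set.mem_insert_iff, Set.mem_singleton_iff,
      forall_eq_or_imp, forall_eq]
    exact ⟨(coeff_absL_commute_of (hx.K_other k hki hkj).symm (hx.comm_KE b a k).symm s).symm,
      (coeff_absL_commute_of (hx.comm_PD k).symm (hx.P_other b a k hki hkj).symm s).symm⟩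

/-- The factors to the left and right of the two sites commute with K and P, so the error term of
the two-site product keeps its right factor P + K. -/
theorem IsExchange.prod_absL {i j : κ} {K P : A} (h : IsEvaluation D E)
    (hx : IsExchange D E i j K P) {l₁ l₂ : List κ}
    (hi₁ : i ∉ l₁) (hj₁ : j ∉ l₁) (hi₂ : i ∉ l₂) (hj₂ : j ∉ l₂) (a b : ι) (s : ℕ) :
    ∃ z : A, K * P * coeff s (((l₁ ++ i :: j :: l₂).map (absL D E)).prod a b) =
      coeff s (((l₁ ++ i :: j :: l₂).map (absL D E)).prod a b) * (K * P) + z * (P + K) := by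
  set U := (l₁.map (absL D E)).prod with hU
  set V := (l₂.map (absL D E)).prod with hV
  set M := absL D E i * absL D E j with hM
  have hT : ((l₁ ++ i :: j :: l₂).map (absL D E)).prod = U * M * V := by
    rw [List.map_append, List.prod_append, List.map_cons, List.map_cons,
      List.prod_cons, List.prod_cons, mul_assoc, hM, mul_assoc]
  choose Z hZ using hx.absL_mul_absL h
  refine ⟨coeff s (∑ d, (∑ c, U a c * Z c d) * V d b), ?_⟩
  have key : C K * C P * (U * M * V) a b = (U * M * V) a b * (C K * C P) +
      (∑ d, (∑ c, U a c * Z c d) * V d b) * (C P + C K) := by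
    simp only [Matrix.mul_apply (M := U * M), Matrix.mul_apply (M := U) (N := M),
      Finset.sum_mul, Finset.mul_sum, ← Finset.sum_add_distrib]
    refine Finset.sum_congr rfl fun d _ => Finset.sum_congr rfl fun c _ => ?_
    obtain ⟨c1, c2⟩ := hx.commute_prod hi₁ hj₁ a c
    obtain ⟨c3, c4⟩ := hx.commute_prod hi₂ hj₂ d b
    calc C K * C P * (U a c * M c d * V d b)
        = (C K * C P * U a c) * M c d * V d b := by noncomm_ring
      _ = U a c * (C K * C P * M c d) * V d b := by
          rw [(c1.mul_left c2).eq]; noncomm_ring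
      _ = U a c * M c d * (C K * C P * V d b) + U a c * Z c d * ((C P + C K) * V d b) := by
          rw [hZ]; noncomm_ring
      _ = _ := by rw [(c3.mul_left c4).eq, (c4.add_left c3).eq]; noncomm_ring
  have e := congrArg (coeff s) key
  rw [← map_mul, ← map_add, map_add, coeff_C_mul, coeff_mul_C, coeff_mul_C] at e
  rw [hT]
  exact e

end

theorem finRange_split {n : ℕ} {i j : Fin n} (hij : (i : ℕ) + 1 = j) :
    ∃ l₁ l₂ : List (Fin n), List.finRange n = l₁ ++ i :: j :: l₂ ∧
      i ∉ l₁ ∧ j ∉ l₁ ∧ i ∉ l₂ ∧ j ∉ l₂ := by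
  have hi := i.2
  have hj := j.2
  have hl := List.take_append_drop (i : ℕ) (List.finRange n)
  rw [List.drop_eq_getElem_cons (by simp), List.drop_eq_getElem_cons (by simp; omega),
    List.getElem_finRange, List.getElem_finRange] at hl
  have ei : Fin.cast (List.length_finRange (n := n)) ⟨(i : ℕ), by simp⟩ = i := rfl
  have ej : Fin.cast (List.length_finRange (n := n)) ⟨(i : ℕ) + 1, by simp; omega⟩ = j :=
    Fin.ext hij
  rw [ei, ej] at hl
  have hnd := List.nodup_finRange n
  rw [← hl] at hnd
  refine ⟨_, _, hl.symm, ?_⟩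
  generalize List.take (i : ℕ) (List.finRange n) = l₁ at *
  generalize List.drop ((i : ℕ) + 1 + 1) (List.finRange n) = l₂ at *
  simp only [List.nodup_append, List.nodup_cons, List.mem_cons, not_or] at hnd
  refine ⟨fun h => hnd.2.2 i h i (Or.inl rfl) rfl, fun h => hnd.2.2 j h j (Or.inr (Or.inl rfl)) rfl,
    hnd.2.1.1.2, hnd.2.1.2.1⟩

theorem IsExchange.prod_finRange_apply {n : ℕ} {ι M : Type*} [Fintype ι] [DecidableEq ι]
    [AddCommGroup M] [Module ℂ M] {D : Fin n → Module.End ℂ M}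
    {E : ι → ι → Fin n → Module.End ℂ M} (h : IsEvaluation D E) {i j : Fin n}
    (hij : (i : ℕ) + 1 = j) {K P : Module.End ℂ M}
    (hx : IsExchange D E i j K P) (a b : ι) (s : ℕ) {x : M} (hKP : K (P x) = -x) :
    K (P (coeff s (((List.finRange n).map (absL D E)).prod a b) x)) =
      -coeff s (((List.finRange n).map (absL D E)).prod a b) x := by
  obtain ⟨l₁, l₂, hl, hi₁, hj₁, hi₂, hj₂⟩ := finRange_split hij
  obtain ⟨z, hz⟩ := hx.prod_absL h hi₁ hj₁ hi₂ hj₂ a b s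
  rw [← hl] at hz
  -- Applying K to KPx = -x and using K² = 1 gives Px = -Kx, so the error term vanishes on x.
  have hx' : P x + K x = 0 := by
    have := congrArg K hKP
    rw [← Module.End.mul_apply, hx.K_mul_K, Module.End.one_apply, map_neg] at this
    rw [this]
    abel
  have e := LinearMap.congr_fun hz x
  simp only [Module.End.mul_apply, LinearMap.add_apply, hKP, hx', map_zero, add_zero, map_neg] at e
  exact e

/-! ### Multiplication by scalar series. -/

theorem scalar_series_commute {A : Type*} [Ring A] [Algebra ℂ A] (f : PowerSeries ℂ)
    (z : PowerSeries A) : Commute (PowerSeries.map (algebraMap ℂ A) f) z :=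
  series_commute fun m n => by
    rw [coeff_map]
    exact Algebra.commutes _ _

theorem scalar_series_coeff_commute {A : Type*} [Ring A] [Algebra ℂ A] (f : PowerSeries ℂ)
    (z : PowerSeries (PowerSeries A)) :
    Commute (PowerSeries.map C (PowerSeries.map (algebraMap ℂ A) f)) z :=
  series_commute fun m n => by
    rw [coeff_map, coeff_map]
    exact commute_coeff_of_C fun m => Algebra.commutes _ _

theorem RTT.scalar_mul {A ι : Type*} [Ring A] [Algebra ℂ A] (f : PowerSeries ℂ)
    {T : Matrix ι ι (PowerSeries A)}
    (h : RTT (X : PowerSeries (PowerSeries A)) (C X) (T.map (PowerSeries.map C)) (T.map C)) :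
    RTT (X : PowerSeries (PowerSeries A)) (C X)
      ((Matrix.of fun a b => PowerSeries.map (algebraMap ℂ A) f * T a b).map (PowerSeries.map C))
      ((Matrix.of fun a b => PowerSeries.map (algebraMap ℂ A) f * T a b).map C) := by
  intro a b c d
  have := RTT.smul (scalar_series_coeff_commute f) (g := C (PowerSeries.map (algebraMap ℂ A) f))
    (fun z => commute_coeff_of_C fun m => scalar_series_commute _ _) h a b c d
  simp only [Matrix.map_apply, Matrix.of_apply, map_mul] at this ⊢
  exact this

theorem coeff_scalar_mul {A : Type*} [Semiring A] [Algebra ℂ A] (f : PowerSeries ℂ)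
    (T : PowerSeries A) (s : ℕ) : coeff s (PowerSeries.map (algebraMap ℂ A) f * T) =
      ∑ p ∈ Finset.HasAntidiagonal.antidiagonal s, coeff p.1 f • coeff p.2 T := by
  rw [coeff_mul]
  refine Finset.sum_congr rfl fun p _ => ?_
  rw [coeff_map, Algebra.smul_def]

end SpinSutherland

end

noncomputable section

namespace SpinSutherland

open PowerSeries

/-! ### The operators `T_{ab}(u; β; n)` satisfy the relations of the Yangian -/

theorem tensorMap_mul {N n : ℕ} (f f' : Module.End ℂ (Laurent n)) (g g' : Module.End ℂ (Spin N n)) :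
    (TensorProduct.map f g * TensorProduct.map f' g' : Module.End ℂ (Amb N n)) =
      TensorProduct.map (f * f') (g * g') := (TensorProduct.map_mul f f' g g').symm

theorem tensorMap_commute {N n : ℕ} {f f' : Module.End ℂ (Laurent n)}
    {g g' : Module.End ℂ (Spin N n)} (hf : Commute f f') (hg : Commute g g') :
    Commute (TensorProduct.map f g : Module.End ℂ (Amb N n)) (TensorProduct.map f' g') := by
  change _ * _ = _ * _
  rw [tensorMap_mul, tensorMap_mul, hf.eq, hg.eq]

/-- The Cherednik-Dunkl operator acting on the polynomial factor. -/
def ambD (N : ℕ) {n : ℕ} (β : ℂ) (i : Fin n) : Module.End ℂ (Amb N n) :=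
  TensorProduct.map (dunkl β i) 1

/-- The matrix unit acting on the `i`-th factor of the spin part. -/
def ambE (N : ℕ) {n : ℕ} (a b : Fin N) (i : Fin n) : Module.End ℂ (Amb N n) :=
  TensorProduct.map 1 (unitAt N a b i)

/-- The exchange of the variables `z_i` and `z_j`. -/
def ambK (N : ℕ) {n : ℕ} (i j : Fin n) : Module.End ℂ (Amb N n) :=
  TensorProduct.map (permK i j) 1

/-- The exchange of the `i`-th and the `j`-th factor of the spin part. -/
def ambP (N : ℕ) {n : ℕ} (i j : Fin n) : Module.End ℂ (Amb N n) :=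
  TensorProduct.map 1 (flip N i j)

theorem tensorMap_one_one {N n : ℕ} :
    (TensorProduct.map 1 1 : Module.End ℂ (Amb N n)) = 1 := TensorProduct.map_one

theorem tensorMap_one_mul {N n : ℕ} (g g' : Module.End ℂ (Spin N n)) :
    (TensorProduct.map 1 g * TensorProduct.map 1 g' : Module.End ℂ (Amb N n)) =
      TensorProduct.map 1 (g * g') := by rw [tensorMap_mul, one_mul]

theorem tensorMap_mul_one {N n : ℕ} (f f' : Module.End ℂ (Laurent n)) :
    (TensorProduct.map f 1 * TensorProduct.map f' 1 : Module.End ℂ (Amb N n)) =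
      TensorProduct.map (f * f') 1 := by rw [tensorMap_mul, one_mul]

theorem ambD_commute {N n : ℕ} (β : ℂ) (i j : Fin n) : Commute (ambD N β i) (ambD N β j) :=
  tensorMap_commute (dunkl_commute β i j) (Commute.refl _)

theorem ambD_commute_ambE {N n : ℕ} (β : ℂ) (i j : Fin n) (a b : Fin N) :
    Commute (ambD N β i) (ambE N a b j) :=
  tensorMap_commute (Commute.one_right _) (Commute.one_left _)

theorem ambK_commute_ambP {N n : ℕ} (i j k l : Fin n) :
    Commute (ambK N i j) (ambP N k l) :=
  tensorMap_commute (Commute.one_right _) (Commute.one_left _)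

theorem ambK_commute_ambE {N n : ℕ} (i j k : Fin n) (a b : Fin N) :
    Commute (ambK N i j) (ambE N a b k) :=
  tensorMap_commute (Commute.one_right _) (Commute.one_left _)

theorem ambP_commute_ambD {N n : ℕ} (β : ℂ) (i j k : Fin n) :
    Commute (ambP N i j) (ambD N β k) :=
  tensorMap_commute (Commute.one_left _) (Commute.one_right _)

theorem ambE_mul_ambE {N n : ℕ} (a b c d : Fin N) (i : Fin n) :
    ambE N a b i * ambE N c d i = if b = c then ambE N a d i else 0 := by
  rw [ambE, ambE, tensorMap_one_mul, unitAt_mul_unitAt]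
  split_ifs
  · rfl
  · exact TensorProduct.map_zero_right _

theorem ambE_commute {N n : ℕ} (a b c d : Fin N) {i j : Fin n} (hij : i ≠ j) :
    Commute (ambE N a b i) (ambE N c d j) :=
  tensorMap_commute (Commute.refl _) (unitAt_commute a b c d hij)

theorem ambP_mul_ambE {N n : ℕ} (a b : Fin N) (i j k : Fin n) :
    ambP N i j * ambE N a b k = ambE N a b (Equiv.swap i j k) * ambP N i j := by
  rw [ambP, ambE, tensorMap_one_mul, flip_mul_unitAt, ← tensorMap_one_mul, ambE]

theorem ambP_mul_self {N n : ℕ} (i j : Fin n) : ambP N i j * ambP N i j = 1 := by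
  rw [ambP, tensorMap_one_mul, flip_mul_self, tensorMap_one_one]

theorem ambK_mul_self {N n : ℕ} (i j : Fin n) : ambK N i j * ambK N i j = 1 := by
  rw [ambK, tensorMap_mul_one, permK_mul_self, tensorMap_one_one]

theorem sum_ambE_mul_ambE {N n : ℕ} (a c : Fin N) {i j : Fin n} (hij : i ≠ j) :
    ∑ d, ambE N d a i * ambE N c d j = ambP N i j * ambE N c a i := by
  simp only [ambE, ambP, tensorMap_one_mul, ← sum_unitAt_mul_unitAt a c hij]
  exact (map_sum (TensorProduct.mapBilinear (RingHom.id ℂ) (Laurent n) (Spin N n) _ _ 1) _ _).symm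

theorem isEvaluation (N : ℕ) {n : ℕ} (β : ℂ) :
    IsEvaluation (ambD N (n := n) β) (fun a b i => ambE N a b i) where
  comm_D := ambD_commute β
  comm_DE := ambD_commute_ambE β
  mul_E := ambE_mul_ambE
  comm_E _ _ _ _ _ _ hij := ambE_commute _ _ _ _ hij

theorem isExchange (N : ℕ) {n : ℕ} (β : ℂ) {i j : Fin n} (hij : (i : ℕ) + 1 = j) :
    IsExchange (ambD N β) (fun a b k => ambE N a b k) i j (ambK N i j) (ambP N i j) where
  comm_KP := ambK_commute_ambP i j i j
  K_left := by
    rw [ambK, ambD, ambD, tensorMap_mul_one, tensorMap_mul_one, permK_mul_dunkl_left β hij,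
      TensorProduct.map_add_left, tensorMap_one_one]
  K_right := by
    have h : TensorProduct.map (-1) 1 = (-1 : Module.End ℂ (Amb N n)) :=
      TensorProduct.ext' fun x y => TensorProduct.neg_tmul x y
    rw [ambK, ambD, ambD, tensorMap_mul_one, tensorMap_mul_one, permK_mul_dunkl_right β hij,
      sub_eq_add_neg, TensorProduct.map_add_left, h]
  K_other _ hi hj := tensorMap_commute (permK_commute_dunkl β hij hi hj) (Commute.refl _)
  K_mul_K := ambK_mul_self i j
  comm_KE a b k := ambK_commute_ambE i j k a b
  P_left a b := by rw [ambP_mul_ambE, Equiv.swap_apply_left]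
  P_right a b := by rw [ambP_mul_ambE, Equiv.swap_apply_right]
  P_other a b k hi hj := by
    have := ambP_mul_ambE (N := N) a b i j k
    rwa [Equiv.swap_apply_of_ne_of_ne hi hj] at this
  P_mul_P := ambP_mul_self i j
  comm_PD := ambP_commute_ambD β i j
  sum_E a c := sum_ambE_mul_ambE a c fun e => by simp [e] at hij

theorem lOp_eq (N : ℕ) {n : ℕ} (β : ℂ) (i : Fin n) :
    lOp N β i = absL (ambD N β) (fun a b k => ambE N a b k) i := by
  refine Matrix.ext fun a b => PowerSeries.ext fun s => ?_
  cases s with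
  | zero => exact (coeff_mk _ _).trans (Eq.trans rfl (coeff_zero_absL (D := ambD N β)
      (E := fun a b k => ambE N a b k) i a b).symm)
  | succ s =>
    have h1 : (-ambD N β i) ^ s = TensorProduct.map ((-dunkl β i) ^ s) 1 := by
      have h2 : -ambD N β i = TensorProduct.map (-dunkl β i) 1 :=
        TensorProduct.ext' fun x y => (TensorProduct.neg_tmul (dunkl β i x) y).symm
      rw [h2, TensorProduct.map_pow, one_pow]
    refine (coeff_mk _ _).trans (Eq.trans ?_ (coeff_succ_absL i a b s).symm)
    rw [h1, ambE, tensorMap_mul, mul_one, one_mul]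

theorem tSeries_eq (N n : ℕ) (β : ℂ) :
    tSeries N n β = ((List.finRange n).map (absL (ambD N β) (fun a b k => ambE N a b k))).prod := by
  rw [tSeries, List.ofFn_eq_map]
  have : (fun i : Fin n => lOp N β i) = absL (ambD N β) (fun a b k => ambE N a b k) :=
    funext fun i => lOp_eq N β i
  rw [this]

theorem coeff_tSeries (N n : ℕ) (β : ℂ) (a b : Fin N) (s : ℕ) :
    coeff s (tSeries N n β a b) = coeff s
      (((List.finRange n).map (absL (ambD N β) (fun a b k => ambE N a b k))).prod a b) := by
  rw [tSeries_eq]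

theorem tBar_eq_coeff (N : ℕ) (β : ℂ) (k s : ℕ) (a b : Fin N) :
    tBar N β k s a b = coeff s (PowerSeries.map (algebraMap ℂ _) (fSeries N β k) *
      ((List.finRange (k * N)).map (absL (ambD N β) (fun a b k => ambE N a b k))).prod a b) := by
  rw [tBar, tBarSeries, tSeries_eq]

theorem tBar_relation (N : ℕ) (β : ℂ) (k r s : ℕ) (a b c d : Fin N) :
    (tBar N β k (r + 1) a b * tBar N β k s c d - tBar N β k s c d * tBar N β k (r + 1) a b) -
        (tBar N β k r a b * tBar N β k (s + 1) c d - tBar N β k (s + 1) c d * tBar N β k r a b) =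
      tBar N β k s c b * tBar N β k r a d - tBar N β k r c b * tBar N β k s a d := by
  simp only [tBar_eq_coeff]
  exact coeff_relation_of_RTT (RTT.scalar_mul (fSeries N β k)
    ((isEvaluation N β).RTT (List.nodup_finRange _))) r s a b c d

theorem coeff_zero_fSeries (N : ℕ) (β : ℂ) (r : ℕ) : coeff 0 (fSeries N β r) = 1 := by
  rw [coeff_zero_eq_constantCoeff_apply, fSeries, map_prod]
  refine Finset.prod_eq_one fun s _ => ?_
  simp

theorem tBar_eq_sum (N : ℕ) (β : ℂ) (r s : ℕ) (a b : Fin N) :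
    tBar N β r s a b = ∑ p ∈ Finset.HasAntidiagonal.antidiagonal s,
      coeff p.1 (fSeries N β r) • coeff p.2 (tSeries N (r * N) β a b) := by
  rw [tBar, tBarSeries]
  exact coeff_scalar_mul _ _ _

theorem tBar_zero (N : ℕ) (β : ℂ) (r : ℕ) (a b : Fin N) :
    tBar N β r 0 a b = if a = b then 1 else 0 := by
  rw [tBar_eq_sum, Finset.Nat.antidiagonal_zero, Finset.sum_singleton,
    coeff_zero_fSeries, one_smul, coeff_tSeries]
  exact coeff_zero_prod_absL _ _ _

theorem coeff_tSeries_antisymm {N n : ℕ} (β : ℂ) {i j : Fin n} (hij : (i : ℕ) + 1 = j)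
    (a b : Fin N) (s : ℕ) {x : Amb N n}
    (hx : ambK N i j (ambP N i j x) = -x) :
    ambK N i j (ambP N i j (coeff s (tSeries N n β a b) x)) = -coeff s (tSeries N n β a b) x := by
  rw [coeff_tSeries]
  exact (isExchange N β hij).prod_finRange_apply (isEvaluation N β) hij a b s hx

end SpinSutherland

end

noncomputable section

namespace SpinSutherland

open PowerSeries

/-! ### The space of states -/

theorem bar_eq {N : ℕ} (c : Fin N) (t : ℤ) : bar N (((c : ℕ) + 1 : ℤ) - N * t) = t := by
  have hc : ((c : ℕ) : ℤ) < N := by exact_mod_cast c.2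
  have h0 : (0 : ℤ) ≤ (c : ℕ) := Int.natCast_nonneg _
  rw [bar, show (((c : ℕ) + 1 : ℤ) - N * t - 1) = (c : ℕ) + N * (-t) by ring,
    Int.add_mul_ediv_left _ _ (by omega), Int.ediv_eq_zero_of_lt h0 hc]
  ring

theorem under_eq {N : ℕ} [NeZero N] (c : Fin N) (t : ℤ) :
    under N (((c : ℕ) + 1 : ℤ) - N * t) = c := by
  have hc : ((c : ℕ) : ℤ) < N := by exact_mod_cast c.2
  have h0 : (0 : ℤ) ≤ (c : ℕ) := Int.natCast_nonneg _
  have h := under_bar N (((c : ℕ) + 1 : ℤ) - N * t)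
  rw [bar_eq] at h
  exact Fin.ext (by omega)

/-- The bijection `k ↦ (k̄, k̲)`. -/
def barUnder (N : ℕ) [NeZero N] (n : ℕ) :
    (Fin n → ℤ) × (Fin n → Fin N) ≃ (Fin n → ℤ) where
  toFun p i := ((p.2 i : ℕ) + 1 : ℤ) - N * p.1 i
  invFun k := (fun i => bar N (k i), fun i => under N (k i))
  left_inv p := by simp only [bar_eq, under_eq]
  right_inv k := funext fun i => (under_bar N (k i)).symm

/-- The basis `u_{k_1} ⊗ ⋯ ⊗ u_{k_n}`. -/
def uvecBasis (N : ℕ) [NeZero N] (n : ℕ) : Module.Basis (Fin n → ℤ) ℂ (Amb N n) :=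
  ((AddMonoidAlgebra.basis (Fin n → ℤ) ℂ).tensorProduct
    (Basis.piTensorProduct fun _ : Fin n => Pi.basisFun ℂ (Fin N))).reindex (barUnder N n)

theorem uvecBasis_apply (N : ℕ) [NeZero N] {n : ℕ} (k : Fin n → ℤ) :
    uvecBasis N n k = uvec N k := by
  simp [uvecBasis, barUnder, uvec, mono, Module.Basis.tensorProduct_apply,
    Basis.piTensorProduct_apply]

theorem uvec_eq (N : ℕ) [NeZero N] {n : ℕ} (k : Fin n → ℤ) :
    uvec N k = mono (fun i => bar N (k i)) ⊗ₜ[ℂ] spinVec (fun i => under N (k i)) := rfl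

theorem ambK_ambP_uvec (N : ℕ) [NeZero N] {n : ℕ} (i j : Fin n) (k : Fin n → ℤ) :
    ambK N i j (ambP N i j (uvec N k)) = uvec N (k ∘ Equiv.swap i j) := by
  rw [uvec_eq, ambP, ambK, TensorProduct.map_tmul, TensorProduct.map_tmul,
    Module.End.one_apply, Module.End.one_apply, permK_mono, flip_spinVec]
  rfl

/-- The action of a permutation on `(ℂ[z^{±1}] ⊗ ℂ^N)^{⊗ n}`. -/
def permAmb (N : ℕ) [NeZero N] {n : ℕ} (w : Equiv.Perm (Fin n)) : Module.End ℂ (Amb N n) :=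
  (uvecBasis N n).constr ℂ fun k => uvec N (k ∘ w)

theorem permAmb_uvec (N : ℕ) [NeZero N] {n : ℕ} (w : Equiv.Perm (Fin n)) (k : Fin n → ℤ) :
    permAmb N w (uvec N k) = uvec N (k ∘ w) := by
  rw [permAmb, ← uvecBasis_apply, Module.Basis.constr_basis]

theorem amb_hom_ext (N : ℕ) [NeZero N] {n : ℕ} {M : Type*} [AddCommMonoid M] [Module ℂ M]
    {f g : Amb N n →ₗ[ℂ] M} (h : ∀ k, f (uvec N k) = g (uvec N k)) : f = g :=
  (uvecBasis N n).ext fun k => by rw [uvecBasis_apply]; exact h k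

theorem permAmb_swap (N : ℕ) [NeZero N] {n : ℕ} (i j : Fin n) (x : Amb N n) :
    permAmb N (Equiv.swap i j) x = ambK N i j (ambP N i j x) := by
  refine LinearMap.congr_fun (f := permAmb N (Equiv.swap i j)) (g := ambK N i j ∘ₗ ambP N i j)
    (amb_hom_ext N fun k => ?_) x
  rw [LinearMap.comp_apply, permAmb_uvec, ambK_ambP_uvec]

/-- Permutations act by precomposition on the indices, hence from the right; the order of
composition is reversed. -/
theorem permAmb_mul (N : ℕ) [NeZero N] {n : ℕ} (v w : Equiv.Perm (Fin n)) (x : Amb N n) :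
    permAmb N (v * w) x = permAmb N w (permAmb N v x) := by
  refine LinearMap.congr_fun (f := permAmb N (v * w)) (g := permAmb N w ∘ₗ permAmb N v)
    (amb_hom_ext N fun k => ?_) x
  rw [LinearMap.comp_apply, permAmb_uvec, permAmb_uvec, permAmb_uvec]
  rfl

theorem permAmb_one (N : ℕ) [NeZero N] {n : ℕ} (x : Amb N n) :
    permAmb N (1 : Equiv.Perm (Fin n)) x = x := by
  refine LinearMap.congr_fun (f := permAmb N 1) (g := LinearMap.id)
    (amb_hom_ext N fun k => ?_) x
  rw [permAmb_uvec]
  rfl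

theorem permAmb_wedge (N : ℕ) [NeZero N] {n : ℕ} (w : Equiv.Perm (Fin n)) (k : Fin n → ℤ) :
    permAmb N w (wedge N k) = ((Equiv.Perm.sign w : ℤ) : ℂ) • wedge N k := by
  rw [wedge, map_sum, Finset.smul_sum, ← Equiv.sum_comp (Equiv.mulRight w⁻¹)]
  refine Finset.sum_congr rfl fun v _ => ?_
  rw [map_smul, permAmb_uvec, smul_smul, Equiv.coe_mulRight, Equiv.Perm.sign_mul,
    Equiv.Perm.sign_inv, Function.comp_assoc, ← Equiv.Perm.coe_mul, mul_assoc, inv_mul_cancel,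
    mul_one]
  congr 1
  push_cast
  ring

theorem wedge_comp (N : ℕ) [NeZero N] {n : ℕ} (w : Equiv.Perm (Fin n)) (k : Fin n → ℤ) :
    wedge N (k ∘ w) = ((Equiv.Perm.sign w : ℤ) : ℂ) • wedge N k := by
  rw [wedge, wedge, Finset.smul_sum, ← Equiv.sum_comp (Equiv.mulLeft w⁻¹)]
  refine Finset.sum_congr rfl fun v _ => ?_
  rw [smul_smul, Equiv.coe_mulLeft, Equiv.Perm.sign_mul, Equiv.Perm.sign_inv,
    Function.comp_assoc, ← Equiv.Perm.coe_mul, mul_inv_cancel_left]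
  push_cast
  rfl

/-- The antisymmetrizer. -/
def alt (N : ℕ) [NeZero N] (n : ℕ) : Module.End ℂ (Amb N n) :=
  ∑ w : Equiv.Perm (Fin n), ((Equiv.Perm.sign w : ℤ) : ℂ) • permAmb N w

theorem alt_uvec (N : ℕ) [NeZero N] {n : ℕ} (k : Fin n → ℤ) : alt N n (uvec N k) = wedge N k := by
  simp only [alt, LinearMap.sum_apply, LinearMap.smul_apply, permAmb_uvec, wedge]

theorem sign_mul_sign_cast {n : ℕ} (w : Equiv.Perm (Fin n)) :
    ((Equiv.Perm.sign w : ℤ) : ℂ) * ((Equiv.Perm.sign w : ℤ) : ℂ) = 1 := by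
  rw [← Int.cast_mul, ← Units.val_mul, Int.units_mul_self, Units.val_one, Int.cast_one]

theorem alt_of_antisymm (N : ℕ) [NeZero N] {n : ℕ} {x : Amb N n}
    (hx : ∀ w : Equiv.Perm (Fin n), permAmb N w x = ((Equiv.Perm.sign w : ℤ) : ℂ) • x) :
    x = ((n.factorial : ℂ))⁻¹ • alt N n x := by
  simp only [alt, LinearMap.sum_apply, LinearMap.smul_apply, hx, smul_smul, sign_mul_sign_cast,
    one_smul, Finset.sum_const, Finset.card_univ, Fintype.card_perm, Fintype.card_fin]
  rw [← Nat.cast_smul_eq_nsmul ℂ, smul_smul, inv_mul_cancel₀, one_smul]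
  exact_mod_cast n.factorial_ne_zero

theorem sign_swap_smul {N n m : ℕ} {i j : Fin n} (hij : i ≠ j) (x : Amb N m) :
    ((Equiv.Perm.sign (Equiv.swap i j) : ℤ) : ℂ) • x = -x := by
  rw [Equiv.Perm.sign_swap hij]
  have : (((-1 : ℤˣ) : ℤ) : ℂ) = -1 := by simp
  rw [this]
  exact neg_one_smul ℂ x

/-- The adjacent transpositions generate the symmetric group. -/
theorem permAmb_of_adjacent (N : ℕ) [NeZero N] {n : ℕ} {x : Amb N n}
    (hx : ∀ i j : Fin n, (i : ℕ) + 1 = j → ambK N i j (ambP N i j x) = -x)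
    (w : Equiv.Perm (Fin n)) : permAmb N w x = ((Equiv.Perm.sign w : ℤ) : ℂ) • x := by
  cases n with
  | zero =>
    rw [Subsingleton.elim w 1, permAmb_one]
    simp
  | succ n =>
    have hw : w ∈ Submonoid.closure
        (Set.range fun i : Fin n => Equiv.swap i.castSucc i.succ) := by
      rw [Equiv.Perm.mclosure_swap_castSucc_succ]
      trivial
    induction hw using Submonoid.closure_induction with
    | mem w hw =>
      obtain ⟨i, rfl⟩ := hw
      dsimp only
      rw [permAmb_swap, hx _ _ (by simp), sign_swap_smul Fin.castSucc_lt_succ.ne]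
    | one => rw [permAmb_one]; simp
    | mul v w _ _ hv hw =>
      rw [permAmb_mul, hv, map_smul, hw, smul_smul, Equiv.Perm.sign_mul]
      push_cast
      rfl

theorem permAmb_of_mem_stateSpace (N : ℕ) [NeZero N] {n : ℕ} {x : Amb N n}
    (hx : x ∈ stateSpace N n) (w : Equiv.Perm (Fin n)) :
    permAmb N w x = ((Equiv.Perm.sign w : ℤ) : ℂ) • x := by
  induction hx using Submodule.span_induction with
  | mem x hx =>
    obtain ⟨k, rfl⟩ := hx
    exact permAmb_wedge N w k
  | zero => simp
  | add x y _ _ hx hy => rw [map_add, hx, hy, smul_add]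
  | smul c x _ hx => rw [map_smul, hx, smul_comm]

/-- An antisymmetric combination of the `u_{k_1} ⊗ ⋯ ⊗ u_{k_n}`, `k ∈ Q`, is a combination of the
wedges `û_k`, `k ∈ Q`. -/
theorem mem_span_wedge_of_antisymm (N : ℕ) [NeZero N] {n : ℕ} {x : Amb N n}
    (hx : ∀ w : Equiv.Perm (Fin n), permAmb N w x = ((Equiv.Perm.sign w : ℤ) : ℂ) • x)
    {Q : Set (Fin n → ℤ)} (hQ : x ∈ Submodule.span ℂ (uvec N '' Q)) :
    x ∈ Submodule.span ℂ (wedge N '' Q) := by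
  rw [alt_of_antisymm N hx]
  refine Submodule.smul_mem _ _ ?_
  have h := Submodule.mem_map_of_mem (f := alt N n) hQ
  rw [Submodule.map_span, ← Set.image_comp] at h
  rwa [show (alt N n ∘ uvec N : (Fin n → ℤ) → Amb N n) = wedge N from funext (alt_uvec N)] at h

/-- Adjacent exchanges suffice, and they are the ones for which the Dunkl operators have simple
cross relations. -/
theorem mem_stateSpace_of_adjacent (N : ℕ) [NeZero N] {n : ℕ} {x : Amb N n}
    (hx : ∀ i j : Fin n, (i : ℕ) + 1 = j → ambK N i j (ambP N i j x) = -x) :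
    x ∈ stateSpace N n := by
  have h := mem_span_wedge_of_antisymm N (permAmb_of_adjacent N hx) (Q := Set.univ) (by
    have : uvec N '' (Set.univ : Set (Fin n → ℤ)) = Set.range (uvecBasis N n) := by
      rw [Set.image_univ]
      exact congrArg Set.range (funext fun k => (uvecBasis_apply N k).symm)
    rw [this, (uvecBasis N n).span_eq]
    trivial)
  rwa [Set.image_univ] at h

theorem swap_of_mem_stateSpace (N : ℕ) [NeZero N] {n : ℕ} {x : Amb N n}
    (hx : x ∈ stateSpace N n) {i j : Fin n} (hij : i ≠ j) :
    ambK N i j (ambP N i j x) = -x := by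
  rw [← permAmb_swap, permAmb_of_mem_stateSpace N hx, sign_swap_smul hij]

theorem coeff_tSeries_mem_stateSpace (N : ℕ) [NeZero N] {n : ℕ} (β : ℂ) (a b : Fin N) (s : ℕ)
    {x : Amb N n} (hx : x ∈ stateSpace N n) :
    coeff s (tSeries N n β a b) x ∈ stateSpace N n :=
  mem_stateSpace_of_adjacent N fun i j hij => coeff_tSeries_antisymm β hij a b s
    (swap_of_mem_stateSpace N hx fun e => by simp [e] at hij)

theorem wedge_eq_zero (N : ℕ) [NeZero N] {n : ℕ} {k : Fin n → ℤ} {i j : Fin n} (hij : i ≠ j)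
    (hk : k i = k j) : wedge N k = 0 := by
  have h := wedge_comp N (Equiv.swap i j) k
  have hk' : k ∘ Equiv.swap i j = k := by
    funext l
    rw [Function.comp_apply, Equiv.swap_apply_def]
    split_ifs with h1 h2
    · rw [h1, hk]
    · rw [h2, hk]
    · rfl
  rw [hk', sign_swap_smul hij] at h
  have h2 : (2 : ℂ) • wedge N k = 0 := by
    rw [two_smul]
    nth_rewrite 1 [h]
    exact neg_add_cancel _
  exact (smul_eq_zero.mp h2).resolve_left two_ne_zero

theorem exists_perm_strictAnti {n : ℕ} {k : Fin n → ℤ} (hk : Function.Injective k) :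
    ∃ w : Equiv.Perm (Fin n), StrictAnti (k ∘ w) := by
  refine ⟨Tuple.sort (fun i => -k i), ?_⟩
  have h := Tuple.monotone_sort (fun i => -k i)
  have hs : StrictMono ((fun i => -k i) ∘ Tuple.sort fun i => -k i) :=
    h.strictMono_of_injective ((neg_injective.comp hk).comp (Equiv.injective _))
  intro i j hij
  have := hs hij
  simp only [Function.comp_apply, neg_lt_neg_iff] at this ⊢
  exact this

/-- Every wedge is a multiple of a normally ordered one. -/
theorem span_wedge_le (N : ℕ) [NeZero N] {n : ℕ} {Q : Set (Fin n → ℤ)}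
    (hQ : ∀ k ∈ Q, ∀ w : Equiv.Perm (Fin n), k ∘ w ∈ Q) :
    Submodule.span ℂ (wedge N '' Q) ≤
      Submodule.span ℂ (wedge N '' {k | k ∈ Q ∧ StrictAnti k}) := by
  rw [Submodule.span_le]
  rintro _ ⟨k, hk, rfl⟩
  by_cases hinj : Function.Injective k
  · obtain ⟨w, hw⟩ := exists_perm_strictAnti hinj
    have h := wedge_comp N w k
    have h' : wedge N k = ((Equiv.Perm.sign w : ℤ) : ℂ) • wedge N (k ∘ w) := by
      rw [h, smul_smul, sign_mul_sign_cast, one_smul]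
    rw [h']
    exact Submodule.smul_mem _ _ (Submodule.subset_span ⟨_, ⟨hQ k hk w, hw⟩, rfl⟩)
  · simp only [Function.Injective, not_forall] at hinj
    obtain ⟨i, j, hij, hne⟩ := hinj
    rw [wedge_eq_zero N hne hij]
    exact zero_mem _

/-! ### Subspaces preserved by the operators `T_{ab}(u; β; n)` -/

/-- The ring of endomorphisms preserving a subspace. -/
def stabilizerRing {M : Type*} [AddCommGroup M] [Module ℂ M] (W : Submodule ℂ M) :
    Subring (Module.End ℂ M) where
  carrier := {f | ∀ x ∈ W, f x ∈ W}
  mul_mem' := fun hf hg x hx => hf _ (hg x hx)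
  one_mem' := fun _ hx => hx
  add_mem' := fun hf hg x hx => add_mem (hf x hx) (hg x hx)
  zero_mem' := fun _ _ => zero_mem W
  neg_mem' := fun hf x hx => neg_mem (hf x hx)

theorem coeff_prod_absL_mem {A κ ι : Type*} [Ring A] [Fintype ι] [DecidableEq ι] {D : κ → A}
    {E : ι → ι → κ → A} (𝒮 : Subring A) (hD : ∀ i, D i ∈ 𝒮) (hE : ∀ a b i, E a b i ∈ 𝒮)
    (l : List κ) (a b : ι) (s : ℕ) : coeff s ((l.map (absL D E)).prod a b) ∈ 𝒮 := by
  refine coeff_list_prod_mem_subsemiring 𝒮.toSubsemiring l (fun i _ a b s => ?_) a b s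
  cases s with
  | zero =>
    rw [coeff_zero_absL]
    split_ifs
    · exact one_mem 𝒮
    · exact zero_mem 𝒮
  | succ s =>
    rw [coeff_succ_absL]
    exact mul_mem (pow_mem (neg_mem (hD i)) s) (hE b a i)

/-- The span of the monomials with exponents in `Q`. -/
def monoSpan {n : ℕ} (Q : Set (Fin n → ℤ)) : Submodule ℂ (Laurent n) :=
  Submodule.span ℂ (mono '' Q)

/-- The span of the `u_{k_1} ⊗ ⋯ ⊗ u_{k_n}` with exponents in `Q`. -/
def ambSpan (N : ℕ) {n : ℕ} (Q : Set (Fin n → ℤ)) : Submodule ℂ (Amb N n) :=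
  Submodule.span ℂ {x | ∃ f ∈ monoSpan Q, ∃ y : Spin N n, x = f ⊗ₜ[ℂ] y}

theorem ambSpan_eq (N : ℕ) [NeZero N] {n : ℕ} (Q : Set (Fin n → ℤ)) :
    ambSpan N Q = Submodule.span ℂ (uvec N '' {k | (fun i => bar N (k i)) ∈ Q}) := by
  apply le_antisymm
  · refine Submodule.span_le.mpr ?_
    rintro _ ⟨f, hf, y, rfl⟩
    induction hf using Submodule.span_induction with
    | mem f hf =>
      obtain ⟨t, ht, rfl⟩ := hf
      have hy : y ∈ Submodule.span ℂ (Set.range (spinVec (N := N) (n := n))) := by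
        have := (Basis.piTensorProduct fun _ : Fin n => Pi.basisFun ℂ (Fin N)).mem_span y
        rwa [show ⇑(Basis.piTensorProduct fun _ : Fin n => Pi.basisFun ℂ (Fin N)) =
          spinVec (N := N) (n := n) from
            funext fun η => by simp [Basis.piTensorProduct_apply, spinVec]] at this
      induction hy using Submodule.span_induction with
      | mem y hy =>
        obtain ⟨η, rfl⟩ := hy
        refine Submodule.subset_span ⟨fun i => ((η i : ℕ) + 1 : ℤ) - N * t i, ?_, ?_⟩
        · simpa only [Set.mem_ofPred_eq, bar_eq] using ht
        · simp only [uvec_eq, bar_eq, under_eq]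
      | zero => rw [TensorProduct.tmul_zero]; exact zero_mem _
      | add y z _ _ hy hz => rw [TensorProduct.tmul_add]; exact add_mem hy hz
      | smul c y _ hy => rw [TensorProduct.tmul_smul]; exact Submodule.smul_mem _ _ hy
    | zero => rw [TensorProduct.zero_tmul]; exact zero_mem _
    | add y z _ _ hy hz => rw [TensorProduct.add_tmul]; exact add_mem hy hz
    | smul c y _ hy => rw [← TensorProduct.smul_tmul']; exact Submodule.smul_mem _ _ hy
  · refine Submodule.span_le.mpr ?_
    rintro _ ⟨k, hk, rfl⟩
    exact Submodule.subset_span ⟨_, Submodule.subset_span ⟨_, hk, rfl⟩, _, rfl⟩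

theorem tensorMap_mem_ambSpan {N n : ℕ} {Q : Set (Fin n → ℤ)} {f : Module.End ℂ (Laurent n)}
    (hf : ∀ x ∈ monoSpan Q, f x ∈ monoSpan Q) (g : Module.End ℂ (Spin N n)) :
    ∀ x ∈ ambSpan N Q, TensorProduct.map f g x ∈ ambSpan N Q := by
  intro x hx
  induction hx using Submodule.span_induction with
  | mem x hx =>
    obtain ⟨p, hp, y, rfl⟩ := hx
    rw [TensorProduct.map_tmul]
    exact Submodule.subset_span ⟨_, hf p hp, _, rfl⟩
  | zero => rw [map_zero]; exact zero_mem _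
  | add y z _ _ hy hz => rw [map_add]; exact add_mem hy hz
  | smul c y _ hy => rw [map_smul]; exact Submodule.smul_mem _ _ hy

theorem coeff_tSeries_mem_ambSpan {N n : ℕ} {β : ℂ} {Q : Set (Fin n → ℤ)}
    (hQ : ∀ i, ∀ x ∈ monoSpan Q, dunkl β i x ∈ monoSpan Q) (a b : Fin N) (s : ℕ) {x : Amb N n}
    (hx : x ∈ ambSpan N Q) : coeff s (tSeries N n β a b) x ∈ ambSpan N Q := by
  have h := coeff_prod_absL_mem (D := ambD N β) (E := fun a b k => ambE N a b k)
    (stabilizerRing (ambSpan N Q)) (fun i => tensorMap_mem_ambSpan (hQ i) 1)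
    (fun a b i => tensorMap_mem_ambSpan (fun x hx => hx) _) (List.finRange n) a b s
  rw [coeff_tSeries]
  exact h x hx

/-- A set of exponents closed under moving two exponents towards each other. -/
def ExchangeClosed {n : ℕ} (Q : Set (Fin n → ℤ)) : Prop :=
  ∀ t ∈ Q, ∀ p q : Fin n, p ≠ q → ∀ x y : ℤ, x + y = t p + t q → min (t p) (t q) ≤ x →
    x ≤ max (t p) (t q) → Function.update (Function.update t p x) q y ∈ Q

theorem map_mem_monoSpan {n : ℕ} {Q : Set (Fin n → ℤ)} {f : Module.End ℂ (Laurent n)}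
    (hf : ∀ t ∈ Q, f (mono t) ∈ monoSpan Q) : ∀ x ∈ monoSpan Q, f x ∈ monoSpan Q := by
  intro x hx
  have : Submodule.map f (monoSpan Q) ≤ monoSpan Q := by
    rw [monoSpan, Submodule.map_span_le]
    rintro _ ⟨t, ht, rfl⟩
    exact hf t ht
  exact this (Submodule.mem_map_of_mem hx)

/-- Dividing z_p(K_{pq} - 1)z^t by z_p - z_q leaves only monomials whose exponents at p and q lie
between t_p and t_q and have the same sum. -/
theorem thetaK_mem_monoSpan {n : ℕ} {Q : Set (Fin n → ℤ)} (hQ : ExchangeClosed Q) {p q : Fin n}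
    (hpq : p ≠ q) : ∀ x ∈ monoSpan Q, thetaK p q x ∈ monoSpan Q := by
  refine map_mem_monoSpan fun t ht => ?_
  rw [thetaK_mono]
  refine sub_mem (sum_mem fun l hl => ?_) (sum_mem fun l hl => ?_)
  all_goals
    rw [Finset.mem_range] at hl
    exact Submodule.subset_span ⟨_, hQ t ht p q hpq _ _ (by ring) (by omega) (by omega), rfl⟩

theorem dunkl_mem_monoSpan {n : ℕ} (β : ℂ) {Q : Set (Fin n → ℤ)} (hQ : ExchangeClosed Q)
    (i : Fin n) : ∀ x ∈ monoSpan Q, dunkl β i x ∈ monoSpan Q := by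
  intro x hx
  simp only [dunkl, LinearMap.sub_apply, LinearMap.add_apply, LinearMap.smul_apply,
    LinearMap.sum_apply, LinearMap.id_apply]
  refine sub_mem (add_mem (add_mem (Submodule.smul_mem _ _ ?_) (Submodule.smul_mem _ _ hx))
    (sum_mem fun j hj => ?_)) (sum_mem fun j hj => ?_)
  · refine map_mem_monoSpan (fun t ht => ?_) x hx
    rw [eulerD_mono]
    exact Submodule.smul_mem _ _ (Submodule.subset_span ⟨t, ht, rfl⟩)
  · simp only [Finset.mem_filter, Finset.mem_univ, true_and] at hj
    exact thetaK_mem_monoSpan hQ hj.ne' x hx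
  · simp only [Finset.mem_filter, Finset.mem_univ, true_and] at hj
    exact thetaK_mem_monoSpan hQ hj.ne' x hx

theorem exchangeClosed_le {n : ℕ} (M : ℤ) : ExchangeClosed {t : Fin n → ℤ | ∀ i, t i ≤ M} := by
  intro t ht p q hpq x y hxy h1 h2 i
  have hp := ht p
  have hq := ht q
  simp only [Function.update_apply]
  split_ifs
  · omega
  · omega
  · exact ht i

theorem sum_update_update {n : ℕ} (t : Fin n → ℤ) {p q : Fin n} (hpq : p ≠ q) {x y : ℤ}
    (hxy : x + y = t p + t q) :
    ∑ i, Function.update (Function.update t p x) q y i = ∑ i, t i := by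
  have h1 : q ∈ Finset.univ.erase p := Finset.mem_erase.mpr ⟨hpq.symm, Finset.mem_univ q⟩
  rw [← Finset.add_sum_erase _ _ (Finset.mem_univ p), ← Finset.add_sum_erase _ _ h1,
    ← Finset.add_sum_erase Finset.univ t (Finset.mem_univ p), ← Finset.add_sum_erase _ t h1,
    Function.update_self, Function.update_of_ne hpq, Function.update_self, ← add_assoc,
    ← add_assoc, hxy]
  congr 1
  refine Finset.sum_congr rfl fun i hi => ?_
  simp only [Finset.mem_erase] at hi
  rw [Function.update_of_ne hi.1, Function.update_of_ne hi.2.1]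

theorem exchangeClosed_le_sum {n : ℕ} (M D : ℤ) :
    ExchangeClosed {t : Fin n → ℤ | (∀ i, t i ≤ M) ∧ ∑ i, t i = D} :=
  fun t ht p q hpq x y hxy h1 h2 => ⟨exchangeClosed_le M t ht.1 p q hpq x y hxy h1 h2,
    (sum_update_update t hpq hxy).trans ht.2⟩

/-! ### The invariance of `F⁰_{N,rN}` and of its homogeneous components -/

theorem bar_le_iff {N : ℕ} [NeZero N] (k r : ℤ) : bar N k ≤ r ↔ -(r * N) + 1 ≤ k := by
  have hN : (0 : ℤ) < N := by exact_mod_cast Nat.pos_of_ne_zero (NeZero.ne N)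
  rw [bar, neg_le, Int.le_ediv_iff_mul_le hN]
  constructor <;> intro h <;> linarith

theorem strictAnti_add_le {n : ℕ} {k : Fin n → ℤ} (hk : StrictAnti k) {i j : Fin n} (hij : i ≤ j) :
    k j + (((j : ℕ) : ℤ) - (i : ℕ)) ≤ k i := by
  obtain ⟨i, hi⟩ := i
  obtain ⟨j, hj⟩ := j
  simp only [Fin.mk_le_mk] at hij
  induction j, hij using Nat.le_induction with
  | base => simp
  | succ j hij ih =>
    have h1 := ih (by omega)
    have h2 : k ⟨j + 1, hj⟩ < k ⟨j, by omega⟩ := hk (by simp [Fin.lt_def])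
    simp only at h1 ⊢
    push_cast
    omega

/-- A strictly decreasing integer sequence satisfies all the lower bounds once its last entry does,
and the last bound is k ≥ -rN + 1, that is k̄ ≤ r. Since the length is a multiple of N, this is a
condition on the exponents of z alone, which can be controlled without looking at the spins. -/
theorem seq_iff {N : ℕ} [NeZero N] {r : ℕ} {k : Fin (r * N) → ℤ} (hk : StrictAnti k) :
    (∀ i : Fin (r * N), -((i : ℕ) : ℤ) ≤ k i) ↔ ∀ i, bar N (k i) ≤ r := by
  simp only [bar_le_iff]
  constructor
  · intro h i
    have h1 := h i
    have h2 : ((i : ℕ) : ℤ) + 1 ≤ (r : ℤ) * N := by exact_mod_cast i.2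
    omega
  · intro h i
    have hi := i.2
    have h1 := h ⟨r * N - 1, by omega⟩
    have h2 := strictAnti_add_le hk (i := i) (j := ⟨r * N - 1, by omega⟩)
      (by rw [Fin.le_def]; simp only; omega)
    simp only at h2
    have h3 : (((r * N - 1 : ℕ)) : ℤ) = (r : ℤ) * N - 1 := by
      rw [Nat.cast_sub (by omega)]
      push_cast
      ring
    omega

theorem F0_le_ambSpan (N : ℕ) [NeZero N] (r : ℕ) :
    F0 N (r * N) ≤ ambSpan N {t | ∀ i, t i ≤ (r : ℤ)} := by
  rw [F0, Submodule.span_le, ambSpan_eq]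
  rintro _ ⟨k, rfl⟩
  refine sum_mem fun w _ => Submodule.smul_mem _ _ (Submodule.subset_span ⟨_, ?_, rfl⟩)
  intro i
  exact (seq_iff k.2.1).mp k.2.2 (w i)

theorem tBar_mem_of_coeff_mem {N : ℕ} {β : ℂ} {r : ℕ} {a b : Fin N}
    {W : Submodule ℂ (Amb N (r * N))} {x : Amb N (r * N)}
    (h : ∀ s, coeff s (tSeries N (r * N) β a b) x ∈ W) (s : ℕ) : tBar N β r s a b x ∈ W := by
  rw [tBar_eq_sum, LinearMap.sum_apply]
  exact sum_mem fun p _ => Submodule.smul_mem _ _ (h p.2)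

theorem tBar_mem_stateSpace (N : ℕ) [NeZero N] (β : ℂ) (r s : ℕ) (a b : Fin N)
    {x : Amb N (r * N)} (hx : x ∈ stateSpace N (r * N)) :
    tBar N β r s a b x ∈ stateSpace N (r * N) :=
  tBar_mem_of_coeff_mem (fun s => coeff_tSeries_mem_stateSpace N β a b s hx) s

theorem tBar_mem_ambSpan {N : ℕ} (β : ℂ) (r s : ℕ) (a b : Fin N) {Q : Set (Fin (r * N) → ℤ)}
    (hQ : ExchangeClosed Q) {x : Amb N (r * N)} (hx : x ∈ ambSpan N Q) :
    tBar N β r s a b x ∈ ambSpan N Q :=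
  tBar_mem_of_coeff_mem
    (fun s => coeff_tSeries_mem_ambSpan (dunkl_mem_monoSpan β hQ) a b s hx) s

theorem mem_span_wedge_of_mem_ambSpan (N : ℕ) [NeZero N] {n : ℕ} {Q : Set (Fin n → ℤ)}
    (hQ : ∀ t ∈ Q, ∀ w : Equiv.Perm (Fin n), t ∘ w ∈ Q) {x : Amb N n} (hx : x ∈ stateSpace N n)
    (hx' : x ∈ ambSpan N Q) :
    x ∈ Submodule.span ℂ (wedge N '' {k | (fun i => bar N (k i)) ∈ Q ∧ StrictAnti k}) := by
  rw [ambSpan_eq] at hx'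
  exact span_wedge_le N (Q := {k | (fun i => bar N (k i)) ∈ Q}) (fun k hk w => hQ _ hk w)
    (mem_span_wedge_of_antisymm N (Q := {k | (fun i => bar N (k i)) ∈ Q})
      (permAmb_of_mem_stateSpace N hx) hx')

/-- Wedges with all exponents at most r span F⁰; antisymmetry and the exponent bound are preserved
separately. -/
theorem tBar_mem_F0 (N : ℕ) [NeZero N] (β : ℂ) (r s : ℕ) (a b : Fin N)
    {x : Amb N (r * N)} (hx : x ∈ F0 N (r * N)) : tBar N β r s a b x ∈ F0 N (r * N) := by
  have h1 := tBar_mem_stateSpace N β r s a b (F0_le_stateSpace N _ hx)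
  have h2 := tBar_mem_ambSpan β r s a b (exchangeClosed_le _) (F0_le_ambSpan N r hx)
  have h3 := mem_span_wedge_of_mem_ambSpan N (Q := {t | ∀ i, t i ≤ (r : ℤ)})
    (fun t ht w i => ht (w i)) h1 h2
  refine Submodule.span_mono ?_ h3
  rintro _ ⟨k, ⟨hk, hk'⟩, rfl⟩
  exact ⟨⟨k, hk', (seq_iff hk').mpr hk⟩, rfl⟩

theorem Seq.degree_eq (N : ℕ) {n : ℕ} (k : Seq n) :
    k.degree N = ∑ i : Fin n, bar N (-((i : ℕ) : ℤ)) - ∑ i, bar N (k.1 i) :=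
  Finset.sum_sub_distrib _ _

theorem tBar_mem_F0deg (N : ℕ) [NeZero N] (β : ℂ) (d r s : ℕ) (a b : Fin N)
    {x : F0 N (r * N)} (hx : x ∈ F0deg N (r * N) d)
    (hT : tBar N β r s a b x ∈ F0 N (r * N)) :
    (⟨tBar N β r s a b x, hT⟩ : F0 N (r * N)) ∈ F0deg N (r * N) d := by
  -- Degree d amounts to the total exponent `D`, which exchanges between two exponents do not
  -- change.
  set D : ℤ := ∑ i : Fin (r * N), bar N (-((i : ℕ) : ℤ)) - d with hD
  have hmap : (F0deg N (r * N) d).map (F0 N (r * N)).subtype =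
      Submodule.span ℂ ((fun k : Seq (r * N) => wedge N k.1) '' {k | k.degree N = (d : ℤ)}) := by
    rw [F0deg, Submodule.map_span, ← Set.image_comp]
    congr 2
    funext k
    exact wedgeBasis_apply N _ k
  have hx1 : (x : Amb N (r * N)) ∈ ambSpan N {t | (∀ i, t i ≤ (r : ℤ)) ∧ ∑ i, t i = D} := by
    have h := Submodule.mem_map_of_mem (f := (F0 N (r * N)).subtype) hx
    rw [hmap] at h
    refine Submodule.span_le.mpr ?_ h
    rintro _ ⟨k, hk, rfl⟩
    rw [ambSpan_eq]
    refine sum_mem fun w _ => Submodule.smul_mem _ _ (Submodule.subset_span ⟨_, ⟨?_, ?_⟩, rfl⟩)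
    · intro i
      exact (seq_iff k.2.1).mp k.2.2 (w i)
    · rw [Set.mem_ofPred_eq, Seq.degree_eq] at hk
      have := Equiv.sum_comp w (fun i => bar N (k.1 i))
      simp only [Function.comp_apply]
      omega
  have h1 := tBar_mem_stateSpace N β r s a b (F0_le_stateSpace N _ x.2)
  have h2 := tBar_mem_ambSpan β r s a b (exchangeClosed_le_sum _ _) hx1
  have h3 := mem_span_wedge_of_mem_ambSpan N
    (Q := {t | (∀ i, t i ≤ (r : ℤ)) ∧ ∑ i, t i = D}) (fun t ht w => ⟨fun i => ht.1 (w i), (Equiv.sum_comp w t).trans ht.2⟩) h1 h2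
  have h4 : tBar N β r s a b x ∈ (F0deg N (r * N) d).map (F0 N (r * N)).subtype := by
    rw [hmap]
    refine Submodule.span_mono ?_ h3
    rintro _ ⟨k, ⟨⟨hk, hsum⟩, hk'⟩, rfl⟩
    refine ⟨⟨k, hk', (seq_iff hk').mpr hk⟩, ?_, rfl⟩
    rw [Set.mem_ofPred_eq, Seq.degree_eq]
    dsimp only at hsum ⊢
    omega
  obtain ⟨y, hy, hyx⟩ := h4
  have : (⟨tBar N β r s a b x, hT⟩ : F0 N (r * N)) = y := Subtype.ext hyx.symm
  rw [this]
  exact hy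

end SpinSutherland

end

noncomputable section

namespace SpinSutherland

open PowerSeries

/-! ### Products of `L`-operators with consecutive scalar parameters on antisymmetric vectors -/

/-- Two series of operators that agree on the vector `y`. -/
def AgreeAt {M : Type*} [AddCommGroup M] [Module ℂ M] (y : M)
    (f g : PowerSeries (Module.End ℂ M)) : Prop :=
  ∀ s, coeff s f y = coeff s g y

section

variable {M : Type*} [AddCommGroup M] [Module ℂ M] {y : M}

theorem AgreeAt.mul_left {f g : PowerSeries (Module.End ℂ M)} (h : AgreeAt y f g)
    (k : PowerSeries (Module.End ℂ M)) : AgreeAt y (k * f) (k * g) := by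
  intro s
  simp only [coeff_mul, LinearMap.sum_apply, Module.End.mul_apply, h _]

theorem AgreeAt.add {f g f' g' : PowerSeries (Module.End ℂ M)} (h : AgreeAt y f g)
    (h' : AgreeAt y f' g') : AgreeAt y (f + f') (g + g') := fun s => by
  simp only [map_add, LinearMap.add_apply, h s, h' s]

theorem AgreeAt.sum {ι : Type*} {S : Finset ι} {f g : ι → PowerSeries (Module.End ℂ M)}
    (h : ∀ i ∈ S, AgreeAt y (f i) (g i)) : AgreeAt y (∑ i ∈ S, f i) (∑ i ∈ S, g i) := fun s => by
  simp only [map_sum, LinearMap.sum_apply]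
  exact Finset.sum_congr rfl fun i hi => h i hi s

theorem AgreeAt.of_C {f g : Module.End ℂ M} (h : f y = g y) : AgreeAt y (C f) (C g) := fun s => by
  rw [coeff_C, coeff_C]
  split_ifs
  · exact h
  · rfl

theorem AgreeAt.trans {f g h : PowerSeries (Module.End ℂ M)} (h₁ : AgreeAt y f g)
    (h₂ : AgreeAt y g h) : AgreeAt y f h := fun s => (h₁ s).trans (h₂ s)

/-- Fusion: the hypothesis `hE` says that exchanging two spins acts on y as -1. For parameters
decreasing in steps of one the quadratic terms then telescope, and only the first resolvent and the
sum of the matrix units remain. -/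
theorem prod_absL_agreeAt {κ ι : Type*} [Fintype ι] [DecidableEq ι]
    {D : κ → Module.End ℂ M} {E : ι → ι → κ → Module.End ℂ M}
    (hDE : ∀ i j a b, Commute (D i) (E a b j))
    (hE : ∀ i j, i ≠ j → ∀ a c, (∑ d, E d a i * E c d j) y = -E c a j y)
    (i : κ) (l : List κ) (hl : (i :: l).Nodup)
    (hchain : (i :: l).IsChain fun i j => D i = D j + 1) (a b : ι) :
    AgreeAt y (((i :: l).map (absL D E)).prod a b)
      ((if a = b then 1 else 0) + resolvent (D i) * C (((i :: l).map (E b a)).sum)) := by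
  induction l generalizing i a with
  | nil =>
    intro s
    simp [absL]
  | cons j l ih =>
    rw [List.isChain_cons_cons] at hchain
    rw [List.nodup_cons] at hl
    have ih' := ih j hl.2 hchain.2
    rw [List.map_cons, List.prod_cons, Matrix.mul_apply]
    set S : ι → Module.End ℂ M := fun d => ((j :: l).map (E b d)).sum with hS
    refine (AgreeAt.sum fun d _ => (ih' d).mul_left _).trans ?_
    have h1 : ∑ d, absL D E i a d * ((if d = b then 1 else 0) + resolvent (D j) * C (S d)) =
        (if a = b then 1 else 0) + resolvent (D j) * C (S a) + resolvent (D i) * C (E b a i) +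
          resolvent (D i) * resolvent (D j) * C (∑ d, E d a i * S d) := by
      have h2 : ∀ d, resolvent (D i) * C (E d a i) * (resolvent (D j) * C (S d)) =
          resolvent (D i) * resolvent (D j) * C (E d a i * S d) := by
        intro d
        have := (C_commute_resolvent (hDE j i d a).symm).eq
        rw [mul_assoc, ← mul_assoc (C _), this, map_mul]
        noncomm_ring
      simp only [absL, add_mul, mul_add, Finset.sum_add_distrib, h2]
      rw [← Finset.mul_sum, ← map_sum]
      simp only [ite_mul, mul_ite, one_mul, mul_one, zero_mul, mul_zero, Finset.sum_ite_eq,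
        Finset.sum_ite_eq', Finset.mem_univ, if_true]
      abel
    -- Antisymmetry of y turns the quadratic term into minus the linear one, site by site.
    have h3 : (∑ d, E d a i * S d) y = (-S a) y := by
      have key : ∀ l' : List κ, i ∉ l' →
          (∑ d, E d a i * (l'.map (E b d)).sum) y = (-(l'.map (E b a)).sum) y := by
        intro l' hl'
        induction l' with
        | nil => simp
        | cons k l' ih2 =>
          have hk : i ≠ k := fun e => hl' (by simp [e])
          simp only [List.map_cons, List.sum_cons, mul_add, Finset.sum_add_distrib,
            LinearMap.add_apply, hE i k hk a b, ih2 fun e => hl' (List.mem_cons_of_mem _ e),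
            LinearMap.neg_apply]
          abel
      exact key _ hl.1
    rw [h1]
    refine (AgreeAt.add (fun s => rfl) ((AgreeAt.of_C h3).mul_left _)).trans ?_
    -- As D_i = D_j + 1, the resolvents satisfy h_i = h_j - h_j h_i; this absorbs the quadratic term
    -- and replaces the parameter of the tail by that of the head.
    have h4 : resolvent (D i) = resolvent (D j) - resolvent (D j) * resolvent (D i) := by
      have := resolvent_intertwine (k := 1) (c := 1) (d := D i) (d' := D j)
        (by rw [one_mul, mul_one, hchain.1])
      simpa using this
    have h5 : Commute (resolvent (D i)) (resolvent (D j)) := by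
      refine resolvent_commute ?_
      rw [hchain.1]
      exact (Commute.refl _).add_left (Commute.one_left _)
    have h6 : resolvent (D j) * C (S a) =
        resolvent (D i) * C (S a) + resolvent (D i) * resolvent (D j) * C (S a) := by
      rw [← add_mul, h5.eq]
      congr 1
      exact (sub_eq_iff_eq_add.mp h4.symm)
    intro s
    congr 2
    rw [List.map_cons, List.sum_cons]
    change _ = _ + resolvent (D i) * C (E b a i + S a)
    rw [h6, map_add, map_neg]
    noncomm_ring

end

theorem prod_absL_commute {A κ ι : Type*} [Ring A] [Fintype ι] [DecidableEq ι] {D : κ → A}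
    {E : ι → ι → κ → A} (h : IsEvaluation D E) {l₁ l₂ : List κ}
    (hl : ∀ i ∈ l₁, ∀ j ∈ l₂, i ≠ j) (a b c d : ι) :
    Commute ((l₁.map (absL D E)).prod a b) ((l₂.map (absL D E)).prod c d) := by
  have key : ∀ (l : List κ) (y : A), (∀ i ∈ l, ∀ a b s, Commute y (coeff s (absL D E i a b))) →
      ∀ a b s, Commute y (coeff s ((l.map (absL D E)).prod a b)) := by
    intro l y hy a b s
    have := coeff_list_prod_mem_subsemiring (Subsemiring.centralizer {y}) l (L := absL D E)
      (fun i hi a b s => by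
        simpa [Subsemiring.mem_centralizer_iff] using (hy i hi a b s).eq) a b s
    rw [Subsemiring.mem_centralizer_iff] at this
    exact this y rfl
  refine series_commute fun m n => (key l₁ _ (fun i hi a b s => ?_) a b m).symm
  exact (key l₂ _ (fun j hj c d r => h.coeff_absL_commute (hl i hi j hj) _ _ _ _ _ _) c d n).symm

/-- The pairs of operators intertwined by `R` on a subspace `W` that the first one preserves. -/
def intertwinerRing {M M' : Type*} [AddCommGroup M] [Module ℂ M] [AddCommGroup M'] [Module ℂ M']
    (W : Submodule ℂ M) (R : M →ₗ[ℂ] M') : Subring (Module.End ℂ M × Module.End ℂ M') where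
  carrier := {p | ∀ x ∈ W, p.1 x ∈ W ∧ R (p.1 x) = p.2 (R x)}
  mul_mem' {p q} hp hq x hx := by
    refine ⟨(hp _ (hq x hx).1).1, ?_⟩
    change R (p.1 (q.1 x)) = p.2 (q.2 (R x))
    rw [(hp _ (hq x hx).1).2, (hq x hx).2]
  one_mem' x hx := ⟨hx, rfl⟩
  add_mem' {p q} hp hq x hx := by
    refine ⟨add_mem (hp x hx).1 (hq x hx).1, ?_⟩
    change R (p.1 x + q.1 x) = p.2 (R x) + q.2 (R x)
    rw [map_add, (hp x hx).2, (hq x hx).2]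
  zero_mem' x _ := ⟨zero_mem W, map_zero R⟩
  neg_mem' {p} hp x hx := by
    refine ⟨neg_mem (hp x hx).1, ?_⟩
    change R (-p.1 x) = -p.2 (R x)
    rw [map_neg, (hp x hx).2]

/-- Intertwined pairs form a ring, so it is enough to treat the operators D and E. -/
theorem prod_absL_intertwine {M M' κ κ' ι : Type*} [AddCommGroup M] [Module ℂ M]
    [AddCommGroup M'] [Module ℂ M'] [Fintype ι] [DecidableEq ι] {D : κ → Module.End ℂ M}
    {E : ι → ι → κ → Module.End ℂ M} {D' : κ' → Module.End ℂ M'}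
    {E' : ι → ι → κ' → Module.End ℂ M'} {W : Submodule ℂ M} {R : M →ₗ[ℂ] M'} (e : κ' → κ)
    (hD : ∀ i, (D (e i), D' i) ∈ intertwinerRing W R)
    (hE : ∀ a b i, (E a b (e i), E' a b i) ∈ intertwinerRing W R) (l : List κ') (a b : ι) (s : ℕ)
    {x : M} (hx : x ∈ W) :
    coeff s (((l.map e).map (absL D E)).prod a b) x ∈ W ∧
      R (coeff s (((l.map e).map (absL D E)).prod a b) x) =
        coeff s ((l.map (absL D' E')).prod a b) (R x) := by
  have h := coeff_list_prod_mem (L := fun i => absL D E (e i)) (L' := absL D' E')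
    (intertwinerRing W R).toSubsemiring l (fun i _ a b s => ?_) a b s
  · rw [List.map_map]
    exact h x hx
  · cases s with
    | zero =>
      rw [coeff_zero_absL, coeff_zero_absL]
      split_ifs
      · exact one_mem (intertwinerRing W R)
      · exact zero_mem (intertwinerRing W R)
    | succ s =>
      rw [coeff_succ_absL, coeff_succ_absL]
      exact mul_mem (pow_mem (neg_mem (hD i)) s) (hE b a i)

/-! ### Extraction of the leading part in the first variables -/

/-- The linear map on Laurent polynomials with prescribed values on the monomials. -/
def monoLift {n : ℕ} {M : Type*} [AddCommMonoid M] [Module ℂ M] (g : (Fin n → ℤ) → M) :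
    Laurent n →ₗ[ℂ] M :=
  (AddMonoidAlgebra.basis (Fin n → ℤ) ℂ).constr ℂ g

theorem monoLift_mono {n : ℕ} {M : Type*} [AddCommMonoid M] [Module ℂ M] (g : (Fin n → ℤ) → M)
    (t : Fin n → ℤ) : monoLift g (mono t) = g t := by
  have h : mono t = AddMonoidAlgebra.basis (Fin n → ℤ) ℂ t := by simp [mono]
  rw [h, monoLift, Module.Basis.constr_basis]

/-- The coefficient of `z_1^M ⋯ z_m^M`, as a Laurent polynomial in the other variables. -/
def topCoeff (m n : ℕ) (M : ℤ) : Laurent (m + n) →ₗ[ℂ] Laurent n :=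
  open Classical in
  monoLift fun t => if ∀ i : Fin m, t (Fin.castAdd n i) = M then mono (t ∘ Fin.natAdd m) else 0

open Classical in
theorem topCoeff_mono (m n : ℕ) (M : ℤ) (t : Fin (m + n) → ℤ) :
    topCoeff m n M (mono t) =
      if ∀ i : Fin m, t (Fin.castAdd n i) = M then mono (t ∘ Fin.natAdd m) else 0 :=
  monoLift_mono _ _

theorem topCoeff_mono_of_ne {m n : ℕ} {M : ℤ} {t : Fin (m + n) → ℤ} {i : Fin m}
    (h : t (Fin.castAdd n i) ≠ M) : topCoeff m n M (mono t) = 0 := by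
  classical
  rw [topCoeff_mono, if_neg fun e => h (e i)]

theorem monoSpan_eqOn {n : ℕ} {V : Type*} [AddCommMonoid V] [Module ℂ V] {Q : Set (Fin n → ℤ)}
    {f g : Laurent n →ₗ[ℂ] V} (h : ∀ t ∈ Q, f (mono t) = g (mono t)) {x : Laurent n}
    (hx : x ∈ monoSpan Q) : f x = g x := by
  induction hx using Submodule.span_induction with
  | mem x hx => obtain ⟨t, ht, rfl⟩ := hx; exact h t ht
  | zero => simp
  | add x y _ _ hx hy => rw [map_add, map_add, hx, hy]
  | smul c x _ hx => rw [map_smul, map_smul, hx]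

/-- The monomials with exponents at most `M`. -/
abbrev expLe (n : ℕ) (M : ℤ) : Set (Fin n → ℤ) := {t | ∀ i, t i ≤ M}

/-- In the result of θ_{pq}(K_{pq} - 1) the exponent at the second index q is strictly below
max(t_p, t_q) ≤ M, so the coefficient of z_q^M vanishes. -/
theorem topCoeff_thetaK_castAdd {m n : ℕ} {M : ℤ} {p : Fin (m + n)} {j : Fin m}
    {f : Laurent (m + n)} (hf : f ∈ monoSpan (expLe (m + n) M)) :
    topCoeff m n M (thetaK p (Fin.castAdd n j) f) = 0 := by
  refine monoSpan_eqOn (f := topCoeff m n M ∘ₗ thetaK p (Fin.castAdd n j)) (g := 0)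
    (fun t ht => ?_) hf
  have h1 := ht p
  have h2 := ht (Fin.castAdd n j)
  rw [LinearMap.comp_apply, thetaK_mono, map_sub, map_sum, map_sum,
    Finset.sum_eq_zero, Finset.sum_eq_zero, sub_zero, LinearMap.zero_apply]
  all_goals
    intro l hl
    rw [Finset.mem_range] at hl
    refine topCoeff_mono_of_ne (i := j) ?_
    rw [Function.update_self]
    omega

theorem topCoeff_mono₂_natAdd {m n : ℕ} (M : ℤ) (a b : Fin n) (t : Fin (m + n) → ℤ) (x y : ℤ)
    (h : ∀ i : Fin m, t (Fin.castAdd n i) = M) :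
    topCoeff m n M (mono₂ t (Fin.natAdd m a) (Fin.natAdd m b) x y) =
      mono₂ (t ∘ Fin.natAdd m) a b x y := by
  classical
  have hne : ∀ (i : Fin m) (a : Fin n), Fin.castAdd n i ≠ Fin.natAdd m a := fun i a e => by
    have := congrArg Fin.val e
    simp at this
    omega
  rw [mono₂, topCoeff_mono, if_pos, mono₂]
  · rw [Function.update_comp_eq_of_injective _ (Fin.natAdd_injective n m),
      Function.update_comp_eq_of_injective _ (Fin.natAdd_injective n m)]
  · intro i
    rw [Function.update_of_ne (hne i b), Function.update_of_ne (hne i a), h i]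

theorem topCoeff_thetaK_natAdd {m n : ℕ} (M : ℤ) (a b : Fin n) (f : Laurent (m + n)) :
    topCoeff m n M (thetaK (Fin.natAdd m a) (Fin.natAdd m b) f) =
      thetaK a b (topCoeff m n M f) := by
  classical
  refine LinearMap.congr_fun (f := topCoeff m n M ∘ₗ thetaK (Fin.natAdd m a) (Fin.natAdd m b))
    (g := thetaK a b ∘ₗ topCoeff m n M) (laurent_hom_ext fun t => ?_) f
  rw [LinearMap.comp_apply, LinearMap.comp_apply, thetaK_mono, map_sub, map_sum, map_sum]
  by_cases h : ∀ i : Fin m, t (Fin.castAdd n i) = M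
  · simp only [topCoeff_mono₂_natAdd M a b t _ _ h]
    rw [topCoeff_mono, if_pos h, thetaK_mono]
    rfl
  · have hne : ∀ (i : Fin m) (a : Fin n), Fin.castAdd n i ≠ Fin.natAdd m a := fun i a e => by
      have := congrArg Fin.val e
      simp at this
      omega
    rw [topCoeff_mono, if_neg h, map_zero, Finset.sum_eq_zero, Finset.sum_eq_zero, sub_zero]
    all_goals
      intro l _
      rw [mono₂, topCoeff_mono, if_neg]
      intro h'
      refine h fun i => ?_
      have := h' i
      rwa [Function.update_of_ne (hne i b), Function.update_of_ne (hne i a)] at this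

theorem topCoeff_eulerD_castAdd {m n : ℕ} (M : ℤ) (i : Fin m) (f : Laurent (m + n)) :
    topCoeff m n M (eulerD (Fin.castAdd n i) f) = (M : ℂ) • topCoeff m n M f := by
  classical
  refine LinearMap.congr_fun (f := topCoeff m n M ∘ₗ eulerD (Fin.castAdd n i))
    (g := (M : ℂ) • topCoeff m n M) (laurent_hom_ext fun t => ?_) f
  rw [LinearMap.comp_apply, LinearMap.smul_apply, eulerD_mono, map_smul, topCoeff_mono]
  split_ifs with h
  · rw [h i]
  · rw [smul_zero, smul_zero]

theorem topCoeff_eulerD_natAdd {m n : ℕ} (M : ℤ) (i : Fin n) (f : Laurent (m + n)) :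
    topCoeff m n M (eulerD (Fin.natAdd m i) f) = eulerD i (topCoeff m n M f) := by
  classical
  refine LinearMap.congr_fun (f := topCoeff m n M ∘ₗ eulerD (Fin.natAdd m i))
    (g := eulerD i ∘ₗ topCoeff m n M) (laurent_hom_ext fun t => ?_) f
  rw [LinearMap.comp_apply, LinearMap.comp_apply, eulerD_mono, map_smul, topCoeff_mono]
  split_ifs with h
  · rw [eulerD_mono]
    rfl
  · rw [smul_zero, map_zero]

theorem topCoeff_permK_castAdd {m n : ℕ} (M : ℤ) (i j : Fin m) (f : Laurent (m + n)) :
    topCoeff m n M (permK (Fin.castAdd n i) (Fin.castAdd n j) f) = topCoeff m n M f := by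
  classical
  refine LinearMap.congr_fun (f := topCoeff m n M ∘ₗ permK (Fin.castAdd n i) (Fin.castAdd n j))
    (g := topCoeff m n M) (laurent_hom_ext fun t => ?_) f
  have hc : ∀ k : Fin m, Equiv.swap (Fin.castAdd n i) (Fin.castAdd n j) (Fin.castAdd n k) =
      Fin.castAdd n (Equiv.swap i j k) := fun k =>
    (Fin.castAdd_injective m n).swap_apply i j k
  have hn : ∀ k : Fin n, Equiv.swap (Fin.castAdd n i) (Fin.castAdd n j) (Fin.natAdd m k) =
      Fin.natAdd m k := fun k => by
    refine Equiv.swap_apply_of_ne_of_ne ?_ ?_ <;>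
    · intro e
      have := congrArg Fin.val e
      simp at this
      omega
  rw [LinearMap.comp_apply, permK_mono, topCoeff_mono, topCoeff_mono]
  have e1 : (∀ k : Fin m, (t ∘ Equiv.swap (Fin.castAdd n i) (Fin.castAdd n j)) (Fin.castAdd n k) =
      M) ↔ ∀ k : Fin m, t (Fin.castAdd n k) = M := by
    simp only [Function.comp_apply, hc]
    exact (Equiv.swap i j).forall_congr_right (q := fun k => t (Fin.castAdd n k) = M)
  have e2 : (t ∘ Equiv.swap (Fin.castAdd n i) (Fin.castAdd n j)) ∘ Fin.natAdd m =
      t ∘ Fin.natAdd m := by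
    funext k
    simp only [Function.comp_apply, hn]
  simp only [e1, e2]

/-- In d_i with i in the first block every divided difference has a first-block variable as its
second index: either i itself or some j < i. All of them drop out and only the scalar part is left.
-/
theorem topCoeff_dunkl_castAdd {m n : ℕ} (β : ℂ) (M : ℤ) (i : Fin m) {f : Laurent (m + n)}
    (hf : f ∈ monoSpan (expLe (m + n) M)) :
    topCoeff m n M (dunkl β (Fin.castAdd n i) f) =
      (β⁻¹ * M + ((m + n : ℕ) : ℂ) - ((i : ℕ) + 1)) • topCoeff m n M f := by
  simp only [dunkl, LinearMap.sub_apply, LinearMap.add_apply, LinearMap.smul_apply,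
    LinearMap.sum_apply, LinearMap.id_apply, map_sub, map_add, map_sum, map_smul]
  rw [topCoeff_eulerD_castAdd, Finset.sum_eq_zero, Finset.sum_eq_zero, add_zero, sub_zero,
    smul_smul, ← add_smul, Fin.val_castAdd, add_sub_assoc]
  · intro j hj
    simp only [Finset.mem_filter, Finset.mem_univ, true_and, Fin.lt_def, Fin.val_castAdd] at hj
    have hj' : j = Fin.castAdd n ⟨j, by have := i.2; omega⟩ := rfl
    rw [hj']
    exact topCoeff_thetaK_castAdd hf
  · intro j _
    exact topCoeff_thetaK_castAdd hf

/-- The divided differences linking i to the first block drop out, and the others commute with the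
extraction. The shift in position by m compensates the m additional variables in the constant n - i.
-/
theorem topCoeff_dunkl_natAdd {m n : ℕ} (β : ℂ) (M : ℤ) (i : Fin n) {f : Laurent (m + n)}
    (hf : f ∈ monoSpan (expLe (m + n) M)) :
    topCoeff m n M (dunkl β (Fin.natAdd m i) f) = dunkl β i (topCoeff m n M f) := by
  simp only [dunkl, LinearMap.sub_apply, LinearMap.add_apply, LinearMap.smul_apply,
    LinearMap.sum_apply, LinearMap.id_apply, map_sub, map_add, map_sum, map_smul,
    Finset.sum_filter, Fin.sum_univ_add]
  have h1 : ∀ j : Fin m, ¬ Fin.natAdd m i < Fin.castAdd n j := fun j => by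
    simp only [Fin.lt_def, Fin.val_natAdd, Fin.val_castAdd]
    omega
  have h2 : ∀ j : Fin m, Fin.castAdd n j < Fin.natAdd m i := fun j => by
    simp only [Fin.lt_def, Fin.val_natAdd, Fin.val_castAdd]
    omega
  simp only [h1, h2, if_true, if_false, topCoeff_thetaK_castAdd hf, topCoeff_eulerD_natAdd,
    Finset.sum_const_zero, zero_add, Fin.natAdd_lt_natAdd_iff,
    Fin.val_natAdd]
  have h3 : ∀ (P : Prop) [Decidable P] (a b : Fin n),
      topCoeff m n M ((if P then thetaK (Fin.natAdd m a) (Fin.natAdd m b) else 0) f) =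
        (if P then thetaK a b else 0) (topCoeff m n M f) := fun P _ a b => by
    split_ifs
    · exact topCoeff_thetaK_natAdd M a b f
    · exact map_zero _
  simp only [h3, LinearMap.zero_apply, map_zero, Finset.sum_const_zero, zero_add]
  congr 4
  push_cast
  ring

end SpinSutherland

end

noncomputable section

namespace SpinSutherland

open PowerSeries

/-! ### Extraction of the leading part of a tensor -/

/-- The coefficient of `v_{τ 1} ⊗ ⋯ ⊗ v_{τ m}` in the first `m` factors. -/
def topSpin {N m : ℕ} (n : ℕ) (τ : Fin m → Fin N) : Spin N (m + n) →ₗ[ℂ] Spin N n :=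
  onSpin fun η => if (∀ i : Fin m, η (Fin.castAdd n i) = τ i) then spinVec (η ∘ Fin.natAdd m) else 0

theorem topSpin_spinVec {N m n : ℕ} (τ : Fin m → Fin N) (η : Fin (m + n) → Fin N) :
    topSpin n τ (spinVec η) =
      if (∀ i : Fin m, η (Fin.castAdd n i) = τ i) then spinVec (η ∘ Fin.natAdd m) else 0 :=
  onSpin_spinVec _ _

theorem castAdd_ne_natAdd {m n : ℕ} (i : Fin m) (j : Fin n) : Fin.castAdd n i ≠ Fin.natAdd m j :=
  fun e => by
    have := congrArg Fin.val e
    simp at this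
    omega

theorem topSpin_unitAt_natAdd {N m n : ℕ} (τ : Fin m → Fin N) (a b : Fin N) (i : Fin n)
    (x : Spin N (m + n)) :
    topSpin n τ (unitAt N a b (Fin.natAdd m i) x) = unitAt N a b i (topSpin n τ x) := by
  refine LinearMap.congr_fun (f := topSpin n τ ∘ₗ unitAt N a b (Fin.natAdd m i))
    (g := unitAt N a b i ∘ₗ topSpin n τ) (spin_hom_ext fun η => ?_) x
  rw [LinearMap.comp_apply, LinearMap.comp_apply, unitAt_spinVec, topSpin_spinVec]
  by_cases h1 : η (Fin.natAdd m i) = b <;> by_cases h2 : ∀ i : Fin m, η (Fin.castAdd n i) = τ i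
  · rw [if_pos h1, if_pos h2, topSpin_spinVec, if_pos, unitAt_spinVec, Function.comp_apply,
      if_pos h1, Function.update_comp_eq_of_injective _ (Fin.natAdd_injective n m)]
    intro j
    rw [Function.update_of_ne (castAdd_ne_natAdd j i), h2]
  · rw [if_pos h1, if_neg h2, topSpin_spinVec, if_neg, map_zero]
    refine fun h => h2 fun j => ?_
    rw [← h j, Function.update_of_ne (castAdd_ne_natAdd j i)]
  · rw [if_neg h1, if_pos h2, unitAt_spinVec, Function.comp_apply, if_neg h1, map_zero]
  · rw [if_neg h1, if_neg h2, map_zero, map_zero]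

theorem topSpin_unitAt_castAdd {N m n : ℕ} (τ : Fin m → Fin N) (a c : Fin N) (i : Fin m)
    (x : Spin N (m + n)) :
    topSpin n τ (unitAt N c a (Fin.castAdd n i) x) =
      if τ i = c then topSpin n (Function.update τ i a) x else 0 := by
  refine (LinearMap.congr_fun (f := topSpin n τ ∘ₗ unitAt N c a (Fin.castAdd n i))
    (g := if τ i = c then topSpin n (Function.update τ i a) else 0)
    (spin_hom_ext fun η => ?_) x).trans (by split_ifs <;> rfl)
  have hinj := Fin.castAdd_injective m n
  have key : (∀ j : Fin m, η (Fin.castAdd n j) = Function.update τ i a j) ↔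
      η (Fin.castAdd n i) = a ∧ ∀ j : Fin m, j ≠ i → η (Fin.castAdd n j) = τ j := by
    constructor
    · intro h
      refine ⟨by simpa using h i, fun j hj => by simpa [hj] using h j⟩
    · rintro ⟨h1, h2⟩ j
      by_cases hj : j = i
      · subst hj; simpa using h1
      · simpa [hj] using h2 j hj
  have key2 : (∀ j : Fin m, Function.update η (Fin.castAdd n i) c (Fin.castAdd n j) = τ j) ↔
      τ i = c ∧ ∀ j : Fin m, j ≠ i → η (Fin.castAdd n j) = τ j := by
    constructor
    · intro h
      refine ⟨by simpa [eq_comm] using h i, fun j hj => ?_⟩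
      rw [← h j, Function.update_of_ne fun e => hj (hinj e)]
    · rintro ⟨h1, h2⟩ j
      by_cases hj : j = i
      · subst hj; simpa using h1.symm
      · rw [Function.update_of_ne fun e => hj (hinj e), h2 j hj]
  have hcomp : Function.update η (Fin.castAdd n i) c ∘ Fin.natAdd m = η ∘ Fin.natAdd m := by
    funext j
    rw [Function.comp_apply, Function.update_of_ne (castAdd_ne_natAdd i j).symm]
    rfl
  rw [LinearMap.comp_apply, unitAt_spinVec]
  by_cases h1 : η (Fin.castAdd n i) = a <;> by_cases h2 : τ i = c <;>
    simp only [h1, h2, if_true, if_false, topSpin_spinVec, key, key2, hcomp, true_and, false_and,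
      map_zero, LinearMap.zero_apply]

theorem topSpin_flip {N m n : ℕ} {τ : Fin m → Fin N} {i j : Fin m} (h : τ i = τ j)
    (x : Spin N (m + n)) :
    topSpin n τ (flip N (Fin.castAdd n i) (Fin.castAdd n j) x) = topSpin n τ x := by
  refine LinearMap.congr_fun (f := topSpin n τ ∘ₗ flip N (Fin.castAdd n i) (Fin.castAdd n j))
    (g := topSpin n τ) (spin_hom_ext fun η => ?_) x
  have hc : ∀ k : Fin m, Equiv.swap (Fin.castAdd n i) (Fin.castAdd n j) (Fin.castAdd n k) =
      Fin.castAdd n (Equiv.swap i j k) := fun k =>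
    (Fin.castAdd_injective m n).swap_apply i j k
  have hτ : ∀ k, τ (Equiv.swap i j k) = τ k := fun k => by
    rw [Equiv.swap_apply_def]
    split_ifs with h1 h2
    · rw [h1, h]
    · rw [h2, h]
    · rfl
  have e1 : (∀ k : Fin m, (η ∘ Equiv.swap (Fin.castAdd n i) (Fin.castAdd n j)) (Fin.castAdd n k) =
      τ k) ↔ ∀ k : Fin m, η (Fin.castAdd n k) = τ k := by
    simp only [Function.comp_apply, hc]
    rw [← (Equiv.swap i j).forall_congr_right (q := fun k => η (Fin.castAdd n k) = τ k)]
    simp only [hτ]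
  have e2 : (η ∘ Equiv.swap (Fin.castAdd n i) (Fin.castAdd n j)) ∘ Fin.natAdd m =
      η ∘ Fin.natAdd m := by
    funext k
    simp only [Function.comp_apply]
    rw [Equiv.swap_apply_of_ne_of_ne (castAdd_ne_natAdd i k).symm (castAdd_ne_natAdd j k).symm]
  rw [LinearMap.comp_apply, flip_spinVec, topSpin_spinVec, topSpin_spinVec]
  simp only [e1, e2]

/-- The leading polynomial part of a tensor in the first `m` variables. -/
def topPoly (N m n : ℕ) (M : ℤ) : Amb N (m + n) →ₗ[ℂ] Laurent n ⊗[ℂ] Spin N (m + n) :=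
  TensorProduct.map (topCoeff m n M) LinearMap.id

/-- The leading part of a tensor in the first `m` variables and factors. -/
def topPart {N m : ℕ} (n : ℕ) (M : ℤ) (τ : Fin m → Fin N) : Amb N (m + n) →ₗ[ℂ] Amb N n :=
  TensorProduct.map LinearMap.id (topSpin n τ) ∘ₗ topPoly N m n M

theorem topPart_tmul {N m n : ℕ} (M : ℤ) (τ : Fin m → Fin N) (f : Laurent (m + n))
    (y : Spin N (m + n)) :
    topPart n M τ (f ⊗ₜ[ℂ] y) = topCoeff m n M f ⊗ₜ[ℂ] topSpin n τ y := rfl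

theorem ambSpan_induction {N n : ℕ} {Q : Set (Fin n → ℤ)} {V : Type*} [AddCommGroup V] [Module ℂ V]
    {f g : Amb N n →ₗ[ℂ] V} (h : ∀ p ∈ monoSpan Q, ∀ y, f (p ⊗ₜ[ℂ] y) = g (p ⊗ₜ[ℂ] y))
    {x : Amb N n} (hx : x ∈ ambSpan N Q) : f x = g x := by
  induction hx using Submodule.span_induction with
  | mem x hx => obtain ⟨p, hp, y, rfl⟩ := hx; exact h p hp y
  | zero => rw [map_zero, map_zero]
  | add x y _ _ hx hy => rw [map_add, map_add, hx, hy]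
  | smul c x _ hx => rw [map_smul, map_smul, hx]

theorem tensorMap_mem_intertwinerRing {N n : ℕ} {Q : Set (Fin n → ℤ)} {M' : Type*}
    [AddCommGroup M'] [Module ℂ M'] {R : Amb N n →ₗ[ℂ] M'} {f : Module.End ℂ (Laurent n)}
    {g : Module.End ℂ (Spin N n)} {h : Module.End ℂ M'}
    (hf : ∀ x ∈ monoSpan Q, f x ∈ monoSpan Q)
    (hR : ∀ p ∈ monoSpan Q, ∀ y, R (f p ⊗ₜ[ℂ] g y) = h (R (p ⊗ₜ[ℂ] y))) :
    (TensorProduct.map f g, h) ∈ intertwinerRing (ambSpan N Q) R := by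
  intro x hx
  refine ⟨tensorMap_mem_ambSpan hf g x hx, ?_⟩
  exact ambSpan_induction (f := R ∘ₗ TensorProduct.map f g) (g := h ∘ₗ R) hR hx

theorem eq_zero_of_eq_neg {V : Type*} [AddCommGroup V] [Module ℂ V] {x : V} (h : x = -x) :
    x = 0 := by
  have : (2 : ℂ) • x = 0 := by
    rw [two_smul]
    nth_rewrite 2 [h]
    exact add_neg_cancel x
  exact (smul_eq_zero.mp this).resolve_left two_ne_zero

theorem coeff_resolvent_smul_one {A : Type*} [Ring A] [Algebra ℂ A] (c : ℂ) (s : ℕ) :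
    coeff s (resolvent (c • (1 : A))) = coeff s (resolvent c) • 1 := by
  cases s with
  | zero => simp [resolvent]
  | succ s =>
    rw [resolvent, resolvent, coeff_succ_X_mul, coeff_succ_X_mul, coeff_mk, coeff_mk,
      ← neg_smul, smul_pow, one_pow]

section

variable {N m n : ℕ} (β : ℂ) (M : ℤ)

theorem ambD_natAdd_mem (τ : Fin m → Fin N) (i : Fin n) :
    (ambD N β (Fin.natAdd m i), ambD N β i) ∈
      intertwinerRing (ambSpan N (expLe (m + n) M)) (topPart n M τ) :=
  tensorMap_mem_intertwinerRing (dunkl_mem_monoSpan β (exchangeClosed_le M) _) fun p hp y => by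
    rw [topPart_tmul, topPart_tmul, topCoeff_dunkl_natAdd β M i hp]
    rfl

theorem ambE_natAdd_mem (τ : Fin m → Fin N) (a b : Fin N) (i : Fin n) :
    (ambE N a b (Fin.natAdd m i), ambE N a b i) ∈
      intertwinerRing (ambSpan N (expLe (m + n) M)) (topPart n M τ) :=
  tensorMap_mem_intertwinerRing (fun _ hx => hx) fun p _ y => by
    rw [topPart_tmul, topPart_tmul, topSpin_unitAt_natAdd]
    rfl

/-- The eigenvalue of the Cherednik-Dunkl operator on the leading part. -/
def topEigen (m n : ℕ) (β : ℂ) (M : ℤ) (i : Fin m) : ℂ :=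
  β⁻¹ * M + ((m + n : ℕ) : ℂ) - ((i : ℕ) + 1)

theorem ambD_castAdd_mem (i : Fin m) :
    (ambD N β (Fin.castAdd n i), topEigen m n β M i • 1) ∈
      intertwinerRing (ambSpan N (expLe (m + n) M)) (topPoly N m n M) :=
  tensorMap_mem_intertwinerRing (dunkl_mem_monoSpan β (exchangeClosed_le M) _) fun p hp y => by
    change topCoeff m n M _ ⊗ₜ[ℂ] y = topEigen m n β M i • (topCoeff m n M p ⊗ₜ[ℂ] y)
    rw [topCoeff_dunkl_castAdd β M i hp, TensorProduct.smul_tmul']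
    rfl

theorem ambE_castAdd_mem (a b : Fin N) (i : Fin m) :
    (ambE N a b (Fin.castAdd n i), TensorProduct.map 1 (unitAt N a b (Fin.castAdd n i))) ∈
      intertwinerRing (ambSpan N (expLe (m + n) M)) (topPoly N m n M) :=
  tensorMap_mem_intertwinerRing (fun _ hx => hx) fun _ _ _ => rfl

theorem flip_topPoly [NeZero N] {i j : Fin m} (hij : i ≠ j) {x : Amb N (m + n)}
    (hx : x ∈ stateSpace N (m + n)) :
    TensorProduct.map LinearMap.id (flip N (Fin.castAdd n i) (Fin.castAdd n j)) (topPoly N m n M x) =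
      -topPoly N m n M x := by
  have h := congrArg (topPoly N m n M)
    (swap_of_mem_stateSpace N hx (fun e => hij (Fin.castAdd_injective m n e)))
  rw [map_neg] at h
  refine Eq.trans ?_ h
  refine LinearMap.congr_fun (f := TensorProduct.map LinearMap.id
    (flip N (Fin.castAdd n i) (Fin.castAdd n j)) ∘ₗ topPoly N m n M)
    (g := topPoly N m n M ∘ₗ ambK N (Fin.castAdd n i) (Fin.castAdd n j) ∘ₗ
      ambP N (Fin.castAdd n i) (Fin.castAdd n j)) (TensorProduct.ext' fun p y => ?_) x
  change topCoeff m n M p ⊗ₜ[ℂ] _ = topCoeff m n M (permK _ _ p) ⊗ₜ[ℂ] _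
  rw [topCoeff_permK_castAdd]
  rfl

/-- The leading polynomial part is symmetric under exchange of the first variables, so antisymmetry
falls on the spins; a component with two equal spins equals its negative. -/
theorem topSpin_of_not_injective [NeZero N] {η : Fin m → Fin N} {i j : Fin m} (hij : i ≠ j)
    (h : η i = η j) {x : Amb N (m + n)} (hx : x ∈ stateSpace N (m + n)) :
    topPart n M η x = 0 := by
  have h1 := congrArg (TensorProduct.map LinearMap.id (topSpin n η)) (flip_topPoly M hij hx)
  rw [map_neg] at h1
  have h2 : TensorProduct.map LinearMap.id (topSpin n η)
      (TensorProduct.map LinearMap.id (flip N (Fin.castAdd n i) (Fin.castAdd n j))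
        (topPoly N m n M x)) = topPart n M η x := by
    refine LinearMap.congr_fun (f := TensorProduct.map LinearMap.id (topSpin n η) ∘ₗ
      TensorProduct.map LinearMap.id (flip N (Fin.castAdd n i) (Fin.castAdd n j)))
      (g := TensorProduct.map LinearMap.id (topSpin n η)) (TensorProduct.ext' fun p y => ?_)
      (topPoly N m n M x)
    change p ⊗ₜ[ℂ] _ = p ⊗ₜ[ℂ] _
    rw [topSpin_flip h]
  rw [h2] at h1
  exact eq_zero_of_eq_neg h1

/-- This supplies the antisymmetry hypothesis of `prod_absL_agreeAt` for the leading part. -/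
theorem unitAt_topPoly [NeZero N] {i j : Fin m} (hij : i ≠ j) (a c : Fin N) {x : Amb N (m + n)}
    (hx : x ∈ stateSpace N (m + n)) :
    (∑ d, (TensorProduct.map 1 (unitAt N d a (Fin.castAdd n i)) *
        TensorProduct.map 1 (unitAt N c d (Fin.castAdd n j)) :
        Module.End ℂ (Laurent n ⊗[ℂ] Spin N (m + n)))) (topPoly N m n M x) =
      -(TensorProduct.map 1 (unitAt N c a (Fin.castAdd n j)) :
        Module.End ℂ (Laurent n ⊗[ℂ] Spin N (m + n))) (topPoly N m n M x) := by
  have hij' : Fin.castAdd n i ≠ Fin.castAdd n j := fun e => hij (Fin.castAdd_injective m n e)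
  rw [← map_neg, ← flip_topPoly M hij hx]
  refine LinearMap.congr_fun (f := ∑ d, (TensorProduct.map 1 (unitAt N d a (Fin.castAdd n i)) *
    TensorProduct.map 1 (unitAt N c d (Fin.castAdd n j)) :
        Module.End ℂ (Laurent n ⊗[ℂ] Spin N (m + n))))
    (g := TensorProduct.map 1 (unitAt N c a (Fin.castAdd n j)) ∘ₗ
      TensorProduct.map LinearMap.id (flip N (Fin.castAdd n i) (Fin.castAdd n j)))
    (TensorProduct.ext' fun p y => ?_) (topPoly N m n M x)
  have h := LinearMap.congr_fun (sum_unitAt_mul_unitAt a c hij') y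
  have h2 := flip_mul_unitAt c a (Fin.castAdd n i) (Fin.castAdd n j) (Fin.castAdd n i)
  rw [Equiv.swap_apply_left] at h2
  rw [h2, LinearMap.sum_apply] at h
  rw [LinearMap.sum_apply]
  change ∑ d, p ⊗ₜ[ℂ] (unitAt N d a (Fin.castAdd n i) * unitAt N c d (Fin.castAdd n j)) y =
    p ⊗ₜ[ℂ] (unitAt N c a (Fin.castAdd n j) * flip N (Fin.castAdd n i) (Fin.castAdd n j)) y
  rw [← TensorProduct.tmul_sum, h]

/-- The bijection τ makes the first block carry each basis vector of ℂ^N once, so its spins lie in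
the top exterior power. There the diagonal generators of gl_N act by 1, and the off-diagonal ones by
0 because they produce a repeated spin. -/
theorem sum_unitAt_topPart [NeZero N] (τ : Fin m ≃ Fin N) (a c : Fin N) {x : Amb N (m + n)}
    (hx : x ∈ stateSpace N (m + n)) :
    TensorProduct.map LinearMap.id (topSpin n τ) (((List.finRange m).map fun i =>
      (TensorProduct.map 1 (unitAt N c a (Fin.castAdd n i)) :
        Module.End ℂ (Laurent n ⊗[ℂ] Spin N (m + n)))).sum (topPoly N m n M x)) =
      if a = c then topPart n M τ x else 0 := by
  have h1 : ∀ i, TensorProduct.map LinearMap.id (topSpin n τ)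
      ((TensorProduct.map 1 (unitAt N c a (Fin.castAdd n i)) :
        Module.End ℂ (Laurent n ⊗[ℂ] Spin N (m + n))) (topPoly N m n M x)) =
      if τ i = c then topPart n M (Function.update τ i a) x else 0 := by
    intro i
    refine (LinearMap.congr_fun (f := TensorProduct.map LinearMap.id (topSpin n τ) ∘ₗ
      TensorProduct.map LinearMap.id (unitAt N c a (Fin.castAdd n i)))
      (g := if τ i = c then TensorProduct.map LinearMap.id
        (topSpin n (Function.update τ i a)) else 0) (TensorProduct.ext' fun p y => ?_)
      (topPoly N m n M x)).trans (by split_ifs <;> rfl)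
    change p ⊗ₜ[ℂ] _ = _
    rw [topSpin_unitAt_castAdd]
    split_ifs
    · rfl
    · exact TensorProduct.tmul_zero _ _
  rw [← List.ofFn_eq_map, List.sum_ofFn, LinearMap.sum_apply, map_sum,
    Finset.sum_congr rfl fun i _ => h1 i, Finset.sum_eq_single (τ.symm c)]
  · rw [if_pos (τ.apply_symm_apply c)]
    split_ifs with h
    · subst h
      rw [show Function.update (⇑τ) (τ.symm a) a = τ from Function.update_eq_self_iff.mpr (by simp)]
    · refine topSpin_of_not_injective M (i := τ.symm c) (j := τ.symm a)
        (fun e => h (τ.symm.injective e).symm) ?_ hx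
      rw [Function.update_self, Function.update_of_ne fun e => h (τ.symm.injective e),
        τ.apply_symm_apply]
  · intro i _ hi
    rw [if_neg fun e => hi (by rw [← e, τ.symm_apply_apply])]
  · simp

/-- The product of the first `m` operators acts on the leading part by a scalar. -/
theorem topPart_coeff_prod_castAdd [NeZero N] (τ : Fin m ≃ Fin N) (i₀ : Fin m) (hi₀ : (i₀ : ℕ) = 0)
    (a c : Fin N) (s : ℕ)
    {x : Amb N (m + n)} (hx : x ∈ stateSpace N (m + n))
    (hx' : x ∈ ambSpan N (expLe (m + n) M)) :
    topPart n M τ (coeff s ((((List.finRange m).map (Fin.castAdd n)).map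
        (absL (ambD N β) fun a b k => ambE N a b k)).prod a c) x) =
      if a = c then coeff s (1 + resolvent (topEigen m n β M i₀)) • topPart n M τ x else 0 := by
  have h1 := (prod_absL_intertwine (Fin.castAdd n)
    (ambD_castAdd_mem β M) (ambE_castAdd_mem (N := N) (m := m) (n := n) M) (List.finRange m) a c s
    hx').2
  obtain ⟨k, rfl⟩ : ∃ k, m = k + 1 := ⟨m - 1, by have := i₀.2; omega⟩
  have hi : i₀ = 0 := Fin.ext hi₀
  subst hi
  have hl := List.finRange_succ (n := k)
  have h2 := prod_absL_agreeAt (y := topPoly N (k + 1) n M x)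
    (D := fun i : Fin (k + 1) => topEigen (k + 1) n β M i • 1)
    (E := fun a b i => TensorProduct.map 1 (unitAt N a b (Fin.castAdd n i)))
    (fun i j a b => (Commute.one_left _).smul_left _)
    (fun i j hij a c => unitAt_topPoly M hij a c hx) 0 ((List.finRange k).map Fin.succ)
    (by rw [← hl]; exact List.nodup_finRange _) (by
      -- The eigenvalues decrease by one from each site to the next, as fusion requires.
      rw [← hl, List.isChain_iff_getElem]
      intro i hi
      simp only [List.getElem_finRange]
      rw [← one_smul ℂ (1 : Module.End ℂ (Laurent n ⊗[ℂ] Spin N (k + 1 + n))), smul_smul, mul_one,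
        smul_smul, mul_one, ← add_smul]
      congr 1
      simp only [topEigen, Fin.val_cast]
      push_cast
      ring) a c s
  rw [← hl] at h2
  rw [topPart, LinearMap.comp_apply, h1, h2, map_add, LinearMap.add_apply, map_add, coeff_mul_C]
  have h3 : coeff s (resolvent (topEigen (k + 1) n β M 0 •
      (1 : Module.End ℂ (Laurent n ⊗[ℂ] Spin N (k + 1 + n))))) =
      coeff s (resolvent (topEigen (k + 1) n β M 0)) • 1 := coeff_resolvent_smul_one _ _
  rw [h3, smul_mul_assoc, one_mul, LinearMap.smul_apply, map_smul,
    sum_unitAt_topPart M τ a c hx, map_add, add_smul]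
  split_ifs
  · congr 1
    rw [coeff_one, coeff_one]
    split_ifs
    · exact (one_smul ℂ _).symm
    · rw [zero_smul]
      exact map_zero _
  · rw [smul_zero, add_zero, map_zero]
    exact map_zero _

/-- The product splits into the first block, which acts on the leading part by a scalar series, and
the second, which acts as the operators for n sites. -/
theorem topPart_coeff_tSeries [NeZero N] (τ : Fin m ≃ Fin N) (i₀ : Fin m) (hi₀ : (i₀ : ℕ) = 0)
    (a b : Fin N) (s : ℕ) {x : Amb N (m + n)} (hx : x ∈ stateSpace N (m + n))
    (hx' : x ∈ ambSpan N (expLe (m + n) M)) :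
    topPart n M τ (coeff s (tSeries N (m + n) β a b) x) =
      ∑ p ∈ Finset.HasAntidiagonal.antidiagonal s,
        coeff p.1 (1 + resolvent (topEigen m n β M i₀)) •
          coeff p.2 (tSeries N n β a b) (topPart n M τ x) := by
  have hfin : List.finRange (m + n) =
      (List.finRange m).map (Fin.castAdd n) ++ (List.finRange n).map (Fin.natAdd m) := by
    have := List.ofFn_add (f := (id : Fin (m + n) → Fin (m + n)))
    rw [List.ofFn_id] at this
    rw [this, List.ofFn_eq_map, List.ofFn_eq_map]
    rfl
  rw [coeff_tSeries, hfin, List.map_append, List.prod_append, Matrix.mul_apply, map_sum,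
    LinearMap.sum_apply, map_sum]
  have key : ∀ c : Fin N, topPart n M τ (coeff s
      ((((List.finRange m).map (Fin.castAdd n)).map
        (absL (ambD N β) fun a b k => ambE N a b k)).prod a c *
      (((List.finRange n).map (Fin.natAdd m)).map
        (absL (ambD N β) fun a b k => ambE N a b k)).prod c b) x) =
      if a = c then ∑ p ∈ Finset.HasAntidiagonal.antidiagonal s,
        coeff p.1 (1 + resolvent (topEigen m n β M i₀)) •
          coeff p.2 (tSeries N n β c b) (topPart n M τ x) else 0 := by
    intro c
    have hc := prod_absL_commute (isEvaluation N (n := m + n) β)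
      (l₁ := (List.finRange m).map (Fin.castAdd n)) (l₂ := (List.finRange n).map (Fin.natAdd m))
      (fun i hi j hj => by
        rw [List.mem_map] at hi hj
        obtain ⟨i, -, rfl⟩ := hi
        obtain ⟨j, -, rfl⟩ := hj
        exact castAdd_ne_natAdd i j) a c c b
    -- The blocks are commuted so that the first one meets x directly: its scalar action needs x
    -- antisymmetric, whereas the intertwining of the second block needs only the exponent bound,
    -- which still holds after the first block has acted.
    rw [hc.eq, coeff_mul, LinearMap.sum_apply, map_sum, ← Finset.Nat.sum_antidiagonal_swap]
    have h : ∀ p : ℕ × ℕ, topPart n M τ ((coeff p.swap.1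
        ((((List.finRange n).map (Fin.natAdd m)).map
          (absL (ambD N β) fun a b k => ambE N a b k)).prod c b) *
        coeff p.swap.2 ((((List.finRange m).map (Fin.castAdd n)).map
          (absL (ambD N β) fun a b k => ambE N a b k)).prod a c)) x) =
        coeff p.2 (tSeries N n β c b) (if a = c then
          coeff p.1 (1 + resolvent (topEigen m n β M i₀)) • topPart n M τ x else 0) := by
      intro p
      have h1 := (prod_absL_intertwine (Fin.castAdd n) (ambD_castAdd_mem β M)
        (ambE_castAdd_mem (N := N) (m := m) (n := n) M) (List.finRange m) a c p.1 hx').1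
      have h2 := (prod_absL_intertwine (Fin.natAdd m) (ambD_natAdd_mem β M τ)
        (ambE_natAdd_mem (N := N) (m := m) (n := n) M τ) (List.finRange n) c b p.2 h1).2
      rw [← topPart_coeff_prod_castAdd β M τ i₀ hi₀ a c p.1 hx hx', coeff_tSeries]
      exact h2
    rw [Finset.sum_congr rfl fun p _ => h p]
    split_ifs
    · exact Finset.sum_congr rfl fun p _ => map_smul _ _ _
    · exact Finset.sum_eq_zero fun p _ => map_zero _
  rw [Finset.sum_congr rfl fun c _ => key c, Finset.sum_ite_eq, if_pos (Finset.mem_univ a)]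

end

end SpinSutherland

end

noncomputable section

namespace SpinSutherland

open PowerSeries

/-! ### The intertwining relations -/

/-- With c = (β⁻¹+N)(r+1), the new factor (u+c-1)/(u+c) of f is the inverse of 1 + (u+c-1)⁻¹. -/
theorem fSeries_succ_mul (N : ℕ) (β : ℂ) (r : ℕ) :
    fSeries N β (r + 1) * (1 + resolvent ((β⁻¹ + N) * ((r + 1 : ℕ) : ℂ) - 1)) = fSeries N β r := by
  rw [fSeries, Finset.prod_Icc_succ_top (by omega), ← fSeries]
  set c : ℂ := (β⁻¹ + N) * ((r + 1 : ℕ) : ℂ) with hc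
  have h1 : (1 + C (c - 1) * X : PowerSeries ℂ) * (1 + resolvent (c - 1)) = 1 + C c * X := by
    have := resolvent_add (c - 1)
    rw [map_sub, map_one] at this ⊢
    linear_combination this
  have h2 : (1 + C c * X : PowerSeries ℂ)⁻¹ * (1 + C c * X) = 1 :=
    PowerSeries.inv_mul_cancel _ (by simp)
  linear_combination fSeries N β r * (1 + C c * X : PowerSeries ℂ)⁻¹ * h1 + fSeries N β r * h2

/-- For 0 ≤ i < N one has -rN - i = (N - i) - N(r+1), and N - i lies in {1, …, N}: the N factors
share the exponent r+1 and run through all spins in reverse order. -/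
theorem bar_tail {N : ℕ} (r : ℕ) (i : Fin N) :
    bar N (-((r * N : ℕ) : ℤ) - (i : ℕ)) = r + 1 := by
  have h : (-((r * N : ℕ) : ℤ) - (i : ℕ)) = ((Fin.rev i : ℕ) + 1 : ℤ) - N * (r + 1 : ℤ) := by
    have := i.2
    rw [Fin.val_rev, Nat.cast_sub (by omega)]
    push_cast
    ring
  rw [h, bar_eq]

theorem under_tail {N : ℕ} [NeZero N] (r : ℕ) (i : Fin N) :
    under N (-((r * N : ℕ) : ℤ) - (i : ℕ)) = Fin.rev i := by
  have h : (-((r * N : ℕ) : ℤ) - (i : ℕ)) = ((Fin.rev i : ℕ) + 1 : ℤ) - N * (r + 1 : ℤ) := by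
    have := i.2
    rw [Fin.val_rev, Nat.cast_sub (by omega)]
    push_cast
    ring
  rw [h, under_eq]

/-- The part of a tensor with the factors `u_{-rN}, …, u_{-rN-N+1}` in the first places. -/
def tailPart (N r : ℕ) : Amb N (N + r * N) →ₗ[ℂ] Amb N (r * N) :=
  topPart (r * N) ((r : ℤ) + 1) (Fin.revPerm : Fin N ≃ Fin N)

open Classical in
theorem tailPart_uvec (N : ℕ) [NeZero N] (r : ℕ) (k : Fin (N + r * N) → ℤ) :
    tailPart N r (uvec N k) =
      if ∀ i : Fin N, k (Fin.castAdd (r * N) i) = -((r * N : ℕ) : ℤ) - (i : ℕ)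
        then uvec N (k ∘ Fin.natAdd N) else 0 := by
  have key : (∀ i : Fin N, k (Fin.castAdd (r * N) i) = -((r * N : ℕ) : ℤ) - (i : ℕ)) ↔
      (∀ i : Fin N, bar N (k (Fin.castAdd (r * N) i)) = (r : ℤ) + 1) ∧
        ∀ i : Fin N, under N (k (Fin.castAdd (r * N) i)) = (Fin.revPerm : Fin N ≃ Fin N) i := by
    constructor
    · intro h
      exact ⟨fun i => by rw [h i, bar_tail], fun i => by rw [h i, under_tail]; rfl⟩
    · rintro ⟨h1, h2⟩ i
      rw [under_bar N (k _), under_bar N (-((r * N : ℕ) : ℤ) - (i : ℕ)), h1, h2, bar_tail,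
        under_tail]
      rfl
  rw [tailPart, uvec_eq, topPart_tmul, topCoeff_mono, topSpin_spinVec]
  simp only [key]
  by_cases h1 : ∀ i : Fin N, bar N (k (Fin.castAdd (r * N) i)) = (r : ℤ) + 1
  · by_cases h2 : ∀ i : Fin N, under N (k (Fin.castAdd (r * N) i)) =
        (Fin.revPerm : Fin N ≃ Fin N) i
    · rw [if_pos h1, if_pos h2, if_pos ⟨h1, h2⟩]
      rfl
    · rw [if_neg h2]
      exact (TensorProduct.tmul_zero _ _).trans (if_neg fun h => h2 h.2).symm
  · rw [if_neg h1]
    exact (TensorProduct.zero_tmul _ _).trans (if_neg fun h => h1 h.1).symm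

/-- As k_i ≥ -i, the value -n - i can occur only at a position ≥ n + i. Since m such values have to
fit strictly increasingly below m + n, each sits exactly at n + i. -/
theorem Seq.eq_of_attains {m n : ℕ} (k : Seq (m + n)) {q : Fin m → Fin (m + n)}
    (hq : ∀ i, k.1 (q i) = -(n : ℤ) - (i : ℕ)) (i : Fin m) : (q i : ℕ) = n + i := by
  have h1 : ∀ i, n + i ≤ (q i : ℕ) := fun i => by
    have := k.2.2 (q i)
    rw [hq] at this
    omega
  have hanti : StrictAnti fun i => -((q i : ℕ) : ℤ) := fun i j hij => by
    have : q i < q j := by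
      rw [← k.2.1.lt_iff_gt, hq, hq]
      have : (i : ℕ) < j := hij
      omega
    have : (q i : ℕ) < q j := this
    simp only
    omega
  have hm : 0 < m := by have := i.2; omega
  have h2 := strictAnti_add_le hanti (i := i) (j := ⟨m - 1, by omega⟩)
    (by rw [Fin.le_def]; have := i.2; simp only; omega)
  have h3 := h1 i
  have h4 := (q ⟨m - 1, by omega⟩).2
  simp only at h2
  omega

/-- The permutation that exchanges the blocks of the first `m` and of the last `n` places. -/
def blockSwap (m n : ℕ) : Equiv.Perm (Fin (m + n)) :=
  finAddFlip.trans (finCongr (add_comm n m))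

theorem blockSwap_castAdd {m n : ℕ} (i : Fin m) :
    (blockSwap m n (Fin.castAdd n i) : ℕ) = n + i := by
  simp [blockSwap, add_comm]

theorem blockSwap_natAdd {m n : ℕ} (j : Fin n) :
    blockSwap m n (Fin.natAdd m j) = Fin.castLE (Nat.le_add_left n m) j := by
  ext
  simp [blockSwap]

theorem exists_viaFintypeEmbedding {m n : ℕ} {w : Equiv.Perm (Fin (m + n))}
    (hw : ∀ i : Fin m, w (Fin.castAdd n i) = Fin.castAdd n i) :
    ∃ v : Equiv.Perm (Fin n),
      v.viaFintypeEmbedding (Fin.natAddEmb m : Fin n ↪ Fin (m + n)) = w := by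
  have h1 : ∀ j : Fin n, ∃ j', w (Fin.natAdd m j) = Fin.natAdd m j' := fun j => by
    induction h : w (Fin.natAdd m j) using Fin.addCases with
    | left i =>
      rw [← hw i] at h
      exact absurd (w.injective h).symm (castAdd_ne_natAdd i j)
    | right j' => exact ⟨j', rfl⟩
  choose f hf using h1
  have hinj : Function.Injective f := fun a b hab => by
    have := hf a
    rw [hab, ← hf b] at this
    exact Fin.natAdd_injective n m (w.injective this)
  refine ⟨Equiv.ofBijective f (Finite.injective_iff_bijective.mp hinj), Equiv.ext fun x => ?_⟩
  induction x using Fin.addCases with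
  | left i =>
    rw [hw, Equiv.Perm.viaFintypeEmbedding_apply_notMem_range]
    rintro ⟨j, hj⟩
    exact castAdd_ne_natAdd i j hj.symm
  | right j =>
    rw [hf]
    exact Equiv.Perm.viaFintypeEmbedding_apply_image _ (Fin.natAddEmb m : Fin n ↪ Fin (m + n)) j

/-- The last N factors are moved to the front at the cost of the sign of the block exchange. In the
antisymmetrized sum only permutations fixing the first block can contribute, and they form the wedge
of the first rN factors. -/
theorem tailPart_wedge (N : ℕ) [NeZero N] (r : ℕ) (h : r * N ≤ N + r * N) (k : Seq (N + r * N)) :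
    tailPart N r (wedge N k.1) = ((Equiv.Perm.sign (blockSwap N (r * N)) : ℤ) : ℂ) •
      (proj N h (wedgeBasis N _ k) : Amb N (r * N)) := by
  classical
  set ρ := blockSwap N (r * N) with hρ
  have h0 : wedge N k.1 = ((Equiv.Perm.sign ρ : ℤ) : ℂ) • wedge N (k.1 ∘ ρ) := by
    rw [wedge_comp, smul_smul, sign_mul_sign_cast, one_smul]
  rw [h0, map_smul]
  congr 1
  rw [wedge, map_sum, proj, Module.Basis.constr_basis]
  simp only [map_smul, tailPart_uvec]
  have hq : ∀ w : Equiv.Perm (Fin (N + r * N)),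
      (∀ i : Fin N, ((k.1 ∘ ρ) ∘ w) (Fin.castAdd (r * N) i) = -((r * N : ℕ) : ℤ) - (i : ℕ)) →
      ∀ i : Fin N, w (Fin.castAdd (r * N) i) = Fin.castAdd (r * N) i := by
    intro w hw i
    have := k.eq_of_attains (q := fun i => ρ (w (Fin.castAdd (r * N) i))) hw i
    apply ρ.injective
    ext
    rw [this, blockSwap_castAdd]
  by_cases hk : ∀ i : Fin (N + r * N), r * N ≤ (i : ℕ) → k.1 i = -((i : ℕ) : ℤ)
  · rw [if_pos hk, wedgeBasis_apply, wedge]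
    symm
    -- The contributing permutations are those induced from the second block, with the same sign.
    refine Fintype.sum_of_injective
      (fun v : Equiv.Perm (Fin (r * N)) =>
        v.viaFintypeEmbedding (Fin.natAddEmb N : Fin (r * N) ↪ Fin (N + r * N))) ?_ _ _ ?_ ?_
    · intro v v' hv
      ext1 j
      have := congrArg (fun w => w (Fin.natAddEmb N j)) hv
      simp only [Equiv.Perm.viaFintypeEmbedding_apply_image] at this
      exact (Fin.natAddEmb N).injective this
    · intro w hw
      rw [if_neg fun hw' => hw (exists_viaFintypeEmbedding (hq w hw')), smul_zero]
    · intro v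
      rw [Equiv.Perm.viaFintypeEmbedding_sign, if_pos]
      · congr 2
        funext j
        have h1 := Equiv.Perm.viaFintypeEmbedding_apply_image v
          (Fin.natAddEmb N : Fin (r * N) ↪ Fin (N + r * N)) j
        have h2 : (Fin.natAddEmb N : Fin (r * N) ↪ Fin (N + r * N)) j = Fin.natAdd N j := rfl
        rw [h2] at h1
        simp only [Function.comp_apply]
        rw [h1]
        have h3 : (Fin.natAddEmb N : Fin (r * N) ↪ Fin (N + r * N)) (v j) = Fin.natAdd N (v j) :=
          rfl
        rw [h3, hρ, blockSwap_natAdd]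
        rfl
      · intro i
        simp only [Function.comp_apply]
        rw [Equiv.Perm.viaFintypeEmbedding_apply_notMem_range]
        · rw [hk _ (by rw [hρ, blockSwap_castAdd]; omega), hρ, blockSwap_castAdd]
          push_cast
          ring
        · rintro ⟨j, hj⟩
          exact castAdd_ne_natAdd i j hj.symm
  · rw [if_neg hk]
    refine Finset.sum_eq_zero fun w _ => ?_
    rw [if_neg, smul_zero]
    intro hw
    -- A nonzero term would place every tail value at its own position, so the tail of k would
    -- already agree with o.
    refine hk fun i hi => ?_
    have hi' : i = ρ (w (Fin.castAdd (r * N) ⟨i - r * N, by have := i.2; omega⟩)) := by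
      rw [hq w hw]
      ext
      rw [hρ, blockSwap_castAdd]
      exact (Nat.add_sub_cancel' hi).symm
    have := hw ⟨i - r * N, by have := i.2; omega⟩
    simp only [Function.comp_apply] at this
    rw [← hi'] at this
    rw [this, Nat.cast_sub hi]
    ring

theorem tailPart_eq_proj (N : ℕ) [NeZero N] (r : ℕ) (h : r * N ≤ N + r * N) (x : F0 N (N + r * N)) :
    tailPart N r x = ((Equiv.Perm.sign (blockSwap N (r * N)) : ℤ) : ℂ) •
      (proj N h x : Amb N (r * N)) := by
  refine LinearMap.congr_fun (f := tailPart N r ∘ₗ (F0 N (N + r * N)).subtype)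
    (g := ((Equiv.Perm.sign (blockSwap N (r * N)) : ℤ) : ℂ) •
      ((F0 N (r * N)).subtype ∘ₗ proj N h)) ((wedgeBasis N _).ext fun k => ?_) x
  change tailPart N r (wedgeBasis N _ k : Amb N (N + r * N)) = _
  rw [wedgeBasis_apply, tailPart_wedge N r h]
  rfl

/-- Associativity of the Cauchy product, for series with coefficients in a module. -/
theorem sum_coeff_mul_smul {V : Type*} [AddCommGroup V] [Module ℂ V] (φ g : PowerSeries ℂ)
    (t : ℕ → V) (s : ℕ) :
    ∑ p ∈ Finset.HasAntidiagonal.antidiagonal s, coeff p.1 φ •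
        ∑ q ∈ Finset.HasAntidiagonal.antidiagonal p.2, coeff q.1 g • t q.2 =
      ∑ p ∈ Finset.HasAntidiagonal.antidiagonal s, coeff p.1 (φ * g) • t p.2 := by
  simp only [coeff_mul, Finset.smul_sum, Finset.sum_smul, smul_smul]
  rw [Finset.sum_sigma', Finset.sum_sigma']
  refine Finset.sum_nbij' (fun x => ⟨(x.1.1 + x.2.1, x.2.2), (x.1.1, x.2.1)⟩)
    (fun x => ⟨(x.2.1, x.2.2 + x.1.2), (x.2.2, x.1.2)⟩) ?_ ?_ ?_ ?_ ?_ <;>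
  · rintro ⟨⟨a, b⟩, ⟨c, d⟩⟩ h
    simp only [Finset.mem_sigma, Finset.HasAntidiagonal.mem_antidiagonal] at h ⊢ <;>
    · obtain ⟨rfl, rfl⟩ := h
      first
      | exact ⟨by omega, trivial⟩
      | rfl

/-- The number of sites `K` is a variable because (r+1)N and N + rN give different types; the
equation between them is eliminated inside. -/
theorem proj_sum_coeff (N : ℕ) [NeZero N] (β : ℂ) {r K : ℕ} (hK : K = N + r * N) (h : r * N ≤ K)
    (x : F0 N K) (hx : (x : Amb N K) ∈ ambSpan N (expLe K ((r : ℤ) + 1))) (φ : PowerSeries ℂ)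
    (a b : Fin N) (s : ℕ)
    (y : F0 N K) (hy : (y : Amb N K) = ∑ p ∈ Finset.HasAntidiagonal.antidiagonal s,
      coeff p.1 φ • coeff p.2 (tSeries N K β a b) x) :
    (proj N h y : Amb N (r * N)) = ∑ p ∈ Finset.HasAntidiagonal.antidiagonal s,
      coeff p.1 (φ * (1 + resolvent ((β⁻¹ + N) * ((r + 1 : ℕ) : ℂ) - 1))) •
        coeff p.2 (tSeries N (r * N) β a b) (proj N h x) := by
  subst hK
  have hN : 0 < N := Nat.pos_of_ne_zero (NeZero.ne N)
  set ε : ℂ := ((Equiv.Perm.sign (blockSwap N (r * N)) : ℤ) : ℂ) with hε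
  have hε2 : ε * ε = 1 := sign_mul_sign_cast _
  have hproj : ∀ x : F0 N (N + r * N), (proj N h x : Amb N (r * N)) = ε • tailPart N r x :=
    fun x => by rw [tailPart_eq_proj N r h, smul_smul, hε2, one_smul]
  -- The first eigenvalue β⁻¹(r+1) + (N + rN) - 1, with maximal exponent r+1 and (r+1)N variables in
  -- all.
  have hc : topEigen N (r * N) β ((r : ℤ) + 1) ⟨0, hN⟩ = (β⁻¹ + N) * ((r + 1 : ℕ) : ℂ) - 1 := by
    rw [topEigen]
    push_cast
    ring
  have key := fun s => topPart_coeff_tSeries β ((r : ℤ) + 1) (Fin.revPerm : Fin N ≃ Fin N)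
    ⟨0, hN⟩ rfl a b s (F0_le_stateSpace N _ x.2) hx
  rw [hc] at key
  have h1 : tailPart N r y = ∑ p ∈ Finset.HasAntidiagonal.antidiagonal s,
      coeff p.1 (φ * (1 + resolvent ((β⁻¹ + N) * ((r + 1 : ℕ) : ℂ) - 1))) •
        coeff p.2 (tSeries N (r * N) β a b) (tailPart N r x) := by
    refine Eq.trans ?_ (sum_coeff_mul_smul φ (1 + resolvent ((β⁻¹ + N) * ((r + 1 : ℕ) : ℂ) - 1))
      (fun q => coeff q (tSeries N (r * N) β a b) (tailPart N r x)) s)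
    rw [hy, map_sum]
    refine Finset.sum_congr rfl fun p _ => ?_
    rw [map_smul]
    exact congrArg _ (key p.2)
  rw [hproj, hproj, h1, Finset.smul_sum]
  refine Finset.sum_congr rfl fun p _ => ?_
  rw [map_smul, smul_comm]

theorem proj_tBar (N : ℕ) [NeZero N] (β : ℂ) (r s : ℕ) (a b : Fin N) (h : r * N ≤ (r + 1) * N)
    (x y : F0 N ((r + 1) * N)) (hy : (y : Amb N ((r + 1) * N)) = tBar N β (r + 1) s a b x) :
    (proj N h y : Amb N (r * N)) = tBar N β r s a b (proj N h x) := by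
  have hx := F0_le_ambSpan N (r + 1) x.2
  rw [Nat.cast_succ] at hx
  rw [tBar_eq_sum, LinearMap.sum_apply] at hy
  rw [proj_sum_coeff N β (by ring) h x hx (fSeries N β (r + 1)) a b s y hy, fSeries_succ_mul,
    tBar_eq_sum, LinearMap.sum_apply]
  rfl

end SpinSutherland

end

noncomputable section

namespace SpinSutherland

/-! ### The basis of the Fock space -/

/-- The determinant of the matrix with the entries `1` at the places `(i, j)` with `k i = l j`, and
`0` elsewhere. -/
def coincidenceDet (n : ℕ) (k l : ℕ → ℤ) : ℂ :=
  (Matrix.of fun i j : Fin n => if k i = l j then (1 : ℂ) else 0).det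

/-- Expansion along the last row, whose only nonzero entry is the diagonal one because l is
injective. -/
theorem coincidenceDet_succ {n : ℕ} {k l : ℕ → ℤ} (hl : StrictAnti l) (h : k n = l n) :
    coincidenceDet (n + 1) k l = coincidenceDet n k l := by
  rw [coincidenceDet, Matrix.det_succ_row _ (Fin.last n), Finset.sum_eq_single (Fin.last n)]
  · have h1 : (-1 : ℂ) ^ (n + n) = 1 := Even.neg_one_pow ⟨n, rfl⟩
    simp only [Matrix.of_apply, Fin.val_last, h, h1, if_true, one_mul]
    rw [coincidenceDet]
    congr 1
    ext i j
    simp [Fin.succAbove_last]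
  · intro j _ hj
    have : k n ≠ l j := fun e => hj (Fin.ext (hl.injective (e.symm.trans h)))
    simp [this]
  · simp

theorem coincidenceDet_stable {m n : ℕ} {k l : ℕ → ℤ} (hl : StrictAnti l)
    (h : ∀ i, m ≤ i → k i = l i) (hmn : m ≤ n) :
    coincidenceDet n k l = coincidenceDet m k l := by
  induction n, hmn using Nat.le_induction with
  | base => rfl
  | succ n hn ih => rw [coincidenceDet_succ hl (h n hn), ih]

theorem coincidenceDet_swap {n i : ℕ} (k l : ℕ → ℤ) (hi : i + 1 < n) :
    coincidenceDet n (k ∘ Equiv.swap i (i + 1)) l = -coincidenceDet n k l := by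
  have h := Matrix.det_permute (Equiv.swap (⟨i, by omega⟩ : Fin n) ⟨i + 1, hi⟩)
    (Matrix.of fun i j : Fin n => if k i = l j then (1 : ℂ) else 0)
  rw [Equiv.Perm.sign_swap (by simp [Fin.ext_iff])] at h
  rw [coincidenceDet, coincidenceDet]
  refine Eq.trans ?_ (h.trans (by simp))
  congr 1
  ext a b
  have : (Equiv.swap (⟨i, by omega⟩ : Fin n) ⟨i + 1, hi⟩ a : ℕ) = Equiv.swap i (i + 1) (a : ℕ) :=
    (Fin.val_injective.swap_apply (⟨i, by omega⟩ : Fin n) ⟨i + 1, hi⟩ a).symm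
  simp [this]

theorem coincidenceDet_self {n : ℕ} {l : ℕ → ℤ} (hl : StrictAnti l) : coincidenceDet n l l = 1 := by
  rw [coincidenceDet]
  have : (Matrix.of fun i j : Fin n => if l i = l j then (1 : ℂ) else 0) = 1 := by
    ext i j
    simp [Matrix.one_apply, hl.injective.eq_iff, Fin.ext_iff]
  rw [this, Matrix.det_one]

/-- If every k_i occurs among l_1, …, l_n, then the two decreasing sequences have the same entries
and coincide; otherwise the matrix has a zero row. -/
theorem coincidenceDet_of_strictAnti {n : ℕ} {k l : ℕ → ℤ} (hk : StrictAnti k) (hl : StrictAnti l)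
    (h : ∃ i < n, k i ≠ l i) : coincidenceDet n k l = 0 := by
  by_cases hex : ∀ i : Fin n, ∃ j : Fin n, k i = l j
  · exfalso
    choose f hf using hex
    have hinj : Function.Injective f := fun a b hab => by
      have h1 := hf a
      rw [hab, ← hf b] at h1
      exact Fin.ext (hk.injective h1)
    have hk' : StrictAnti fun i : Fin n => k i := fun a b hab => hk hab
    have hl' : StrictAnti fun i : Fin n => l i := fun a b hab => hl hab
    have hw := strictAnti_comp_perm hl' hk'
      (Equiv.ofBijective f (Finite.injective_iff_bijective.mp hinj)) (funext fun i => (hf i).symm)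
    obtain ⟨i, hi, hne⟩ := h
    have h1 : f ⟨i, hi⟩ = ⟨i, hi⟩ := congrArg (fun w : Equiv.Perm (Fin n) => w ⟨i, hi⟩) hw
    have h2 := hf ⟨i, hi⟩
    rw [h1] at h2
    exact hne h2
  · push Not at hex
    obtain ⟨i, hi⟩ := hex
    exact Matrix.det_eq_zero_of_row_eq_zero i fun j => by simp [hi j]

theorem SemiInf.exists_tail (k l : SemiInf) : ∃ m : ℕ, ∀ i, m ≤ i → k.1 i = l.1 i := by
  obtain ⟨m, hm⟩ := k.2
  obtain ⟨m', hm'⟩ := l.2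
  exact ⟨max m m', fun i hi => by
    rw [hm i ((le_max_left _ _).trans hi), hm' i ((le_max_right _ _).trans hi)]⟩

/-- The coordinate functional of û_l is a determinant whose size is any bound beyond which the tails
agree. Independence of this size lets both sides of an exchange relation be evaluated with one
matrix size, where the determinant is alternating. -/
theorem exists_coord_siWedge {l : SemiInf} (hl : StrictAnti l.1) :
    ∃ φ : Fock →ₗ[ℂ] ℂ, ∀ k : SemiInf, ∀ n : ℕ, (∀ i, n ≤ i → k.1 i = l.1 i) →
      φ (siWedge k) = coincidenceDet n k.1 l.1 := by
  choose B hB using fun k : SemiInf => k.exists_tail l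
  let ψ : (SemiInf →₀ ℂ) →ₗ[ℂ] ℂ :=
    Finsupp.linearCombination ℂ fun k => coincidenceDet (B k) k.1 l.1
  have hψ : ∀ k : SemiInf, ∀ n : ℕ, (∀ i, n ≤ i → k.1 i = l.1 i) →
      ψ (Finsupp.single k 1) = coincidenceDet n k.1 l.1 := by
    intro k n hn
    rw [Finsupp.linearCombination_single, one_smul,
      ← coincidenceDet_stable hl hn (le_max_left n (B k)),
      ← coincidenceDet_stable hl (hB k) (le_max_right n (B k))]
  have hrel : fockRel ≤ LinearMap.ker ψ := by
    rw [fockRel, Submodule.span_le]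
    rintro _ ⟨k, i, rfl⟩
    rw [SetLike.mem_coe, LinearMap.mem_ker, map_add]
    -- The bound i + 2 keeps both exchanged rows inside the matrix.
    set n := max (B k) (max (B (k.swap i)) (i + 2)) with hn
    have h1 : B k ≤ n := le_max_left _ _
    have h2 : B (k.swap i) ≤ n := (le_max_left _ _).trans (le_max_right _ _)
    have h3 : i + 2 ≤ n := (le_max_right _ _).trans (le_max_right _ _)
    rw [hψ k n fun j hj => hB k j (h1.trans hj),
      hψ (k.swap i) n fun j hj => hB _ j (h2.trans hj)]
    have := coincidenceDet_swap (n := n) (i := i) k.1 l.1 (by omega)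
    rw [SemiInf.swap, this, add_neg_cancel]
  refine ⟨fockRel.liftQ ψ hrel, fun k n hn => ?_⟩
  rw [siWedge, ← hψ k n hn]
  exact Submodule.liftQ_apply _ _ _

/-- The strictly decreasing sequences, which label the basis of the Fock space. -/
abbrev AntiSeq : Type := {k : SemiInf // StrictAnti k.1}

theorem siWedge_linearIndependent : LinearIndependent ℂ fun k : AntiSeq => siWedge k.1 := by
  choose φ hφ using fun l : AntiSeq => exists_coord_siWedge l.2
  refine LinearIndependent.of_pairwise_dual_eq_zero_one _ φ (fun l k hlk => ?_) fun l => ?_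
  · change φ l (siWedge k.1) = 0
    obtain ⟨n, hn⟩ := k.1.exists_tail l.1
    have hne : ∃ i, k.1.1 i ≠ l.1.1 i := by
      by_contra! h
      exact hlk (Subtype.ext (Subtype.ext (funext fun i => (h i).symm)))
    obtain ⟨i, hi⟩ := hne
    rw [hφ l k.1 n hn]
    refine coincidenceDet_of_strictAnti k.2 l.2 ⟨i, ?_, hi⟩
    by_contra! h
    exact hi (hn i h)
  · change φ l (siWedge l.1) = 1
    rw [hφ l l.1 0 fun _ _ => rfl, coincidenceDet_self l.2]

theorem siWedge_swap (k : SemiInf) (i : ℕ) : siWedge (k.swap i) = -siWedge k := by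
  have h : Finsupp.single k (1 : ℂ) + Finsupp.single (k.swap i) 1 ∈ fockRel :=
    Submodule.subset_span ⟨k, i, rfl⟩
  rw [← Submodule.Quotient.mk_eq_zero] at h
  exact (neg_eq_of_add_eq_zero_right h).symm

/-- The sequence `k` with its first `n` entries permuted by `w`. -/
def SemiInf.perm {n : ℕ} (k : SemiInf) (w : Equiv.Perm (Fin n)) : SemiInf :=
  ⟨fun i => if h : i < n then k.1 (w ⟨i, h⟩) else k.1 i, by
    obtain ⟨m, hm⟩ := k.2
    refine ⟨max m n, fun i hi => ?_⟩
    exact (dif_neg (by have := le_max_right m n; omega)).trans (hm i ((le_max_left _ _).trans hi))⟩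

theorem SemiInf.perm_mul {n : ℕ} (k : SemiInf) (v w : Equiv.Perm (Fin n)) :
    k.perm (v * w) = (k.perm v).perm w := by
  refine Subtype.ext (funext fun i => ?_)
  by_cases h : i < n <;> simp [SemiInf.perm, h]

theorem SemiInf.perm_one {n : ℕ} (k : SemiInf) : k.perm (1 : Equiv.Perm (Fin n)) = k := by
  refine Subtype.ext (funext fun i => ?_)
  simp [SemiInf.perm]

theorem SemiInf.perm_swap {n : ℕ} (k : SemiInf) (a b : Fin n) (i : ℕ) :
    (k.perm (Equiv.swap a b)).1 i = k.1 (Equiv.swap (a : ℕ) b i) := by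
  by_cases h : i < n
  · simp only [SemiInf.perm, h, dif_pos]
    rw [← Fin.val_injective.swap_apply a b ⟨i, h⟩]
  · simp only [SemiInf.perm, h, dif_neg, not_false_eq_true]
    rw [Equiv.swap_apply_of_ne_of_ne] <;> omega

theorem siWedge_perm {n : ℕ} (w : Equiv.Perm (Fin n)) (k : SemiInf) :
    siWedge (k.perm w) = ((Equiv.Perm.sign w : ℤ) : ℂ) • siWedge k := by
  cases n with
  | zero =>
    rw [Subsingleton.elim w 1, SemiInf.perm_one]
    simp
  | succ n =>
    have hw : w ∈ Submonoid.closure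
        (Set.range fun i : Fin n => Equiv.swap i.castSucc i.succ) := by
      rw [Equiv.Perm.mclosure_swap_castSucc_succ]
      trivial
    induction hw using Submonoid.closure_induction generalizing k with
    | mem w hw =>
      obtain ⟨i, rfl⟩ := hw
      have h : k.perm (Equiv.swap i.castSucc i.succ) = k.swap i := by
        refine Subtype.ext (funext fun j => ?_)
        rw [SemiInf.perm_swap]
        rfl
      dsimp only
      rw [h, siWedge_swap, Equiv.Perm.sign_swap Fin.castSucc_lt_succ.ne]
      simp
    | one => rw [SemiInf.perm_one]; simp
    | mul v w _ _ hv hw =>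
      rw [SemiInf.perm_mul, hw, hv, smul_smul, Equiv.Perm.sign_mul, mul_comm]
      push_cast
      rfl

theorem siWedge_eq_zero {k : SemiInf} (hk : ¬ Function.Injective k.1) : siWedge k = 0 := by
  simp only [Function.Injective, not_forall] at hk
  obtain ⟨a, b, hab, hne⟩ := hk
  have ha : a < max a b + 1 := by omega
  have hb : b < max a b + 1 := by omega
  have h := siWedge_perm (Equiv.swap (⟨a, ha⟩ : Fin (max a b + 1)) ⟨b, hb⟩) k
  rw [Equiv.Perm.sign_swap (by simpa [Fin.ext_iff] using hne)] at h
  have hk' : k.perm (Equiv.swap (⟨a, ha⟩ : Fin (max a b + 1)) ⟨b, hb⟩) = k := by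
    refine Subtype.ext (funext fun j => ?_)
    rw [SemiInf.perm_swap, Equiv.swap_apply_def]
    split_ifs with h1 h2
    · rw [h1]; exact hab.symm
    · rw [h2]; exact hab
    · rfl
  rw [hk'] at h
  exact eq_zero_of_eq_neg (h.trans (by simp))

/-- A wedge with a repeated entry vanishes. Otherwise sorting finitely many entries costs a sign and
yields a normally ordered wedge. -/
theorem siWedge_mem_span (k : SemiInf) :
    siWedge k ∈ Submodule.span ℂ (Set.range fun k : AntiSeq => siWedge k.1) := by
  by_cases hk : Function.Injective k.1
  · obtain ⟨n, hn⟩ := k.2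
    obtain ⟨w, hw⟩ := exists_perm_strictAnti (k := fun i : Fin n => k.1 i)
      (hk.comp Fin.val_injective)
    have hanti : StrictAnti (k.perm w).1 := by
      -- A value ≤ -n among the first n entries would be repeated in the tail, against injectivity;
      -- so the sorted head stays above the tail.
      have hlow : ∀ i : Fin n, -(n : ℤ) < k.1 i := by
        intro i
        by_contra! h
        have h1 := hn (-k.1 i).toNat (by omega)
        have h2 : (((-k.1 i).toNat : ℕ) : ℤ) = -k.1 i := Int.toNat_of_nonneg (by omega)
        rw [h2, neg_neg] at h1
        have := hk h1
        have := i.2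
        omega
      intro a b hab
      by_cases hb : b < n
      · have ha : a < n := hab.trans hb
        simp only [SemiInf.perm, ha, hb, dif_pos]
        exact hw (a := ⟨a, ha⟩) (b := ⟨b, hb⟩) hab
      · simp only [SemiInf.perm, hb, dif_neg, not_false_eq_true]
        rw [hn b (by omega)]
        split_ifs with ha
        · have := hlow (w ⟨a, ha⟩)
          omega
        · rw [hn a (by omega)]
          omega
    have h1 := siWedge_perm w k
    have h2 : siWedge k = ((Equiv.Perm.sign w : ℤ) : ℂ) • siWedge (k.perm w) := by
      rw [h1, smul_smul, sign_mul_sign_cast, one_smul]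
    rw [h2]
    exact Submodule.smul_mem _ _ (Submodule.subset_span ⟨⟨k.perm w, hanti⟩, rfl⟩)
  · rw [siWedge_eq_zero hk]
    exact zero_mem _

theorem span_siWedge : Submodule.span ℂ (Set.range fun k : AntiSeq => siWedge k.1) = ⊤ := by
  rw [eq_top_iff]
  rintro x -
  obtain ⟨y, rfl⟩ := fockRel.mkQ_surjective x
  induction y using Finsupp.induction_linear with
  | zero => rw [map_zero]; exact zero_mem _
  | add f g hf hg => rw [map_add]; exact add_mem hf hg
  | single k c =>
    rw [← mul_one c, ← smul_eq_mul, ← Finsupp.smul_single, map_smul]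
    exact Submodule.smul_mem _ _ (siWedge_mem_span k)

end SpinSutherland

end

noncomputable section

namespace SpinSutherland

/-! ### The homogeneous components of the Fock space -/

theorem strictAnti_nat_add_le {k : ℕ → ℤ} (hk : StrictAnti k) {i j : ℕ} (hij : i ≤ j) :
    k j + ((j : ℤ) - i) ≤ k i := by
  induction j, hij using Nat.le_induction with
  | base => simp
  | succ j hj ih =>
    have := hk (Nat.lt_succ_self j)
    simp only [Nat.succ_eq_add_one] at this
    push_cast
    omega

/-- The sequence drops by at least one at each step and eventually equals -j at position j. -/
theorem AntiSeq.neg_le (k : AntiSeq) (i : ℕ) : -(i : ℤ) ≤ k.1.1 i := by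
  obtain ⟨m, hm⟩ := k.1.2
  have h := strictAnti_nat_add_le k.2 (le_max_left i m)
  rw [hm _ (le_max_right i m)] at h
  omega

theorem bar_antitone {N : ℕ} [NeZero N] {k l : ℤ} (h : k ≤ l) : bar N l ≤ bar N k := by
  rw [bar_le_iff]
  exact ((bar_le_iff k _).mp le_rfl).trans h

/-- The homogeneous degree of a semi-infinite wedge. -/
def siDegree (N : ℕ) (k : SemiInf) : ℤ := ∑ᶠ i : ℕ, (bar N (-(i : ℤ)) - bar N (k.1 i))

theorem siDegree_eq {N n : ℕ} {k : SemiInf} (hk : ∀ i, n ≤ i → k.1 i = -(i : ℤ)) :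
    siDegree N k = ∑ i : Fin n, (bar N (-((i : ℕ) : ℤ)) - bar N (k.1 i)) := by
  rw [siDegree, finsum_eq_sum_of_support_subset (s := Finset.range n)]
  · exact (Fin.sum_univ_eq_sum_range (fun i : ℕ => bar N (-(i : ℤ)) - bar N (k.1 i)) n).symm
  · intro i hi
    by_contra h
    rw [Finset.coe_range, Set.mem_Iio, not_lt] at h
    exact hi (by simp only [hk i h, sub_self])

theorem AntiSeq.bar_le {N : ℕ} [NeZero N] (k : AntiSeq) (i : ℕ) :
    bar N (k.1.1 i) ≤ bar N (-(i : ℤ)) := bar_antitone (k.neg_le i)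

theorem AntiSeq.siDegree_nonneg {N : ℕ} [NeZero N] (k : AntiSeq) : 0 ≤ siDegree N k.1 :=
  finsum_nonneg fun i => sub_nonneg.mpr (k.bar_le i)

theorem bar_neg_mul {N : ℕ} [NeZero N] (j : ℕ) : bar N (-((j * N : ℕ) : ℤ)) = j + 1 := by
  have := bar_tail j (⟨0, Nat.pos_of_ne_zero (NeZero.ne N)⟩ : Fin N)
  simpa using this

/-- If k exceeds o at a position i ≥ dN, it exceeds o at all earlier ones. At each of the positions
0, N, …, dN the exponent of o has just increased, so exceeding o there costs at least one unit of
degree. These d + 1 units contradict degree d. -/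
theorem AntiSeq.eq_of_siDegree {N : ℕ} [NeZero N] {k : AntiSeq} {d : ℕ}
    (hk : siDegree N k.1 = d) {i : ℕ} (hi : d * N ≤ i) : k.1.1 i = -(i : ℤ) := by
  have hN : 0 < N := Nat.pos_of_ne_zero (NeZero.ne N)
  refine le_antisymm ?_ (k.neg_le i)
  by_contra! h
  obtain ⟨m, hm⟩ := k.1.2
  have hpos : ∀ j ≤ d, 1 ≤ bar N (-((j * N : ℕ) : ℤ)) - bar N (k.1.1 (j * N)) := by
    intro j hj
    have hji : j * N ≤ i := (Nat.mul_le_mul_right N hj).trans hi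
    have h1 := strictAnti_nat_add_le k.2 hji
    have h2 : bar N (k.1.1 (j * N)) ≤ j := by
      rw [bar_le_iff]
      push_cast at h1
      omega
    rw [bar_neg_mul]
    omega
  have hm' : ∀ i, max m (d * N + 1) ≤ i → k.1.1 i = -(i : ℤ) :=
    fun i hi => hm i ((le_max_left _ _).trans hi)
  rw [siDegree_eq hm', Fin.sum_univ_eq_sum_range
    (fun i : ℕ => bar N (-(i : ℤ)) - bar N (k.1.1 i))] at hk
  have hinj : Function.Injective fun j : ℕ => j * N := fun a b e =>
    Nat.eq_of_mul_eq_mul_right hN e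
  have hsub : (Finset.range (d + 1)).image (fun j => j * N) ⊆
      Finset.range (max m (d * N + 1)) := by
    intro x hx
    obtain ⟨j, hj, rfl⟩ := Finset.mem_image.mp hx
    rw [Finset.mem_range] at hj ⊢
    have := Nat.mul_le_mul_right N (Nat.lt_succ_iff.mp hj)
    have := le_max_right m (d * N + 1)
    omega
  have h1 := Finset.sum_le_sum_of_subset_of_nonneg
    (f := fun i : ℕ => bar N (-(i : ℤ)) - bar N (k.1.1 i)) hsub
    fun i _ _ => sub_nonneg.mpr (k.bar_le i)
  rw [hk, Finset.sum_image fun a _ b _ e => hinj e] at h1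
  have h2 := Finset.card_nsmul_le_sum (Finset.range (d + 1))
    (fun j => bar N (-((j * N : ℕ) : ℤ)) - bar N (k.1.1 (j * N))) 1
    fun j hj => hpos j (Nat.lt_succ_iff.mp (Finset.mem_range.mp hj))
  rw [Finset.card_range, nsmul_eq_mul, mul_one] at h2
  push_cast at h2
  have h3 := h2.trans h1
  omega

theorem fockDeg_eq (N d : ℕ) : fockDeg N d =
    Submodule.span ℂ ((fun k : AntiSeq => siWedge k.1) '' {k | siDegree N k.1 = d}) := by
  rw [fockDeg]
  congr 1
  ext x
  constructor
  · rintro ⟨k, ⟨h1, h2⟩, rfl⟩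
    exact ⟨⟨k, h1⟩, h2, rfl⟩
  · rintro ⟨k, h, rfl⟩
    exact ⟨k.1, ⟨k.2, h⟩, rfl⟩

theorem isInternal_fockDeg (N : ℕ) [NeZero N] : DirectSum.IsInternal fun d : ℕ => fockDeg N d := by
  refine DirectSum.isInternal_submodule_of_iSupIndep_of_iSup_eq_top ?_ ?_
  · intro d
    have h : ⨆ j, ⨆ (_ : j ≠ d), fockDeg N j = Submodule.span ℂ
        ((fun k : AntiSeq => siWedge k.1) '' ⋃ j : ℕ, ⋃ (_ : j ≠ d), {k | siDegree N k.1 = j}) := by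
      simp only [fockDeg_eq, Set.image_iUnion, Submodule.span_iUnion]
    simp only [h]
    rw [fockDeg_eq]
    refine siWedge_linearIndependent.disjoint_span_image ?_
    rw [Set.disjoint_left]
    intro k hk hk'
    simp only [Set.mem_iUnion, Set.mem_ofPred_eq] at hk hk'
    obtain ⟨j, hj, hjk⟩ := hk'
    rw [hk] at hjk
    exact hj (by exact_mod_cast hjk.symm)
  · rw [eq_top_iff, ← span_siWedge, Submodule.span_le]
    rintro _ ⟨k, rfl⟩
    refine Submodule.mem_iSup_of_mem (siDegree N k.1).toNat ?_
    rw [fockDeg_eq]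
    exact Submodule.subset_span ⟨k, (Int.toNat_of_nonneg k.siDegree_nonneg).symm, rfl⟩

/-! ### Finite and semi-infinite sequences -/

theorem Seq.extend_apply {n : ℕ} (k : Seq n) (i : Fin n) : k.extend.1 i = k.1 i :=
  dif_pos i.2

theorem Seq.extend_of_le {n : ℕ} (k : Seq n) {i : ℕ} (hi : n ≤ i) : k.extend.1 i = -(i : ℤ) :=
  dif_neg (by omega)

theorem Seq.extend_strictAnti {n : ℕ} (k : Seq n) : StrictAnti k.extend.1 := by
  intro a b hab
  by_cases hb : b < n
  · rw [k.extend_apply ⟨b, hb⟩, k.extend_apply ⟨a, hab.trans hb⟩]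
    exact k.2.1 hab
  · rw [k.extend_of_le (by omega)]
    by_cases ha : a < n
    · rw [k.extend_apply ⟨a, ha⟩]
      have := k.2.2 ⟨a, ha⟩
      simp only at this
      omega
    · rw [k.extend_of_le (by omega)]
      omega

/-- The sequence `k` extended by `(-n, -n - 1, …)`, as a label of the basis of the Fock space. -/
def Seq.toAnti {n : ℕ} (k : Seq n) : AntiSeq := ⟨k.extend, k.extend_strictAnti⟩

theorem Seq.toAnti_injective {n : ℕ} : Function.Injective (Seq.toAnti (n := n)) := by
  intro k l h
  refine Subtype.ext (funext fun i => ?_)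
  rw [← k.extend_apply i, ← l.extend_apply i]
  exact congrArg (fun a : AntiSeq => a.1.1 i) h

theorem Seq.siDegree_extend {N n : ℕ} (k : Seq n) : siDegree N k.extend = k.degree N := by
  rw [siDegree_eq fun i hi => k.extend_of_le hi, Seq.degree]
  simp only [Seq.extend_apply]

/-- The first `n` entries of a strictly decreasing sequence. -/
def AntiSeq.restrict (n : ℕ) (k : AntiSeq) : Seq n :=
  ⟨fun i => k.1.1 i, fun _ _ h => k.2 h, fun i => k.neg_le i⟩

theorem AntiSeq.extend_restrict {n : ℕ} {k : AntiSeq} (hk : ∀ i, n ≤ i → k.1.1 i = -(i : ℤ)) :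
    (k.restrict n).extend = k.1 := by
  refine Subtype.ext (funext fun i => ?_)
  by_cases hi : i < n
  · exact (k.restrict n).extend_apply ⟨i, hi⟩
  · rw [Seq.extend_of_le _ (by omega), hk i (by omega)]

theorem Seq.take_extend {m n : ℕ} (h : n ≤ m) {k : Seq m}
    (hk : ∀ i : Fin m, n ≤ (i : ℕ) → k.1 i = -((i : ℕ) : ℤ)) : (k.take h).extend = k.extend := by
  refine Subtype.ext (funext fun i => ?_)
  by_cases hi : i < n
  · rw [(k.take h).extend_apply ⟨i, hi⟩, k.extend_apply ⟨i, by omega⟩]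
    rfl
  · rw [Seq.extend_of_le _ (by omega)]
    by_cases hi' : i < m
    · rw [k.extend_apply ⟨i, hi'⟩, hk ⟨i, hi'⟩ (by simp only; omega)]
    · rw [Seq.extend_of_le _ (by omega)]

theorem withTail_wedgeBasis (N : ℕ) [NeZero N] {n : ℕ} (k : Seq n) :
    withTail N n (wedgeBasis N n k) = siWedge k.extend := by
  rw [withTail, Module.Basis.constr_basis]

theorem withTail_injective (N : ℕ) [NeZero N] (n : ℕ) : Function.Injective (withTail N n) := by
  have h : LinearIndependent ℂ fun k : Seq n => siWedge k.extend :=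
    siWedge_linearIndependent.comp Seq.toAnti Seq.toAnti_injective
  have h' : withTail N n = Finsupp.linearCombination ℂ (fun k : Seq n => siWedge k.extend) ∘ₗ
      (wedgeBasis N n).repr.toLinearMap := by
    refine (wedgeBasis N n).ext fun k => ?_
    rw [withTail_wedgeBasis, LinearMap.comp_apply, LinearEquiv.coe_coe, Module.Basis.repr_self,
      Finsupp.linearCombination_single, one_smul]
  rw [h', LinearMap.coe_comp]
  exact Function.Injective.comp h (wedgeBasis N n).repr.injective

open Classical in
theorem proj_wedgeBasis (N : ℕ) [NeZero N] {m n : ℕ} (h : n ≤ m) (k : Seq m) :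
    proj N h (wedgeBasis N m k) =
      if ∀ i : Fin m, n ≤ (i : ℕ) → k.1 i = -((i : ℕ) : ℤ) then wedgeBasis N n (k.take h) else 0 := by
  rw [proj, Module.Basis.constr_basis]

theorem proj_proj (N : ℕ) [NeZero N] {l m n : ℕ} (h : m ≤ l) (h' : n ≤ m) (x : F0 N l) :
    proj N h' (proj N h x) = proj N (h'.trans h) x := by
  classical
  refine LinearMap.congr_fun (f := proj N h' ∘ₗ proj N h) (g := proj N (h'.trans h))
    ((wedgeBasis N l).ext fun k => ?_) x
  rw [LinearMap.comp_apply, proj_wedgeBasis, proj_wedgeBasis]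
  by_cases h1 : ∀ i : Fin l, n ≤ (i : ℕ) → k.1 i = -((i : ℕ) : ℤ)
  · rw [if_pos h1, if_pos fun i hi => h1 i (h'.trans hi), proj_wedgeBasis, if_pos]
    · rfl
    · exact fun i hi => h1 (Fin.castLE h i) hi
  · rw [if_neg h1]
    split_ifs with h2
    · rw [proj_wedgeBasis, if_neg]
      intro h3
      refine h1 fun i hi => ?_
      by_cases him : m ≤ (i : ℕ)
      · exact h2 i him
      · exact h3 ⟨i, by omega⟩ hi
    · exact map_zero _

/-- In degree d all entries beyond position dN ≤ rN are those of o, so the projection merely cuts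
off factors that the tail restores. -/
theorem withTail_proj (N : ℕ) [NeZero N] {d r l : ℕ} (hdr : d ≤ r) (h : r * N ≤ l * N)
    {x : F0 N (l * N)} (hx : x ∈ F0deg N (l * N) d) :
    withTail N (r * N) (proj N h x) = withTail N (l * N) x := by
  classical
  induction hx using Submodule.span_induction with
  | mem x hx =>
    obtain ⟨k, hk, rfl⟩ := hx
    have hk' : ∀ i : Fin (l * N), r * N ≤ (i : ℕ) → k.1 i = -((i : ℕ) : ℤ) := fun i hi => by
      rw [← k.extend_apply]
      exact AntiSeq.eq_of_siDegree (N := N) (k := k.toAnti) (d := d) (k.siDegree_extend.trans hk)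
        ((Nat.mul_le_mul_right N hdr).trans hi)
    rw [proj_wedgeBasis, if_pos hk', withTail_wedgeBasis, withTail_wedgeBasis,
      Seq.take_extend h hk']
  | zero => simp only [map_zero]
  | add x y _ _ hx hy => simp only [map_add, hx, hy]
  | smul c x _ hx => simp only [map_smul, hx]

theorem withTail_mem_fockDeg (N : ℕ) [NeZero N] {n d : ℕ} {x : F0 N n} (hx : x ∈ F0deg N n d) :
    withTail N n x ∈ fockDeg N d := by
  have : (F0deg N n d).map (withTail N n) ≤ fockDeg N d := by
    rw [F0deg, Submodule.map_span_le, fockDeg_eq]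
    rintro _ ⟨k, hk, rfl⟩
    rw [withTail_wedgeBasis]
    exact Submodule.subset_span ⟨k.toAnti, k.siDegree_extend.trans hk, rfl⟩
  exact this (Submodule.mem_map_of_mem hx)

/-! ### The inverse limits -/

theorem withTail_limitSpace (N : ℕ) [NeZero N] {d r : ℕ} (hr : d ≤ r) (g : limitSpace N d) :
    withTail N (r * N) (g.1 r) = upsilon N d g := by
  have h := withTail_proj N le_rfl (Nat.mul_le_mul_right N hr) (g.2.1 r)
  rw [g.2.2 d r hr] at h
  exact h.symm

/-- Components with r ≥ d are determined by their image in the Fock space; those with r < d are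
projections of them. -/
theorem upsilon_injective (N : ℕ) [NeZero N] (d : ℕ) : Function.Injective (upsilon N d) := by
  intro g g' hg
  have h : ∀ r, d ≤ r → g.1 r = g'.1 r := fun r hr => withTail_injective N (r * N) (by
    rw [withTail_limitSpace N hr g, withTail_limitSpace N hr g', hg])
  refine Subtype.ext (funext fun r => ?_)
  rw [← g.2.2 r (max d r) (le_max_right d r), ← g'.2.2 r (max d r) (le_max_right d r),
    h _ (le_max_left d r)]

open Classical in
/-- The components of the element of the inverse limit that corresponds to a wedge. -/
def limitWedge (N : ℕ) [NeZero N] (k : AntiSeq) (r : ℕ) : F0 N (r * N) :=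
  if ∀ i, r * N ≤ i → k.1.1 i = -(i : ℤ) then wedgeBasis N (r * N) (k.restrict (r * N)) else 0

theorem limitWedge_mem (N : ℕ) [NeZero N] {d : ℕ} {k : AntiSeq} (hk : siDegree N k.1 = d) :
    limitWedge N k ∈ limitSpace N d := by
  classical
  constructor
  · intro r
    rw [limitWedge]
    split_ifs with h
    · refine Submodule.subset_span ⟨_, ?_, rfl⟩
      rw [Set.mem_ofPred_eq, ← Seq.siDegree_extend, AntiSeq.extend_restrict h, hk]
    · exact zero_mem _
  · intro r l hrl
    have hrl' := Nat.mul_le_mul_right N hrl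
    rw [limitWedge, limitWedge]
    by_cases hr : ∀ i, r * N ≤ i → k.1.1 i = -(i : ℤ)
    · rw [if_pos hr, if_pos fun i hi => hr i (hrl'.trans hi), proj_wedgeBasis, if_pos]
      · rfl
      · exact fun i hi => hr i hi
    · rw [if_neg hr]
      split_ifs with hl
      · rw [proj_wedgeBasis, if_neg]
        intro h
        refine hr fun i hi => ?_
        by_cases hil : l * N ≤ i
        · exact hl i hil
        · exact h ⟨i, by omega⟩ hi
      · exact map_zero _

theorem range_upsilon (N : ℕ) [NeZero N] (d : ℕ) : LinearMap.range (upsilon N d) = fockDeg N d := by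
  classical
  apply le_antisymm
  · rintro _ ⟨g, rfl⟩
    exact withTail_mem_fockDeg N (g.2.1 d)
  · rw [fockDeg_eq, Submodule.span_le]
    rintro _ ⟨k, hk, rfl⟩
    refine ⟨⟨limitWedge N k, limitWedge_mem N hk⟩, ?_⟩
    have h : ∀ i, d * N ≤ i → k.1.1 i = -(i : ℤ) := fun i hi => AntiSeq.eq_of_siDegree hk hi
    change withTail N (d * N) (limitWedge N k d) = siWedge k.1
    rw [limitWedge, if_pos h, withTail_wedgeBasis, AntiSeq.extend_restrict h]

end SpinSutherland

end

noncomputable section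

namespace SpinSutherland

/-! ### The action of the Yangian -/

/-- The operator `T̄_{ab}^{(s)}(β; rN)` on `F⁰_{N,rN}`. -/
def tRes (N : ℕ) [NeZero N] (β : ℂ) (s : ℕ) (a b : Fin N) (r : ℕ) :
    Module.End ℂ (F0 N (r * N)) :=
  (tBar N β r s a b).restrict fun _ hx => tBar_mem_F0 N β r s a b hx

theorem tRes_coe (N : ℕ) [NeZero N] (β : ℂ) (s : ℕ) (a b : Fin N) (r : ℕ) (x : F0 N (r * N)) :
    (tRes N β s a b r x : Amb N (r * N)) = tBar N β r s a b x := rfl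

theorem tRes_mem_F0deg (N : ℕ) [NeZero N] (β : ℂ) (s : ℕ) (a b : Fin N) (r d : ℕ)
    {x : F0 N (r * N)} (hx : x ∈ F0deg N (r * N) d) : tRes N β s a b r x ∈ F0deg N (r * N) d :=
  tBar_mem_F0deg N β d r s a b hx _

theorem proj_tRes_succ (N : ℕ) [NeZero N] (β : ℂ) (s : ℕ) (a b : Fin N) (r : ℕ)
    (h : r * N ≤ (r + 1) * N) (x : F0 N ((r + 1) * N)) :
    proj N h (tRes N β s a b (r + 1) x) = tRes N β s a b r (proj N h x) :=
  Subtype.ext (proj_tBar N β r s a b h x _ rfl)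

theorem proj_comp_tRes (N : ℕ) [NeZero N] (β : ℂ) (s : ℕ) (a b : Fin N) (r : ℕ) :
    proj N (Nat.mul_le_mul_right N r.le_succ) ∘ₗ tRes N β s a b (r + 1) =
      tRes N β s a b r ∘ₗ proj N (Nat.mul_le_mul_right N r.le_succ) :=
  LinearMap.ext (proj_tRes_succ N β s a b r (Nat.mul_le_mul_right N r.le_succ))

theorem proj_tRes (N : ℕ) [NeZero N] (β : ℂ) (s : ℕ) (a b : Fin N) {r l : ℕ} (hrl : r ≤ l)
    (h : r * N ≤ l * N) (x : F0 N (l * N)) :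
    proj N h (tRes N β s a b l x) = tRes N β s a b r (proj N h x) := by
  induction l, hrl using Nat.le_induction with
  | base =>
    have hid : proj N h = LinearMap.id := (wedgeBasis N (r * N)).ext fun k => by
      classical
      rw [proj_wedgeBasis, if_pos fun i hi => absurd i.2 (by omega)]
      rfl
    rw [hid]
    rfl
  | succ l hl ih =>
    have h1 := Nat.mul_le_mul_right N (Nat.le_succ l)
    have h2 := Nat.mul_le_mul_right N hl
    rw [← proj_proj N h1 h2, proj_tRes_succ, ih, proj_proj]

/-- The operator `T_{ab}^{(s)}` on the inverse limit. -/
def limitT (N : ℕ) [NeZero N] (β : ℂ) (d s : ℕ) (a b : Fin N) :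
    Module.End ℂ (limitSpace N d) where
  toFun g := ⟨fun r => tRes N β s a b r (g.1 r), fun r => tRes_mem_F0deg N β s a b r d (g.2.1 r),
    fun r l h => by rw [proj_tRes N β s a b h, g.2.2 r l h]⟩
  map_add' g g' := Subtype.ext (funext fun r => map_add (tRes N β s a b r) (g.1 r) (g'.1 r))
  map_smul' c g := Subtype.ext (funext fun r => map_smul (tRes N β s a b r) c (g.1 r))

theorem limitT_coe (N : ℕ) [NeZero N] (β : ℂ) (d s : ℕ) (a b : Fin N) (g : limitSpace N d) (r : ℕ) :
    (limitT N β d s a b g).1 r = tRes N β s a b r (g.1 r) := rfl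

theorem limitSpace_ext {N : ℕ} [NeZero N] {d : ℕ} {g g' : limitSpace N d}
    (h : ∀ r, (g.1 r : Amb N (r * N)) = g'.1 r) : g = g' :=
  Subtype.ext (funext fun r => Subtype.ext (h r))

theorem limitT_zero (N : ℕ) [NeZero N] (β : ℂ) (d : ℕ) (a b : Fin N) :
    limitT N β d 0 a b = if a = b then 1 else 0 := by
  refine LinearMap.ext fun g => limitSpace_ext fun r => ?_
  rw [limitT_coe, tRes_coe, tBar_zero]
  split_ifs <;> rfl

/-- It brings the defining relation to a form without subtraction, as needed for targets that are
only assumed to be semirings. -/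
theorem sub_sub_sub_eq_iff {A : Type*} [AddCommGroup A] {a b c d e f : A} :
    a - b - (c - d) = e - f ↔ a + d + f = e + b + c := by
  constructor <;> intro h
  · have : a = e - f + (c - d) + b := by rw [← h]; abel
    rw [this]; abel
  · have : a = e + b + c - f - d := by rw [← h]; abel
    rw [this]; abel

theorem limitT_relation (N : ℕ) [NeZero N] (β : ℂ) (k r s : ℕ) (a b c d : Fin N) :
    limitT N β k (r + 1) a b * limitT N β k s c d +
        limitT N β k (s + 1) c d * limitT N β k r a b +
        limitT N β k r c b * limitT N β k s a d =
      limitT N β k s c b * limitT N β k r a d + limitT N β k s c d * limitT N β k (r + 1) a b +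
        limitT N β k r a b * limitT N β k (s + 1) c d := by
  refine LinearMap.ext fun g => limitSpace_ext fun l => ?_
  have h := (sub_sub_sub_eq_iff (A := Module.End ℂ (Amb N (l * N)))).mp
    (tBar_relation N β l r s a b c d)
  exact LinearMap.congr_fun h (g.1 l)

/-- The homomorphism from the Yangian with given images of the generators. -/
theorem exists_yangian_hom {N : ℕ} {A : Type*} [Semiring A] [Algebra ℂ A]
    (T : ℕ → Fin N → Fin N → A) (h0 : ∀ a b, T 0 a b = if a = b then 1 else 0)
    (hT : ∀ r s a b c d, T (r + 1) a b * T s c d + T (s + 1) c d * T r a b + T r c b * T s a d =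
      T s c b * T r a d + T s c d * T (r + 1) a b + T r a b * T (s + 1) c d) :
    ∃ ρ : Yangian N →ₐ[ℂ] A, ∀ s a b, ρ (yT N s a b) = T s a b := by
  -- Negation is multiplication by the scalar -1.
  let _ : Ring A := Algebra.semiringToRing ℂ
  let φ : FreeAlgebra ℂ (ℕ × Fin N × Fin N) →ₐ[ℂ] A :=
    FreeAlgebra.lift ℂ fun x => T (x.1 + 1) x.2.1 x.2.2
  have hφ : ∀ s a b, φ (freeT N s a b) = T s a b := by
    intro s a b
    cases s with
    | zero =>
      rw [h0, freeT]
      split_ifs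
      · exact map_one φ
      · exact map_zero φ
    | succ s => exact FreeAlgebra.lift_ι_apply _ _
  refine ⟨RingQuot.liftAlgHom ℂ ⟨φ, ?_⟩, fun s a b => ?_⟩
  · rintro _ _ ⟨r, s, a, b, c, d⟩
    simp only [map_sub, map_mul, hφ]
    exact sub_sub_sub_eq_iff.mpr (hT r s a b c d)
  · rw [yT, RingQuot.liftAlgHom_mkAlgHom_apply, hφ]

theorem yangian_hom_ext {N : ℕ} {A : Type*} [Semiring A] [Algebra ℂ A] {ρ σ : Yangian N →ₐ[ℂ] A}
    (h : ∀ s a b, ρ (yT N s a b) = σ (yT N s a b)) : ρ = σ :=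
  RingQuot.ringQuot_ext' ℂ _ _ (FreeAlgebra.hom_ext (funext fun x => h (x.1 + 1) x.2.1 x.2.2))

theorem existsUnique_limit_action (N : ℕ) [NeZero N] (β : ℂ) (d : ℕ) :
    ∃! ρ : Yangian N →ₐ[ℂ] Module.End ℂ (limitSpace N d),
      ∀ (s : ℕ) (a b : Fin N) (g : limitSpace N d) (r : ℕ),
        (ρ (yT N s a b) g).1 r = tRes N β s a b r (g.1 r) := by
  obtain ⟨ρ, hρ⟩ := exists_yangian_hom (limitT N β d) (limitT_zero N β d) (limitT_relation N β d)
  refine ⟨ρ, fun s a b g r => by rw [hρ, limitT_coe], fun σ hσ => yangian_hom_ext fun s a b => ?_⟩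
  refine LinearMap.ext fun g => Subtype.ext (funext fun r => ?_)
  rw [hσ, hρ, limitT_coe]

/-- Each summand is identified with a homogeneous component, and the Fock space is the internal
direct sum of these components. -/
theorem upsilon_bijective (N : ℕ) [NeZero N] : Function.Bijective
    (DirectSum.toModule ℂ ℕ Fock (upsilon N) : (DirectSum ℕ fun d => limitSpace N d) →ₗ[ℂ] Fock) := by
  let e : ∀ d, limitSpace N d ≃ₗ[ℂ] fockDeg N d := fun d =>
    LinearEquiv.ofBijective ((upsilon N d).codRestrict (fockDeg N d) fun g =>
      withTail_mem_fockDeg N (g.2.1 d))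
      ⟨fun g g' h => upsilon_injective N d (congrArg Subtype.val h), fun x => by
        obtain ⟨g, hg⟩ := (range_upsilon N d).ge x.2
        exact ⟨g, Subtype.ext hg⟩⟩
  have h : (DirectSum.toModule ℂ ℕ Fock (upsilon N) :
      (DirectSum ℕ fun d => limitSpace N d) →ₗ[ℂ] Fock) =
      DirectSum.coeLinearMap (fun d => fockDeg N d) ∘ₗ
        (DFinsupp.mapRange.linearEquiv e).toLinearMap := by
    refine DirectSum.linearMap_ext ℂ fun d => LinearMap.ext fun g => ?_
    rw [LinearMap.comp_apply, LinearMap.comp_apply, LinearMap.comp_apply, DirectSum.toModule_lof]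
    have h1 : (DFinsupp.mapRange.linearEquiv e).toLinearMap
        (DirectSum.lof ℂ ℕ (fun d => limitSpace N d) d g) =
        DirectSum.lof ℂ ℕ (fun d => fockDeg N d) d (e d g) :=
      DFinsupp.mapRange_single (hf := fun i => map_zero (e i))
    rw [h1, DirectSum.coeLinearMap_lof]
    rfl
  rw [h, LinearMap.coe_comp]
  exact (isInternal_fockDeg N).comp (DFinsupp.mapRange.linearEquiv e).bijective

/-- The images of the inverse limits span the Fock space; this gives both the relations and the
uniqueness of the action. -/
theorem fock_hom_ext (N : ℕ) [NeZero N] {f g : Module.End ℂ Fock}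
    (h : ∀ d x, f (upsilon N d x) = g (upsilon N d x)) : f = g := by
  have htop := (isInternal_fockDeg N).submodule_iSup_eq_top
  refine LinearMap.ext fun x => ?_
  have hx : x ∈ ⨆ d, fockDeg N d := by rw [htop]; trivial
  induction hx using Submodule.iSup_induction' with
  | mem d x hx =>
    rw [← range_upsilon] at hx
    obtain ⟨y, rfl⟩ := hx
    exact h d y
  | zero => rw [map_zero, map_zero]
  | add x y _ _ hx hy => rw [map_add, map_add, hx, hy]

theorem existsUnique_fock_action (N : ℕ) [NeZero N] (β : ℂ) :
    ∃! σ : Yangian N →ₐ[ℂ] Module.End ℂ Fock,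
      ∀ (d s : ℕ) (a b : Fin N) (g : limitSpace N d) (r : ℕ), d ≤ r →
        σ (yT N s a b) (withTail N (r * N) (g.1 r)) =
          withTail N (r * N) (tRes N β s a b r (g.1 r)) := by
  let e : (DirectSum ℕ fun d => limitSpace N d) ≃ₗ[ℂ] Fock := LinearEquiv.ofBijective _ (upsilon_bijective N)
  have he : ∀ d (g : limitSpace N d), e (DirectSum.lof ℂ ℕ (fun d => limitSpace N d) d g) =
      upsilon N d g := fun d g => DirectSum.toModule_lof _ _ _
  -- The operators on the direct sum of the inverse limits, transported along the isomorphism with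
  -- the Fock space.
  let T : ℕ → Fin N → Fin N → Module.End ℂ Fock := fun s a b =>
    e.toLinearMap ∘ₗ DirectSum.lmap (fun d => limitT N β d s a b) ∘ₗ e.symm.toLinearMap
  have hT : ∀ s a b d (g : limitSpace N d),
      T s a b (upsilon N d g) = upsilon N d (limitT N β d s a b g) := by
    intro s a b d g
    change e (DirectSum.lmap (fun d => limitT N β d s a b) (e.symm (upsilon N d g))) = _
    rw [← he, e.symm_apply_apply, DirectSum.lmap_lof, he]
  obtain ⟨σ, hσ⟩ := exists_yangian_hom T (fun a b => fock_hom_ext N fun d x => by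
      rw [hT, limitT_zero]
      split_ifs
      · rfl
      · exact map_zero _) (fun r s a b c d => fock_hom_ext N fun k x => by
      have := congrArg (fun f => upsilon N k (f x)) (limitT_relation N β k r s a b c d)
      simpa only [LinearMap.add_apply, Module.End.mul_apply, hT, map_add] using this)
  have key : ∀ (d s : ℕ) (a b : Fin N) (g : limitSpace N d) (r : ℕ), d ≤ r →
      upsilon N d (limitT N β d s a b g) = withTail N (r * N) (tRes N β s a b r (g.1 r)) :=
    fun d s a b g r hr => (withTail_limitSpace N hr _).symm
  refine ⟨σ, fun d s a b g r hr => ?_, fun σ' hσ' => yangian_hom_ext fun s a b =>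
    fock_hom_ext N fun d g => ?_⟩
  · rw [withTail_limitSpace N hr, hσ, hT, key d s a b g r hr]
  · have h := hσ' d s a b g d le_rfl
    rw [withTail_limitSpace N le_rfl] at h
    rw [h, hσ, hT, key d s a b g d le_rfl]

end SpinSutherland

end
open SpinSutherland in
theorem mainTheorem7 (N : ℕ) [NeZero N] (β : ℂ) (hβ : β ≠ 0) :
    -- the coefficients of the series act on `F_{N,rN}`
    (∀ (r s : ℕ) (a b : Fin N), ∀ x ∈ stateSpace N (r * N),
      tBar N β r s a b x ∈ stateSpace N (r * N)) ∧
    -- and leave `F⁰_{N,rN}` invariant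
    ∃ hinv : ∀ (r s : ℕ) (a b : Fin N), ∀ x ∈ F0 N (r * N),
        tBar N β r s a b x ∈ F0 N (r * N),
      -- they preserve the homogeneous degree
      (∀ (d r s : ℕ) (a b : Fin N), ∀ x ∈ F0deg N (r * N) d,
        (tBar N β r s a b).restrict (hinv r s a b) x ∈ F0deg N (r * N) d) ∧
      -- intertwining relations
      (∀ (r s : ℕ) (a b : Fin N),
        proj N (Nat.mul_le_mul_right N r.le_succ) ∘ₗ
            (tBar N β (r + 1) s a b).restrict (hinv (r + 1) s a b) =
          (tBar N β r s a b).restrict (hinv r s a b) ∘ₗ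
            proj N (Nat.mul_le_mul_right N r.le_succ)) ∧
      -- the action of the Yangian on the inverse limits
      (∀ d : ℕ, ∃! ρ : Yangian N →ₐ[ℂ] Module.End ℂ (limitSpace N d),
        ∀ (s : ℕ) (a b : Fin N) (g : limitSpace N d) (r : ℕ),
          (ρ (yT N s a b) g).1 r = (tBar N β r s a b).restrict (hinv r s a b) (g.1 r)) ∧
      -- the inverse limits are the homogeneous components of the Fock space
      (∀ d : ℕ, Function.Injective (upsilon N d) ∧
        LinearMap.range (upsilon N d) = fockDeg N d ∧
        ∀ (r : ℕ), d ≤ r → ∀ g : limitSpace N d,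
          withTail N (r * N) (g.1 r) = upsilon N d g) ∧
      DirectSum.IsInternal (fun d : ℕ => fockDeg N d) ∧
      -- the action of the Yangian on the Fock space
      ∃! σ : Yangian N →ₐ[ℂ] Module.End ℂ Fock,
        ∀ (d s : ℕ) (a b : Fin N) (g : limitSpace N d) (r : ℕ), d ≤ r →
          σ (yT N s a b) (withTail N (r * N) (g.1 r)) =
            withTail N (r * N) ((tBar N β r s a b).restrict (hinv r s a b) (g.1 r)) := by
  refine ⟨fun r s a b x hx => tBar_mem_stateSpace N β r s a b hx,
    fun r s a b x hx => tBar_mem_F0 N β r s a b hx,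
    fun d r s a b x hx => tRes_mem_F0deg N β s a b r d hx,
    fun r s a b => proj_comp_tRes N β s a b r,
    fun d => existsUnique_limit_action N β d,
    fun d => ⟨upsilon_injective N d, range_upsilon N d,
      fun r hr g => withTail_limitSpace N hr g⟩,
    isInternal_fockDeg N, existsUnique_fock_action N β⟩
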